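/- For $n\ge 0$ write $[n]=\{1,\dots,n\}$. A *sequence arrangement* of length $r$ is a subset $\alpha\subseteq[r]^2$ such that for all $(i,j),(i',j')\in\alpha$ one has $i\le i'$ if and only if $j\le j'$; its degree is $|\alpha|$, and $\mathcal A[n,k]$ denotes the set of sequence arrangements of length $n$ and degree $k$. Viewed as the edge set of a directed graph on $[r]$, a sequence arrangement is a disjoint union of loops and chains (directed paths, an isolated vertex being a chain with one vertex). A *chain type* of length $r$ is a pair $\tau=(\nu,\mu)$ of an integer $\nu\ge 0$ and an integer partition $\mu$ with $\nu+|\mu|=r$; its rank is $\mathrm{rk}(\tau)=\nu$ and its degree is $\deg(\tau)=r-\mathrm{len}(\mu)$, where $\mathrm{len}(\mu)$ is the number of parts of $\mu$. Let $\mathcal A(\tau)$ be the set of sequence arrangements of length $r$ whose graph has exactly $\nu$ loops and, for every $j$, has as many chains with $j$ vertices as $\mu$ has parts equal to $j$. A *relative order* for $(a,b)$ is a relation $R\subseteq[a]\times[b]$ such that $j_1\le i_1$, $i_2\le j_2$ and $i_1Ri_2$ imply $j_1Rj_2$. For sequence arrangements $\alpha$ of length $a$ and $\gamma$ of length $b$,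 let $\mathcal R(\alpha,\gamma)$ be the set of relative orders $R$ for $(a,b)$ such that for all $(i_1,j_1)\in\alpha$ and $(i_2,j_2)\in\gamma$ one has $i_1Ri_2$ if and only if $j_1Rj_2$. For $n,k\ge0$ put $$h^\tau(n,k)=\sum_{\alpha\in\mathcal A(\tau)}\ \sum_{\gamma\in\mathcal A[n,k]}|\mathcal R(\alpha,\gamma)|,\qquad H^\tau=\sum_{j,k\ge0}h^\tau(j+k,k)\,x^jy^k\in\mathbb Z[[x,y]].$$ Let $Q=\sqrt{(1-x-y)^2-4xy}$ be the power series square root with constant term $1$, and let $$u=\frac{1+x-y+Q}{2Q},\qquad v=\frac{1-x+y-Q}{2Q},\qquad \eta=\frac{y}{Q^2}.$$ **Theorem.** Let $\tau$ be a chain type of length $r\ge0$, degree $d$ and rank $\nu$. Then there exists a polynomial $P^\tau\in\mathbb Z[z,w]$ of total degree $r-d$ such that $$H^\tau=\eta^{\nu-d}\,u^{r-d}\,v^{r-\nu}\,P^\tau\!\left(-\frac1u,\frac1v\right)Q^{-1-d}$$ (an identity of formal power series, the right-hand side being computed in the fraction field of $\mathbb Q[[x,y]]$). Moreover, $P^\tau=1$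 if $d=r$, and $2(w+1)$ divides $P^\tau$ in $\mathbb Z[z,w]$ if $\nu<d$. -/

import Mathlib

open Finset

/-- `α ⊆ [r]²` is a sequence arrangement of length `r`: for all `(i, j), (i', j') ∈ α`,
`i ≤ i'` if and only if `j ≤ j'`. -/
def IsSeqArrangement {r : ℕ} (α : Finset (Fin r × Fin r)) : Prop :=
  ∀ p ∈ α, ∀ q ∈ α, p.1 ≤ q.1 ↔ p.2 ≤ q.2

open scoped Classical in
/-- The set of sequence arrangements of length `n` and degree (number of elements) `k`. -/
noncomputable def seqArrangements (n k : ℕ) : Finset (Finset (Fin n × Fin n)) :=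
  univ.filter fun γ => IsSeqArrangement γ ∧ γ.card = k

/-- A chain type of length `r`: a pair `(ν, μ)` of a nonnegative integer and an integer partition
such that `ν + |μ| = r`. -/
structure ChainType (r : ℕ) where
  /-- the rank `ν` -/
  rank : ℕ
  /-- the size `|μ|` of the partition `μ` -/
  size : ℕ
  /-- the partition `μ` -/
  partition : size.Partition
  rank_add_size : rank + size = r

/-- The `j`-multiplicity of a chain type: the number of parts of `μ` equal to `j`. -/
def ChainType.mult {r : ℕ} (τ : ChainType r) (j : ℕ) : ℕ := τ.partition.parts.count j

/-- The degree `r - len(μ)` of a chain type. (The number of parts of `μ` is at most `r`, so the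
subtraction does not truncate.) -/
def ChainType.degree {r : ℕ} (τ : ChainType r) : ℕ := r - τ.partition.parts.card

theorem ChainType.card_parts_le {r : ℕ} (τ : ChainType r) : τ.partition.parts.card ≤ r := by
  have h : τ.partition.parts.card • 1 ≤ τ.partition.parts.sum :=
    Multiset.card_nsmul_le_sum fun x hx => τ.partition.parts_pos hx
  have h1 := τ.partition.parts_sum
  have h2 := τ.rank_add_size
  simp only [smul_eq_mul, mul_one] at h
  omega

/-- The number of loops in the directed graph with vertex set `[r]` and edge set `α`. -/
def numLoops {r : ℕ} (α : Finset (Fin r × Fin r)) : ℕ :=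
  (univ.filter fun i : Fin r => (i, i) ∈ α).card

/-- `l` lists, in order, the vertices of a chain of the directed graph with vertex set `[r]` and
edge set `α`: a nonempty directed path which no edge enters at its first vertex and which no edge
leaves at its last vertex. In the graph of a sequence arrangement every vertex has at most one
incoming and at most one outgoing edge, so that these paths are exactly the connected components
that are chains; a single vertex without edges is a chain of size `1`. -/
def IsChainOf {r : ℕ} (α : Finset (Fin r × Fin r)) (l : List (Fin r)) : Prop :=
  l ≠ [] ∧ l.Nodup ∧ l.IsChain (fun i j => (i, j) ∈ α) ∧
    (∀ i ∈ l.head?, ∀ k, (k, i) ∉ α) ∧ (∀ i ∈ l.getLast?, ∀ k, (i, k) ∉ α)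

/-- The number of chains with exactly `j` vertices in the graph of `α`. -/
noncomputable def numChains {r : ℕ} (α : Finset (Fin r × Fin r)) (j : ℕ) : ℕ :=
  {l : List (Fin r) | IsChainOf α l ∧ l.length = j}.ncard

open scoped Classical in
/-- The set `𝒜(τ)` of sequence arrangements of length `r` with chain type `τ`. -/
noncomputable def arrangementsOfType {r : ℕ} (τ : ChainType r) :
    Finset (Finset (Fin r × Fin r)) :=
  univ.filter fun α => IsSeqArrangement α ∧ numLoops α = τ.rank ∧ ∀ j, numChains α j = τ.mult j

/-- `R ⊆ [a] × [b]` is a relative order for `(a, b)`. -/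
def IsRelOrder {a b : ℕ} (R : Finset (Fin a × Fin b)) : Prop :=
  ∀ i₁ j₁ : Fin a, ∀ i₂ j₂ : Fin b, j₁ ≤ i₁ → i₂ ≤ j₂ → (i₁, i₂) ∈ R → (j₁, j₂) ∈ R

open scoped Classical in
/-- The set `ℛ(α, γ)` of relative orders `R` such that, for all `(i₁, j₁) ∈ α` and
`(i₂, j₂) ∈ γ`, one has `i₁ R i₂` if and only if `j₁ R j₂`. -/
noncomputable def relOrders {a b : ℕ} (α : Finset (Fin a × Fin a)) (γ : Finset (Fin b × Fin b)) :
    Finset (Finset (Fin a × Fin b)) :=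
  univ.filter fun R => IsRelOrder R ∧
    ∀ p ∈ α, ∀ q ∈ γ, (p.1, q.1) ∈ R ↔ (p.2, q.2) ∈ R

/-- `h^τ(n, k)`, the sum of `|ℛ(α, γ)|` over arrangements `α` of chain type `τ` and arrangements
`γ` of length `n` and degree `k`. -/
noncomputable def hCount {r : ℕ} (τ : ChainType r) (n k : ℕ) : ℕ :=
  ∑ α ∈ arrangementsOfType τ, ∑ γ ∈ seqArrangements n k, (relOrders α γ).card

/-- The generating function `H^τ = ∑_{j,k ≥ 0} h^τ(j+k, k) x^j y^k` in `ℤ⟦x, y⟧`, where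
`x` is the variable `0` and `y` is the variable `1`. -/
noncomputable def genH {r : ℕ} (τ : ChainType r) : MvPowerSeries (Fin 2) ℤ :=
  fun e => (hCount τ (e 0 + e 1) (e 1) : ℤ)

/-- The power series `(1 - x - y)² - 4xy` in `ℚ⟦x, y⟧`. -/
noncomputable def discr : MvPowerSeries (Fin 2) ℚ :=
  (1 - MvPowerSeries.X 0 - MvPowerSeries.X 1) ^ 2 - 4 * MvPowerSeries.X 0 * MvPowerSeries.X 1

/-- `Q = √((1 - x - y)² - 4xy)` in `ℚ⟦x, y⟧`, obtained by substituting
`(1 - x - y)² - 4xy - 1` for `t` in the binomial series `(1 + t)^(1/2)`. It is the unique square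
root with constant term `1`, see the three facts below. -/
noncomputable def serQ : MvPowerSeries (Fin 2) ℚ :=
  (PowerSeries.binomialSeries ℚ (1 / 2 : ℚ)).subst (discr - 1)

theorem constantCoeff_discr : MvPowerSeries.constantCoeff discr = 1 := by
  simp [discr]

theorem hasSubst_discr : PowerSeries.HasSubst (discr - 1) :=
  PowerSeries.HasSubst.of_constantCoeff_zero (by rw [map_sub, constantCoeff_discr]; simp)

theorem serQ_sq : serQ ^ 2 = discr := by
  have h := PowerSeries.binomialSeries_add (A := ℚ) (1 / 2 : ℚ) (1 / 2)
  have h1 := PowerSeries.binomialSeries_nat (R := ℚ) (A := ℚ) 1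
  have h2 : (1 / 2 : ℚ) + 1 / 2 = ((1 : ℕ) : ℚ) := by norm_num
  rw [h2, h1, pow_one] at h
  rw [serQ, sq, ← PowerSeries.subst_mul hasSubst_discr, ← h,
    PowerSeries.subst_add hasSubst_discr, PowerSeries.subst_X hasSubst_discr,
    ← PowerSeries.coe_substAlgHom hasSubst_discr, map_one]
  ring

theorem constantCoeff_serQ : MvPowerSeries.constantCoeff serQ = 1 := by
  have h := PowerSeries.constantCoeff_subst_eq_zero (a := discr - 1)
    (by rw [map_sub, constantCoeff_discr]; simp)
    (PowerSeries.binomialSeries ℚ (1 / 2 : ℚ) - 1)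
    (by rw [map_sub, PowerSeries.binomialSeries_constantCoeff]; simp)
  rw [← PowerSeries.coe_substAlgHom hasSubst_discr, map_sub, map_one,
    PowerSeries.coe_substAlgHom, map_sub, map_one] at h
  exact sub_eq_zero.mp h

theorem serQ_unique (F : MvPowerSeries (Fin 2) ℚ) (hF : F ^ 2 = discr)
    (h1 : MvPowerSeries.constantCoeff F = 1) : F = serQ := by
  rcases sq_eq_sq_iff_eq_or_eq_neg.mp (hF.trans serQ_sq.symm) with h | h
  · exact h
  · have h2 := congrArg MvPowerSeries.constantCoeff h
    rw [map_neg, h1, constantCoeff_serQ] at h2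
    norm_num at h2

/-- The fraction field of `ℚ⟦x, y⟧`. -/
abbrev SeriesField : Type := FractionRing (MvPowerSeries (Fin 2) ℚ)

/-- The inclusion of `ℚ⟦x, y⟧` into its fraction field. -/
noncomputable def toField : MvPowerSeries (Fin 2) ℚ →+* SeriesField :=
  algebraMap (MvPowerSeries (Fin 2) ℚ) SeriesField

/-- The inclusion of `ℤ⟦x, y⟧` into the fraction field of `ℚ⟦x, y⟧`. -/
noncomputable def intToField : MvPowerSeries (Fin 2) ℤ →+* SeriesField :=
  toField.comp (MvPowerSeries.map (Int.castRingHom ℚ))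

/-- `x` in the field. -/
noncomputable def fieldX : SeriesField := toField (MvPowerSeries.X 0)

/-- `y` in the field. -/
noncomputable def fieldY : SeriesField := toField (MvPowerSeries.X 1)

/-- `Q` in the field. -/
noncomputable def fieldQ : SeriesField := toField serQ

/-- `u = (1 + x - y + Q) / (2Q)`. -/
noncomputable def fieldU : SeriesField := (1 + fieldX - fieldY + fieldQ) / (2 * fieldQ)

/-- `v = (1 - x + y - Q) / (2Q)`. -/
noncomputable def fieldV : SeriesField := (1 - fieldX + fieldY - fieldQ) / (2 * fieldQ)

/-- `η = y / Q²`. -/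
noncomputable def fieldEta : SeriesField := fieldY / fieldQ ^ 2

/-! A relative order for `(a, b)` is the same thing as a shuffle of `[a]` and `[b]` into one line,
and the compatibility condition in `relOrders` says that the union of `α` and `γ`, placed on that
line, is again a sequence arrangement. Hence `h^τ` counts two-coloured arrangements on one line
(`hCount_eq`): the marked colour has chain type `τ`, and in the other colour `x` records the
vertices that no edge enters and `y` the edges.

Edges preserve the order, so when the line is read from left to right the chains awaiting
continuation form a first-in first-out queue: only the head of the queue can be joined to the next
vertex. Backward edges are reduced to forward ones by reversing all edges. Give a marked chain with
`j` vertices the weight `X T_j` and a marked loop the weight `X T_0`. The sum over all continuations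
of a queue then obeys a linear recursion (`sum_arrWeight`, `queueTotal_succ`), which is solved by a
product `A ∏ V(c, k)` over the entries `(c, k)` of the queue (`QueueSolution`). Comparing orders in
the number of vertices identifies `A` with the generating function (`coef_eq_hCount`).

The unknowns `V` are determined by the single series `W = 1 - ∑_b (s b 1 + V b 1)`. Without marked
components `W = (v+1)Q`, where `(u+v)Q = 1`, `x = u(u-1)Q²` and `y = v(v+1)Q²`. In general `W =
(v+1)Q(1 + X f)`, where `f` is the fixed point of an `X`-adic contraction, and `1/(QA)` is an affine
expression in `X f`, `X T_1` and `X T_0` (`exists_queueSolution`).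

With `z = -1/u` and `w = 1/v`, rescaling `f` and the `T_j` turns these equations into equations over
`ℤ[z, w]` (`map_toField_eq`, `map_recipSeries`). The coefficient of the monomial of `τ` in their
solution is `P^τ`, and the scaling factors produce the powers of `η`, `u`, `v` and `Q`
(`intToField_genH`).

The degree bound holds because each linear coefficient in `z, w` and the loop variable come with a
factor `X`. The bound is attained because otherwise the constant term of `H^τ`, the number of
arrangements of type `τ`, would vanish. Modulo `2(w+1)` the reciprocal series involves only `T_0`
and `T_1`, whence the divisibility; if only loops occur it reduces to `1 - X T_0`, whence `P^τ = 1`.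
-/

/-! ### Reachability and chain lengths in a graph -/

/-- `w` is reachable from `v` along the edges in `β`. -/
def Reach {ι : Type*} (β : Finset (ι × ι)) : ι → ι → Prop :=
  Relation.ReflTransGen fun a b => (a, b) ∈ β

open scoped Classical in
/-- The sum of `κ` over the vertices which are reachable from `v`. -/
noncomputable def chainLen {ι : Type*} [Fintype ι] (β : Finset (ι × ι)) (κ : ι → ℕ) (v : ι) : ℕ :=
  ∑ w with Reach β v w, κ w

theorem Reach.eq_of_not_target {ι : Type*} {β : Finset (ι × ι)} {u q : ι}
    (h : Reach β u q) (hq : ∀ w, (w, q) ∉ β) : u = q := by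
  rcases Relation.ReflTransGen.cases_tail h with h | ⟨c, -, hc⟩
  · exact h.symm
  · exact absurd hc (hq c)

theorem Reach.eq_of_not_source {ι : Type*} {β : Finset (ι × ι)} {u q : ι}
    (h : Reach β u q) (hq : ∀ w, (u, w) ∉ β) : u = q := by
  rcases Relation.ReflTransGen.cases_head h with h | ⟨c, hc, -⟩
  · exact h
  · exact absurd hc (hq c)

section
variable {ι : Type*} [DecidableEq ι] {β : Finset (ι × ι)} {q v : ι}

/-- No edge enters `q`, so a path starting elsewhere never meets the new edge. -/
theorem reach_insert_of_ne (hq : ∀ w, (w, q) ∉ β) {u : ι} (hu : u ≠ q) (w : ι) :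
    Reach (insert (q, v) β) u w ↔ Reach β u w := by
  constructor
  · intro h
    induction h with
    | refl => exact Relation.ReflTransGen.refl
    | tail _ hbc ih =>
      rcases Finset.mem_insert.mp hbc with h | h
      · obtain ⟨rfl, rfl⟩ := Prod.mk.inj h
        exact absurd (ih.eq_of_not_target hq) hu
      · exact ih.tail h
  · exact fun h => Relation.ReflTransGen.mono (fun a b hab => Finset.mem_insert_of_mem hab) _ _ h

theorem reach_insert_self (hq : ∀ w, (w, q) ∉ β) (hq' : ∀ w, (q, w) ∉ β) (hv : v ≠ q) (w : ι) :
    Reach (insert (q, v) β) q w ↔ q = w ∨ Reach β v w := by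
  constructor
  · intro h
    rcases Relation.ReflTransGen.cases_head h with h | ⟨c, hc, h⟩
    · exact Or.inl h
    · rcases Finset.mem_insert.mp hc with h1 | h1
      · obtain ⟨-, rfl⟩ := Prod.mk.inj h1
        exact Or.inr ((reach_insert_of_ne hq hv w).mp h)
      · exact absurd h1 (hq' c)
  · rintro (rfl | h)
    · exact Relation.ReflTransGen.refl
    · exact Relation.ReflTransGen.head (Finset.mem_insert_self _ _)
        ((reach_insert_of_ne hq hv w).mpr h)

variable [Fintype ι]

theorem chainLen_insert_of_ne (hq : ∀ w, (w, q) ∉ β) (κ : ι → ℕ) {u : ι} (hu : u ≠ q) :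
    chainLen (insert (q, v) β) κ u = chainLen β κ u := by
  classical
  exact Finset.sum_congr (Finset.filter_congr fun w _ => reach_insert_of_ne hq hu w) fun _ _ => rfl

theorem chainLen_insert_self (hq : ∀ w, (w, q) ∉ β) (hq' : ∀ w, (q, w) ∉ β) (hv : v ≠ q)
    (κ : ι → ℕ) : chainLen (insert (q, v) β) κ q = κ q + chainLen β κ v := by
  classical
  simp only [chainLen, reach_insert_self hq hq' hv]
  rw [Finset.filter_or, Finset.filter_eq, if_pos (Finset.mem_univ _), Finset.sum_union,
    Finset.sum_singleton]
  rw [Finset.disjoint_singleton_left]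
  intro h
  exact hv ((Finset.mem_filter.mp h).2.eq_of_not_target hq)

theorem chainLen_of_not_source (hq : ∀ w, (q, w) ∉ β) (κ : ι → ℕ) : chainLen β κ q = κ q := by
  classical
  have : ∀ w, Reach β q w ↔ q = w := fun w =>
    ⟨fun h => h.eq_of_not_source hq, fun h => h ▸ Relation.ReflTransGen.refl⟩
  simp only [chainLen, this]
  rw [Finset.filter_eq, if_pos (Finset.mem_univ _), Finset.sum_singleton]

theorem chainLen_update_of_ne (hv : ∀ w, (w, v) ∉ β) (κ : ι → ℕ) (k : ℕ) {u : ι} (hu : u ≠ v) :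
    chainLen β (Function.update κ v k) u = chainLen β κ u := by
  classical
  refine Finset.sum_congr rfl fun w hw => Function.update_of_ne ?_ _ _
  rintro rfl
  exact hu ((Finset.mem_filter.mp hw).2.eq_of_not_target hv)

theorem chainLen_update_self (κ : ι → ℕ) (k : ℕ) :
    chainLen β (Function.update κ v (k + κ v)) v = k + chainLen β κ v := by
  classical
  have hv : v ∈ (univ.filter fun w => Reach β v w) :=
    Finset.mem_filter.mpr ⟨Finset.mem_univ _, Relation.ReflTransGen.refl⟩
  simp only [chainLen]
  rw [← Finset.add_sum_erase _ _ hv, ← Finset.add_sum_erase _ κ hv, Function.update_self, add_assoc]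
  congr 2
  exact Finset.sum_congr rfl fun w hw => Function.update_of_ne (Finset.ne_of_mem_erase hw) _ _

end

/-! ### Order matchings and their reversal -/

/-- The relation `β` is an order isomorphism between its sources and its targets. -/
def OrderMatching {ι : Type*} [LinearOrder ι] (β : Finset (ι × ι)) : Prop :=
  ∀ p ∈ β, ∀ q ∈ β, p.1 ≤ q.1 ↔ p.2 ≤ q.2

namespace OrderMatching
variable {ι : Type*} [LinearOrder ι] {β : Finset (ι × ι)}

theorem right_unique (h : OrderMatching β) {a b c : ι} (hb : (a, b) ∈ β) (hc : (a, c) ∈ β) :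
    b = c :=
  le_antisymm ((h _ hb _ hc).mp le_rfl) ((h _ hc _ hb).mp le_rfl)

theorem left_unique (h : OrderMatching β) {a b c : ι} (hb : (b, a) ∈ β) (hc : (c, a) ∈ β) :
    b = c :=
  le_antisymm ((h _ hb _ hc).mpr le_rfl) ((h _ hc _ hb).mpr le_rfl)

theorem mono {γ : Finset (ι × ι)} (h : OrderMatching β) (hγ : γ ⊆ β) : OrderMatching γ :=
  fun p hp q hq => h p (hγ hp) q (hγ hq)

theorem insert {a b : ι} (h : OrderMatching β) (hβ : ∀ p ∈ β, a < p.1 ∧ b < p.2) :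
    OrderMatching (insert (a, b) β) := by
  intro p hp q hq
  rcases Finset.mem_insert.mp hp with rfl | hp <;> rcases Finset.mem_insert.mp hq with rfl | hq
  · simp
  · simp [(hβ q hq).1.le, (hβ q hq).2.le]
  · simp [(hβ p hp).1.not_ge, (hβ p hp).2.not_ge]
  · exact h p hp q hq

theorem swap (h : OrderMatching β) : OrderMatching (β.image Prod.swap) := by
  intro p hp q hq
  obtain ⟨p', hp', rfl⟩ := Finset.mem_image.mp hp
  obtain ⟨q', hq', rfl⟩ := Finset.mem_image.mp hq
  exact (h p' hp' q' hq').symm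

end OrderMatching

theorem mem_image_swap {ι : Type*} [DecidableEq ι] {β : Finset (ι × ι)} {a b : ι} :
    (a, b) ∈ β.image Prod.swap ↔ (b, a) ∈ β := by
  simp

theorem image_swap_swap {ι : Type*} [DecidableEq ι] (β : Finset (ι × ι)) :
    (β.image Prod.swap).image Prod.swap = β := by
  ext ⟨a, b⟩
  rw [mem_image_swap, mem_image_swap]

theorem reach_swap {ι : Type*} [DecidableEq ι] {β : Finset (ι × ι)} {a b : ι} :
    Reach (β.image Prod.swap) a b ↔ Reach β b a := by
  rw [Reach, Reach, ← Relation.reflTransGen_swap]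
  simp only [mem_image_swap]

/-- Otherwise following the outgoing edges would be an injective, hence surjective, self-map of the
finite set of vertices reachable from `v`, and some edge would enter `v`. -/
theorem exists_reach_not_source {ι : Type*} [LinearOrder ι] [Finite ι] {β : Finset (ι × ι)}
    (h : OrderMatching β) {v : ι} (hv : ∀ w, (w, v) ∉ β) :
    ∃ t, Reach β v t ∧ ∀ w, (t, w) ∉ β := by
  by_contra! hcon
  choose f hf using fun t : {t // Reach β v t} => hcon t.1 t.2
  have hinj : Function.Injective
      (fun t : {t // Reach β v t} => (⟨f t, t.2.tail (hf t)⟩ : {t // Reach β v t})) := by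
    intro a b hab
    have h1 : f a = f b := congrArg Subtype.val hab
    exact Subtype.ext (h.left_unique (hf a) (h1 ▸ hf b))
  obtain ⟨t, ht⟩ := Finite.injective_iff_surjective.mp hinj ⟨v, Relation.ReflTransGen.refl⟩
  have h1 : f t = v := congrArg Subtype.val ht
  have h2 := hf t
  rw [h1] at h2
  exact hv _ h2

theorem OrderMatching.reach_comparable {ι : Type*} [LinearOrder ι] {β : Finset (ι × ι)}
    (h : OrderMatching β) {a b c : ι} (hb : Reach β a b) (hc : Reach β a c) :
    Reach β b c ∨ Reach β c b :=
  Relation.ReflTransGen.total_of_right_unique (fun _ _ _ h1 h2 => h.right_unique h1 h2) hb hc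

/-- Successors and predecessors are unique, so the chain from `v` to `t` can be read from either
end. -/
theorem OrderMatching.reach_iff_of_not_source {ι : Type*} [LinearOrder ι] {β : Finset (ι × ι)}
    (h : OrderMatching β) {v t : ι} (hv : ∀ w, (w, v) ∉ β) (hvt : Reach β v t)
    (ht : ∀ w, (t, w) ∉ β) (w : ι) : Reach β v w ↔ Reach β w t := by
  constructor
  · intro hw
    rcases h.reach_comparable hvt hw with h1 | h1
    · rw [h1.eq_of_not_source ht]
      exact Relation.ReflTransGen.refl
    · exact h1
  · intro hw
    have h1 := h.swap.reach_comparable (reach_swap.mpr hw) (reach_swap.mpr hvt)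
    rw [reach_swap, reach_swap] at h1
    rcases h1 with h1 | h1
    · exact h1
    · rw [h1.eq_of_not_target hv]
      exact Relation.ReflTransGen.refl

theorem reach_label {ι L : Type*} {β : Finset (ι × ι)} {m : ι → L} (hm : ∀ p ∈ β, m p.1 = m p.2)
    {a b : ι} (h : Reach β a b) : m a = m b := by
  induction h with
  | refl => rfl
  | tail _ h ih => exact ih.trans (hm _ h)

theorem reach_mem {ι : Type*} {β : Finset (ι × ι)} {s : Set ι} (hs : ∀ p ∈ β, p.2 ∈ s)
    {a b : ι} (ha : a ∈ s) (h : Reach β a b) : b ∈ s := by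
  rcases Relation.ReflTransGen.cases_tail h with h | ⟨c, -, hc⟩
  · exact h ▸ ha
  · exact hs _ hc

/-! ### The weighted sum over arrangements as a queue process -/

section Weight
variable {ι : Type*} [Fintype ι] [LinearOrder ι] {R : Type*} [CommSemiring R]
  (s : Bool → ℕ → R) (ye yl : Bool → R)

/-- The weight of an edge: loops carry an additional factor. -/
noncomputable def edgeWeight (m : ι → Bool) (p : ι × ι) : R :=
  ye (m p.1) * if p.1 = p.2 then yl (m p.1) else 1

open scoped Classical in
/-- The weight of a vertex: initial vertices of chains carry the weight of the chain. -/
noncomputable def headWeight (m : ι → Bool) (κ : ι → ℕ) (β : Finset (ι × ι)) (v : ι) : R :=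
  if ∃ w, (w, v) ∈ β then 1 else s (m v) (chainLen β κ v)

/-- The weight of the graph with edges `β` on the vertices in `l`. -/
noncomputable def arrWeight (m : ι → Bool) (κ : ι → ℕ) (l : List ι) (β : Finset (ι × ι)) : R :=
  (∏ p ∈ β, edgeWeight ye yl m p) * (l.map (headWeight s m κ β)).prod

/-- Reversing all edges exchanges the two ends of every chain and keeps its label and its length.
The factors are matched by sending the initial vertex of a chain to its terminal vertex. -/
theorem prod_headWeight_swap (m : ι → Bool) (κ : ι → ℕ) {l : List ι} (hl : l.Nodup)
    {β : Finset (ι × ι)} (h : OrderMatching β) (hm : ∀ p ∈ β, m p.1 = m p.2)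
    (hmem : ∀ p ∈ β, p.1 ∈ l ∧ p.2 ∈ l) :
    (l.map (headWeight s m κ (β.image Prod.swap))).prod = (l.map (headWeight s m κ β)).prod := by
  classical
  rw [← List.prod_toFinset _ hl, ← List.prod_toFinset _ hl]
  have key : ∀ γ : Finset (ι × ι), ∏ v ∈ l.toFinset, headWeight s m κ γ v =
      ∏ v ∈ l.toFinset with ∀ w, (w, v) ∉ γ, s (m v) (chainLen γ κ v) := by
    intro γ
    rw [Finset.prod_filter]
    refine Finset.prod_congr rfl fun v _ => ?_
    rw [headWeight]
    by_cases hv : ∃ w, (w, v) ∈ γ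
    · rw [if_pos hv, if_neg (by simpa using hv)]
    · rw [if_neg hv, if_pos (by simpa using hv)]
  rw [key, key]
  have ht : ∀ v : ι, ∃ t, (∀ w, (w, v) ∉ β) → Reach β v t ∧ ∀ w, (t, w) ∉ β := by
    intro v
    by_cases hv : ∀ w, (w, v) ∉ β
    · obtain ⟨t, ht⟩ := exists_reach_not_source h hv
      exact ⟨t, fun _ => ht⟩
    · exact ⟨v, fun h => absurd h hv⟩
  choose t ht using ht
  symm
  refine Finset.prod_bij (fun v _ => t v) ?_ ?_ ?_ ?_
  · intro v hv
    obtain ⟨hvl, hv⟩ := Finset.mem_filter.mp hv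
    refine Finset.mem_filter.mpr ⟨?_, fun w hw => (ht v hv).2 w (mem_image_swap.mp hw)⟩
    rw [List.mem_toFinset] at hvl ⊢
    exact reach_mem (s := {v | v ∈ l}) (fun p hp => (hmem p hp).2) hvl (ht v hv).1
  · intro v hv w hw hvw
    have hv := (Finset.mem_filter.mp hv).2
    have hw := (Finset.mem_filter.mp hw).2
    have h1 := (h.reach_iff_of_not_source hv (ht v hv).1 (ht v hv).2 w).mpr
      (by rw [show t v = t w from hvw]; exact (ht w hw).1)
    exact h1.eq_of_not_target hw
  · intro u hu
    obtain ⟨hul, hu⟩ := Finset.mem_filter.mp hu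
    obtain ⟨v, hv, hv'⟩ := exists_reach_not_source h.swap hu
    have hv' : ∀ w, (w, v) ∉ β := fun w hw => hv' w (mem_image_swap.mpr hw)
    have hu' : ∀ w, (u, w) ∉ β := fun w hw => hu w (mem_image_swap.mpr hw)
    rw [List.mem_toFinset] at hul
    refine ⟨v, Finset.mem_filter.mpr ⟨?_, hv'⟩, ?_⟩
    · rw [List.mem_toFinset]
      refine reach_mem (s := {v | v ∈ l}) ?_ hul hv
      intro p hp
      exact (hmem _ (mem_image_swap.mp hp)).1
    · have h1 := (h.reach_iff_of_not_source hv' (ht v hv').1 (ht v hv').2 u).mp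
        (reach_swap.mp hv)
      exact (h1.eq_of_not_source hu').symm
  · intro v hv
    have hv := (Finset.mem_filter.mp hv).2
    have h1 : chainLen β κ v = chainLen (β.image Prod.swap) κ (t v) := by
      refine Finset.sum_congr (Finset.filter_congr fun w _ => ?_) fun _ _ => rfl
      rw [reach_swap, h.reach_iff_of_not_source hv (ht v hv).1 (ht v hv).2]
    rw [h1, reach_label hm (ht v hv).1]

theorem arrWeight_swap (m : ι → Bool) (κ : ι → ℕ) {l : List ι} (hl : l.Nodup)
    {β : Finset (ι × ι)} (h : OrderMatching β) (hm : ∀ p ∈ β, m p.1 = m p.2)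
    (hmem : ∀ p ∈ β, p.1 ∈ l ∧ p.2 ∈ l) :
    arrWeight s ye yl m κ l (β.image Prod.swap) = arrWeight s ye yl m κ l β := by
  rw [arrWeight, arrWeight, prod_headWeight_swap s m κ hl h hm hmem,
    Finset.prod_image fun _ _ _ _ h => Prod.swap_injective h]
  congr 1
  refine Finset.prod_congr rfl fun p hp => ?_
  simp only [edgeWeight, Prod.fst_swap, Prod.snd_swap, hm p hp, eq_comm]

/-- The total weight of all ways to read a list of labelled vertices, the queue consisting of the
labels and the current lengths of the chains that are to be continued. -/
def queueSum : List Bool → List (Bool × ℕ) → R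
  | [], [] => 1
  | [], _ :: _ => 0
  | b :: bs, [] => (s b 1 + ye b * yl b) * queueSum bs [] + 2 * queueSum bs [(b, 1)]
  | b :: bs, (c, k) :: q =>
    s b 1 * queueSum bs ((c, k) :: q) + queueSum bs ((c, k) :: q ++ [(b, 1)]) +
      if b = c then ye b * (s b (k + 1) * queueSum bs q + queueSum bs (q ++ [(b, k + 1)])) else 0

/-- `β` is the edge set of a label-preserving arrangement on the vertices in `ql` and `vl`, where
the vertices in `ql` are initial vertices of chains with more than one vertex. -/
structure IsOpenArr (m : ι → Bool) (ql vl : List ι) (β : Finset (ι × ι)) : Prop where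
  matching : OrderMatching β
  mem : ∀ p ∈ β, p.1 ∈ ql ++ vl ∧ p.2 ∈ ql ++ vl
  label : ∀ p ∈ β, m p.1 = m p.2
  source : ∀ q ∈ ql, ∃ w, (q, w) ∈ β
  not_target : ∀ q ∈ ql, ∀ w, (w, q) ∉ β

omit [Fintype ι] in
theorem IsOpenArr.snd_mem {m : ι → Bool} {ql vl : List ι} {β : Finset (ι × ι)}
    (h : IsOpenArr m ql vl β) {p : ι × ι} (hp : p ∈ β) : p.2 ∈ vl := by
  rcases List.mem_append.mp (h.mem p hp).2 with h1 | h1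
  · exact absurd hp (h.not_target _ h1 p.1)
  · exact h1

omit [Fintype ι] in
-- This is the first-in first-out rule. The head `q` is the least vertex and its target is at least
-- `v`, so order preservation forbids an edge into `v` from a vertex beyond `q`.
theorem IsOpenArr.eq_head {m : ι → Bool} {q v : ι} {qs vl : List ι} {β : Finset (ι × ι)}
    (hs : (q :: qs ++ v :: vl).Pairwise (· < ·)) (h : IsOpenArr m (q :: qs) (v :: vl) β) {w : ι}
    (hw : (w, v) ∈ β) : w = q := by
  obtain ⟨w', hw'⟩ := h.source q List.mem_cons_self
  have h1 : v ≤ w' := by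
    rcases List.mem_cons.mp (h.snd_mem hw') with h1 | h1
    · exact h1.ge
    · exact ((List.pairwise_cons.mp (List.pairwise_append.mp hs).2.1).1 _ h1).le
  have h2 : q ≤ w := by
    rcases List.mem_cons.mp (h.mem _ hw).1 with h2 | h2
    · exact h2.ge
    · exact ((List.pairwise_cons.mp hs).1 _ h2).le
  exact le_antisymm ((h.matching _ hw _ hw').mpr h1) h2

/-- Contraction of the edge `(q, v)`: the vertex `q` disappears, `v` becomes the initial vertex, and
`κ v` absorbs the part of the chain that `q` stood for. -/
theorem arrWeight_insert {m : ι → Bool} {κ : ι → ℕ} {q v : ι} {l : List ι} {β : Finset (ι × ι)}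
    (hβ : ∀ p ∈ β, p.1 ≠ q ∧ p.2 ≠ q) (hv : ∀ w, (w, v) ∉ β) (hvq : v ≠ q) (hm : m q = m v)
    (hl : ∀ u ∈ l, u ≠ q ∧ u ≠ v) :
    (∏ p ∈ insert (q, v) β, edgeWeight ye yl m p) * (headWeight s m κ (insert (q, v) β) q *
      (headWeight s m κ (insert (q, v) β) v * (l.map (headWeight s m κ (insert (q, v) β))).prod)) =
    ye (m v) * arrWeight s ye yl m (Function.update κ v (κ q + κ v)) (v :: l) β := by
  have hq : ∀ w, (w, q) ∉ β := fun w hw => (hβ _ hw).2 rfl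
  have hq' : ∀ w, (q, w) ∉ β := fun w hw => (hβ _ hw).1 rfl
  have h1 : headWeight s m κ (insert (q, v) β) q =
      headWeight s m (Function.update κ v (κ q + κ v)) β v := by
    rw [headWeight, headWeight, if_neg, if_neg (by simpa using hv), chainLen_update_self,
      chainLen_insert_self hq hq' hvq, hm]
    rintro ⟨w, hw⟩
    rcases Finset.mem_insert.mp hw with hw | hw
    · exact hvq (Prod.mk.inj hw).2.symm
    · exact hq w hw
  have h2 : headWeight s m κ (insert (q, v) β) v = 1 :=
    if_pos ⟨q, Finset.mem_insert_self _ _⟩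
  have h3 : l.map (headWeight s m κ (insert (q, v) β)) =
      l.map (headWeight s m (Function.update κ v (κ q + κ v)) β) := by
    refine List.map_congr_left fun u hu => ?_
    obtain ⟨hu1, hu2⟩ := hl u hu
    have : (∃ w, (w, u) ∈ insert (q, v) β) ↔ ∃ w, (w, u) ∈ β := by
      simp [hu2]
    rw [headWeight, headWeight, chainLen_update_of_ne hv _ _ hu2, chainLen_insert_of_ne hq _ hu1]
    simp only [this]
  rw [arrWeight, Finset.prod_insert (hq' v), h1, h2, h3, List.map_cons, List.prod_cons,
    edgeWeight, if_neg hvq.symm, hm]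
  ring

open scoped Classical in
/-- The edge sets of the arrangements on the vertices in `ql` and `vl`. -/
noncomputable def openArrs (m : ι → Bool) (ql vl : List ι) : Finset (Finset (ι × ι)) :=
  univ.filter (IsOpenArr m ql vl)

theorem mem_openArrs {m : ι → Bool} {ql vl : List ι} {β : Finset (ι × ι)} :
    β ∈ openArrs m ql vl ↔ IsOpenArr m ql vl β := by
  simp [openArrs]

open scoped Classical in
theorem filter_isolated (m : ι → Bool) {ql vl : List ι} {v : ι}
    (hs : (ql ++ v :: vl).Nodup) :
    {β ∈ openArrs m ql (v :: vl) | (∀ w, (w, v) ∉ β) ∧ ∀ w, (v, w) ∉ β} = openArrs m ql vl := by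
  have hv : v ∉ ql ++ vl := (List.nodup_middle.mp hs).notMem
  ext β
  rw [Finset.mem_filter, mem_openArrs, mem_openArrs]
  constructor
  · rintro ⟨h, h1, h2⟩
    refine ⟨h.matching, fun p hp => ?_, h.label, h.source, h.not_target⟩
    have h3 : p.1 ≠ v := fun h3 => h2 p.2 (h3 ▸ hp)
    have h4 : p.2 ≠ v := fun h3 => h1 p.1 (h3 ▸ hp)
    have := h.mem p hp
    simpa [h3, h4] using this
  · intro h
    refine ⟨⟨h.matching, fun p hp => ?_, h.label, h.source, h.not_target⟩,
      fun w hw => hv (h.mem _ hw).2, fun w hw => hv (h.mem _ hw).1⟩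
    have := h.mem p hp
    simp only [List.mem_append, List.mem_cons] at this ⊢
    tauto

open scoped Classical in
-- The conditions on a member of the queue are exactly those of a source that is not a target.
theorem filter_start (m : ι → Bool) {ql vl : List ι} {v : ι} :
    {β ∈ openArrs m ql (v :: vl) | (∀ w, (w, v) ∉ β) ∧ ∃ w, (v, w) ∈ β} =
      openArrs m (ql ++ [v]) vl := by
  ext β
  rw [Finset.mem_filter, mem_openArrs, mem_openArrs]
  constructor
  · rintro ⟨h, h1, h2⟩
    refine ⟨h.matching, fun p hp => ?_, h.label, fun q hq => ?_, fun q hq => ?_⟩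
    · simpa using h.mem p hp
    · rcases List.mem_append.mp hq with hq | hq
      · exact h.source q hq
      · rwa [List.mem_singleton.mp hq]
    · rcases List.mem_append.mp hq with hq | hq
      · exact h.not_target q hq
      · rwa [List.mem_singleton.mp hq]
  · intro h
    refine ⟨⟨h.matching, fun p hp => ?_, h.label, fun q hq => ?_, fun q hq => ?_⟩,
      h.not_target v (by simp), h.source v (by simp)⟩
    · simpa using h.mem p hp
    · exact h.source q (List.mem_append_left _ hq)
    · exact h.not_target q (List.mem_append_left _ hq)

theorem arrWeight_perm {m : ι → Bool} {κ : ι → ℕ} {l l' : List ι} (h : l.Perm l')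
    (β : Finset (ι × ι)) : arrWeight s ye yl m κ l β = arrWeight s ye yl m κ l' β := by
  rw [arrWeight, arrWeight, (h.map _).prod_eq]

open scoped Classical in
-- A vertex that is not a target either ends its chain at once or enters the queue. The chain has `κ
-- v` vertices, not one, because the lemma is also applied after a contraction into `v`.
theorem sum_not_target (m : ι → Bool) (κ : ι → ℕ) {ql vl : List ι} {v : ι}
    (hs : (ql ++ v :: vl).Nodup) :
    ∑ β ∈ openArrs m ql (v :: vl) with ∀ w, (w, v) ∉ β, arrWeight s ye yl m κ (ql ++ v :: vl) β =
      s (m v) (κ v) * ∑ β ∈ openArrs m ql vl, arrWeight s ye yl m κ (ql ++ vl) β +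
        ∑ β ∈ openArrs m (ql ++ [v]) vl, arrWeight s ye yl m κ (ql ++ [v] ++ vl) β := by
  rw [← Finset.sum_filter_add_sum_filter_not _ (fun β => ∀ w, (v, w) ∉ β),
    Finset.filter_filter, Finset.filter_filter, Finset.mul_sum, filter_isolated m hs]
  congr 1
  · refine Finset.sum_congr rfl fun β hβ => ?_
    rw [← filter_isolated m hs, Finset.mem_filter] at hβ
    rw [arrWeight_perm s ye yl List.perm_middle, arrWeight, arrWeight, List.map_cons,
      List.prod_cons, headWeight, if_neg (by simpa using hβ.2.1),
      chainLen_of_not_source hβ.2.2]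
    ring
  · simp only [not_forall, not_not]
    rw [filter_start]
    simp

open scoped Classical in
-- An edge into `v` can only come from the head `q`. Erasing it gives a bijection onto the
-- arrangements without `q` in which `v` is not a target; adding it back preserves the order since
-- `q` and `v` precede all other sources and targets.
theorem sum_target (m : ι → Bool) (κ : ι → ℕ) {q v : ι} {qs vl : List ι}
    (hs : (q :: qs ++ v :: vl).Pairwise (· < ·)) :
    ∑ β ∈ openArrs m (q :: qs) (v :: vl) with ∃ w, (w, v) ∈ β,
        arrWeight s ye yl m κ (q :: qs ++ v :: vl) β =
      if m v = m q then ye (m v) * ∑ β ∈ openArrs m qs (v :: vl) with ∀ w, (w, v) ∉ β,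
        arrWeight s ye yl m (Function.update κ v (κ q + κ v)) (qs ++ v :: vl) β else 0 := by
  split_ifs with hm
  swap
  · refine Finset.sum_eq_zero fun β hβ => ?_
    obtain ⟨h, w, hw⟩ := Finset.mem_filter.mp hβ
    rw [mem_openArrs] at h
    obtain rfl := h.eq_head hs hw
    exact absurd (h.label _ hw).symm hm
  have hnd : (q :: qs ++ v :: vl).Nodup := hs.imp ne_of_lt
  have hq : ∀ u ∈ qs ++ v :: vl, q < u := (List.pairwise_cons.mp hs).1
  have hqs : ∀ u ∈ qs, u < v := fun u hu =>
    (List.pairwise_append.mp hs).2.2 u (List.mem_cons_of_mem _ hu) v List.mem_cons_self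
  have hvl : ∀ u ∈ vl, v < u := (List.pairwise_cons.mp (List.pairwise_append.mp hs).2.1).1
  have hqv : q < v := hq v (by simp)
  rw [Finset.mul_sum]
  refine Finset.sum_nbij' (fun β => β.erase (q, v)) (fun β => insert (q, v) β) ?_ ?_ ?_ ?_ ?_
  · intro β hβ
    obtain ⟨h, w, hw⟩ := Finset.mem_filter.mp hβ
    rw [mem_openArrs] at h
    obtain rfl := h.eq_head hs hw
    rw [Finset.mem_filter, mem_openArrs]
    refine ⟨⟨h.matching.mono (Finset.erase_subset _ _), fun p hp => ?_,
      fun p hp => h.label p (Finset.mem_of_mem_erase hp), fun u hu => ?_,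
      fun u hu x hx => h.not_target u (List.mem_cons_of_mem _ hu) x (Finset.mem_of_mem_erase hx)⟩,
      fun x hx => ?_⟩
    · obtain ⟨hp1, hp2⟩ := Finset.mem_erase.mp hp
      obtain ⟨h1, h2⟩ := h.mem p hp2
      rw [List.cons_append, List.mem_cons] at h1 h2
      have h3 : p.1 ≠ w := by
        intro h3
        exact hp1 (Prod.ext h3 (h.matching.right_unique (a := w) (by rw [← h3]; exact hp2) hw))
      have h4 : p.2 ≠ w := by
        intro h4
        exact h.not_target w List.mem_cons_self p.1 (by rw [← h4]; exact hp2)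
      exact ⟨h1.resolve_left h3, h2.resolve_left h4⟩
    · obtain ⟨x, hx⟩ := h.source u (List.mem_cons_of_mem _ hu)
      refine ⟨x, Finset.mem_erase.mpr ⟨fun h1 => ?_, hx⟩⟩
      exact (hq u (List.mem_append_left _ hu)).ne (Prod.mk.inj h1).1.symm
    · obtain ⟨h1, h2⟩ := Finset.mem_erase.mp hx
      exact h1 (by rw [h.eq_head hs h2])
  · intro β hβ
    obtain ⟨h, hv⟩ := Finset.mem_filter.mp hβ
    rw [mem_openArrs] at h
    rw [Finset.mem_filter, mem_openArrs]
    refine ⟨⟨h.matching.insert fun p hp => ⟨hq _ (h.mem p hp).1, ?_⟩, fun p hp => ?_,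
      fun p hp => ?_, fun u hu => ?_, fun u hu x hx => ?_⟩, q, Finset.mem_insert_self _ _⟩
    · rcases List.mem_cons.mp (h.snd_mem hp) with h1 | h1
      · exact absurd (h1 ▸ hp) (hv p.1)
      · exact hvl _ h1
    · rcases Finset.mem_insert.mp hp with rfl | hp
      · simp
      · exact ⟨List.mem_cons_of_mem _ (h.mem p hp).1, List.mem_cons_of_mem _ (h.mem p hp).2⟩
    · rcases Finset.mem_insert.mp hp with rfl | hp
      · exact hm.symm
      · exact h.label p hp
    · rcases List.mem_cons.mp hu with rfl | hu
      · exact ⟨v, Finset.mem_insert_self _ _⟩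
      · obtain ⟨x, hx⟩ := h.source u hu
        exact ⟨x, Finset.mem_insert_of_mem hx⟩
    · rcases List.mem_cons.mp hu with rfl | hu
      · rcases Finset.mem_insert.mp hx with h1 | h1
        · exact hqv.ne (Prod.mk.inj h1).2
        · exact (hq _ (h.mem _ h1).2).ne rfl
      · rcases Finset.mem_insert.mp hx with h1 | h1
        · exact (hqs u hu).ne (Prod.mk.inj h1).2
        · exact h.not_target u hu x h1
  · intro β hβ
    obtain ⟨h, w, hw⟩ := Finset.mem_filter.mp hβ
    rw [mem_openArrs] at h
    obtain rfl := h.eq_head hs hw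
    exact Finset.insert_erase hw
  · intro β hβ
    exact Finset.erase_insert ((Finset.mem_filter.mp hβ).2 q)
  · intro β hβ
    obtain ⟨h, w, hw⟩ := Finset.mem_filter.mp hβ
    rw [mem_openArrs] at h
    obtain rfl := h.eq_head hs hw
    have h1 : ∀ p ∈ β.erase (w, v), p.1 ≠ w ∧ p.2 ≠ w := by
      intro p hp
      obtain ⟨hp1, hp2⟩ := Finset.mem_erase.mp hp
      exact ⟨fun h3 => hp1 (Prod.ext h3 (h.matching.right_unique (a := w)
        (by rw [← h3]; exact hp2) hw)),
        fun h4 => h.not_target w List.mem_cons_self p.1 (by rw [← h4]; exact hp2)⟩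
    have h2 : ∀ x, (x, v) ∉ β.erase (w, v) := by
      intro x hx
      obtain ⟨h1, h2⟩ := Finset.mem_erase.mp hx
      exact h1 (by rw [h.eq_head hs h2])
    have h3 : ∀ u ∈ qs ++ vl, u ≠ w ∧ u ≠ v := by
      intro u hu
      rcases List.mem_append.mp hu with hu | hu
      · exact ⟨(hq u (by simp [hu])).ne', (hqs u hu).ne⟩
      · exact ⟨(hq u (by simp [hu])).ne', (hvl u hu).ne'⟩
    have h4 := arrWeight_insert s ye yl (κ := κ) h1 h2 hqv.ne' hm.symm h3
    rw [Finset.insert_erase hw] at h4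
    rw [arrWeight_perm s ye yl (l := qs ++ v :: vl) List.perm_middle, ← h4,
      arrWeight_perm s ye yl (l := w :: qs ++ v :: vl)
        ((List.perm_middle (l₁ := qs)).cons w), arrWeight]
    simp

omit [Fintype ι] in
-- As `v` is the least vertex, `v ≤ w'` holds, and order preservation turns it into `w ≤ v`.
theorem IsOpenArr.loop_of_mem {m : ι → Bool} {v : ι} {vl : List ι} {β : Finset (ι × ι)}
    (hs : (v :: vl).Pairwise (· < ·)) (h : IsOpenArr m [] (v :: vl) β) {w w' : ι}
    (hw : (w, v) ∈ β) (hw' : (v, w') ∈ β) : w = v := by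
  have h0 : ∀ u ∈ v :: vl, v ≤ u := by
    intro u hu
    rcases List.mem_cons.mp hu with rfl | hu
    · exact le_rfl
    · exact ((List.pairwise_cons.mp hs).1 u hu).le
  exact le_antisymm ((h.matching _ hw _ hw').mpr (h0 _ (h.mem _ hw').2)) (h0 _ (h.mem _ hw).1)

open scoped Classical in
theorem sum_loop (m : ι → Bool) (κ : ι → ℕ) {v : ι} {vl : List ι}
    (hs : (v :: vl).Pairwise (· < ·)) :
    ∑ β ∈ openArrs m [] (v :: vl) with (∃ w, (w, v) ∈ β) ∧ ∃ w, (v, w) ∈ β,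
        arrWeight s ye yl m κ (v :: vl) β =
      ye (m v) * yl (m v) * ∑ β ∈ openArrs m [] vl, arrWeight s ye yl m κ vl β := by
  have hvl : ∀ u ∈ vl, v < u := (List.pairwise_cons.mp hs).1
  rw [← filter_isolated m (ql := []) (hs.imp ne_of_lt), Finset.mul_sum]
  have hmem : ∀ β, β ∈ (openArrs m [] (v :: vl)).filter
      (fun β => (∃ w, (w, v) ∈ β) ∧ ∃ w, (v, w) ∈ β) → IsOpenArr m [] (v :: vl) β ∧ (v, v) ∈ β := by
    intro β hβ
    obtain ⟨h, ⟨w, hw⟩, w', hw'⟩ := Finset.mem_filter.mp hβ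
    rw [mem_openArrs] at h
    have := h.loop_of_mem hs hw hw'
    exact ⟨h, this ▸ hw⟩
  have hiso : ∀ β, IsOpenArr m [] (v :: vl) β → (v, v) ∈ β →
      (∀ w, (w, v) ∉ β.erase (v, v)) ∧ ∀ w, (v, w) ∉ β.erase (v, v) := by
    intro β h hv
    refine ⟨fun w hw => ?_, fun w hw => ?_⟩
    · obtain ⟨h1, h2⟩ := Finset.mem_erase.mp hw
      exact h1 (by rw [h.matching.left_unique h2 hv])
    · obtain ⟨h1, h2⟩ := Finset.mem_erase.mp hw
      exact h1 (by rw [h.matching.right_unique h2 hv])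
  refine Finset.sum_nbij' (fun β => β.erase (v, v)) (fun β => insert (v, v) β) ?_ ?_ ?_ ?_ ?_
  · intro β hβ
    obtain ⟨h, hv⟩ := hmem β hβ
    rw [Finset.mem_filter, mem_openArrs]
    exact ⟨⟨h.matching.mono (Finset.erase_subset _ _),
      fun p hp => h.mem p (Finset.mem_of_mem_erase hp),
      fun p hp => h.label p (Finset.mem_of_mem_erase hp), by simp, by simp⟩, hiso β h hv⟩
  · intro β hβ
    obtain ⟨h, h1, h2⟩ := Finset.mem_filter.mp hβ
    rw [mem_openArrs] at h
    rw [Finset.mem_filter, mem_openArrs]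
    refine ⟨⟨h.matching.insert fun p hp => ⟨?_, ?_⟩, fun p hp => ?_, fun p hp => ?_, by simp,
      by simp⟩, ⟨v, Finset.mem_insert_self _ _⟩, v, Finset.mem_insert_self _ _⟩
    · rcases List.mem_cons.mp (h.mem p hp).1 with h3 | h3
      · exact absurd (h3 ▸ hp) (h2 p.2)
      · exact hvl _ h3
    · rcases List.mem_cons.mp (h.mem p hp).2 with h3 | h3
      · exact absurd (h3 ▸ hp) (h1 p.1)
      · exact hvl _ h3
    · rcases Finset.mem_insert.mp hp with rfl | hp
      · simp
      · exact h.mem p hp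
    · rcases Finset.mem_insert.mp hp with rfl | hp
      · rfl
      · exact h.label p hp
  · intro β hβ
    exact Finset.insert_erase (hmem β hβ).2
  · intro β hβ
    exact Finset.erase_insert ((Finset.mem_filter.mp hβ).2.1 v)
  · intro β hβ
    obtain ⟨h, hv⟩ := hmem β hβ
    obtain ⟨h1, h2⟩ := hiso β h hv
    set γ := β.erase (v, v) with hγ
    have hβγ : β = insert (v, v) γ := (Finset.insert_erase hv).symm
    rw [hβγ, arrWeight, arrWeight, Finset.prod_insert (h1 v), List.map_cons, List.prod_cons,
      headWeight, if_pos ⟨v, Finset.mem_insert_self _ _⟩, edgeWeight, if_pos rfl]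
    have h3 : vl.map (headWeight s m κ (insert (v, v) γ)) = vl.map (headWeight s m κ γ) := by
      refine List.map_congr_left fun u hu => ?_
      have hu := (hvl u hu).ne'
      have : (∃ w, (w, u) ∈ insert (v, v) γ) ↔ ∃ w, (w, u) ∈ γ := by
        simp [hu]
      rw [headWeight, headWeight, chainLen_insert_of_ne h1 _ hu]
      simp only [this]
    rw [h3]
    ring

open scoped Classical in
-- With an empty queue the first vertex may be the end of a chain running backwards. Reversing all
-- edges pairs this with the start of a forward chain, which is the origin of the factor `2` in
-- `queueSum`.
theorem sum_swap (m : ι → Bool) (κ : ι → ℕ) {v : ι} {vl : List ι}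
    (hs : (v :: vl).Nodup) :
    ∑ β ∈ openArrs m [] (v :: vl) with (∃ w, (w, v) ∈ β) ∧ ∀ w, (v, w) ∉ β,
        arrWeight s ye yl m κ (v :: vl) β =
      ∑ β ∈ openArrs m [] (v :: vl) with (∀ w, (w, v) ∉ β) ∧ ∃ w, (v, w) ∈ β,
        arrWeight s ye yl m κ (v :: vl) β := by
  have hsw : ∀ β, IsOpenArr m [] (v :: vl) β → IsOpenArr m [] (v :: vl) (β.image Prod.swap) := by
    intro β h
    refine ⟨h.matching.swap, ?_, ?_, by simp, by simp⟩
    · rintro ⟨a, b⟩ hp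
      exact (h.mem _ (mem_image_swap.mp hp)).symm
    · rintro ⟨a, b⟩ hp
      exact (h.label _ (mem_image_swap.mp hp)).symm
  refine Finset.sum_nbij' (fun β => β.image Prod.swap) (fun β => β.image Prod.swap) ?_ ?_ ?_ ?_ ?_
  · intro β hβ
    simp only [Finset.mem_filter, mem_openArrs, mem_image_swap] at hβ ⊢
    exact ⟨hsw β hβ.1, hβ.2.2, hβ.2.1⟩
  · intro β hβ
    simp only [Finset.mem_filter, mem_openArrs, mem_image_swap] at hβ ⊢
    exact ⟨hsw β hβ.1, hβ.2.2, hβ.2.1⟩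
  · exact fun β _ => image_swap_swap β
  · exact fun β _ => image_swap_swap β
  · intro β hβ
    have h := mem_openArrs.mp (Finset.mem_filter.mp hβ).1
    exact (arrWeight_swap s ye yl m κ hs h.matching h.label h.mem).symm

/-- Induction on the unread vertices. For the next vertex the cases are: isolated, start of a chain,
and, according to whether the queue is empty, either a loop or the reversed start, or an end or
continuation of the chain at the head. The function `κ` is arbitrary on the queue, since it carries
the lengths accumulated by contractions. -/
theorem sum_arrWeight (m : ι → Bool) (κ : ι → ℕ) (ql vl : List ι)
    (hs : (ql ++ vl).Pairwise (· < ·)) (hκ : ∀ v ∈ vl, κ v = 1) :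
    ∑ β ∈ openArrs m ql vl, arrWeight s ye yl m κ (ql ++ vl) β =
      queueSum s ye yl (vl.map m) (ql.map fun q => (m q, κ q)) := by
  classical
  induction vl generalizing ql κ with
  | nil =>
    cases ql with
    | nil =>
      have : openArrs m [] [] = {∅} := by
        ext β
        rw [mem_openArrs, Finset.mem_singleton]
        constructor
        · intro h
          refine Finset.eq_empty_of_forall_notMem fun p hp => ?_
          simpa using (h.mem p hp).1
        · rintro rfl
          exact ⟨by intro p hp; simp at hp, by simp, by simp, by simp, by simp⟩
      rw [this, Finset.sum_singleton]
      simp [queueSum, arrWeight]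
    | cons q qs =>
      have : openArrs m (q :: qs) [] = ∅ := by
        refine Finset.eq_empty_of_forall_notMem fun β hβ => ?_
        rw [mem_openArrs] at hβ
        obtain ⟨w, hw⟩ := hβ.source q List.mem_cons_self
        simpa using hβ.snd_mem hw
      rw [this]
      simp [queueSum]
  | cons v vl ih =>
    have hnd : (ql ++ v :: vl).Nodup := hs.imp ne_of_lt
    have hκ' : ∀ u ∈ vl, κ u = 1 := fun u hu => hκ u (List.mem_cons_of_mem _ hu)
    have hv1 : κ v = 1 := hκ v List.mem_cons_self
    have hs' : (ql ++ vl).Pairwise (· < ·) :=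
      hs.sublist ((List.sublist_cons_self v vl).append_left ql)
    have hs'' : (ql ++ [v] ++ vl).Pairwise (· < ·) := by simpa using hs
    rw [← Finset.sum_filter_add_sum_filter_not _ (fun β => ∀ w, (w, v) ∉ β),
      sum_not_target s ye yl m κ hnd, ih κ ql hs' hκ', ih κ _ hs'' hκ']
    simp only [not_forall, not_not]
    cases ql with
    | nil =>
      rw [← Finset.sum_filter_add_sum_filter_not _ (fun β => ∀ w, (v, w) ∉ β),
        Finset.filter_filter, Finset.filter_filter]
      simp only [not_forall, not_not, List.nil_append]
      rw [sum_swap s ye yl m κ hnd, sum_loop s ye yl m κ hs, filter_start]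
      have h1 := ih κ [] hs' hκ'
      have h2 := ih κ [v] hs'' hκ'
      simp only [List.nil_append, List.cons_append] at h1 h2
      rw [List.nil_append, h1, h2]
      simp only [List.map_nil, List.map_cons, queueSum, hv1]
      ring
    | cons q qs =>
      rw [sum_target s ye yl m κ hs]
      have hnd' : (qs ++ v :: vl).Nodup := (List.nodup_cons.mp hnd).2
      have hvn : v ∉ qs ++ vl := (List.nodup_middle.mp hnd').notMem
      set κ' := Function.update κ v (κ q + κ v) with hκ''
      have hne : ∀ u ∈ qs ++ vl, κ' u = κ u := fun u hu =>
        Function.update_of_ne (fun h => hvn (by rw [← h]; exact hu)) _ _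
      have hκ1 : ∀ u ∈ vl, κ' u = 1 := fun u hu => by
        rw [hne u (List.mem_append_right _ hu), hκ' u hu]
      have hs1 : (qs ++ vl).Pairwise (· < ·) := (List.pairwise_cons.mp hs').2
      have hs2 : (qs ++ [v] ++ vl).Pairwise (· < ·) := (List.pairwise_cons.mp hs'').2
      rw [sum_not_target s ye yl m κ' hnd', ih κ' qs hs1 hκ1, ih κ' _ hs2 hκ1]
      have h3 : (qs.map fun q => (m q, κ' q)) = qs.map fun q => (m q, κ q) :=
        List.map_congr_left fun u hu => by rw [hne u (List.mem_append_left _ hu)]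
      have h4 : κ' v = κ q + 1 := by rw [hκ'', Function.update_self, hv1]
      simp only [List.map_cons, List.map_append, List.map_nil, queueSum, h3, h4, hv1,
        List.cons_append]

end Weight

/-! ### Chains correspond to their initial vertices -/

/-- Order preservation propagates the direction of the first step, so a path is strictly monotone; a
first step that stays in place is excluded because no edge enters `a`. -/
theorem OrderMatching.nodup_of_isChain {ι : Type*} [LinearOrder ι] {β : Finset (ι × ι)}
    (h : OrderMatching β) {a : ι} {l : List ι} (hl : (a :: l).IsChain fun i j => (i, j) ∈ β)
    (ha : ∀ w, (w, a) ∉ β) : (a :: l).Nodup := by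
  have up : ∀ (l : List ι) (a b : ι), a < b →
      (a :: b :: l).IsChain (fun i j => (i, j) ∈ β) → (a :: b :: l).IsChain (· < ·) := by
    intro l
    induction l with
    | nil => intro a b hab _; simpa using hab
    | cons c l ih =>
      intro a b hab hl
      rw [List.isChain_cons_cons] at hl ⊢
      have h1 := (List.isChain_cons_cons.mp hl.2).1
      refine ⟨hab, ih b c ?_ hl.2⟩
      exact lt_of_not_ge fun hc => hab.not_ge ((h _ h1 _ hl.1).mpr hc)
  have down : ∀ (l : List ι) (a b : ι), b < a →
      (a :: b :: l).IsChain (fun i j => (i, j) ∈ β) → (a :: b :: l).IsChain (· > ·) := by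
    intro l
    induction l with
    | nil => intro a b hab _; simpa using hab
    | cons c l ih =>
      intro a b hab hl
      rw [List.isChain_cons_cons] at hl ⊢
      have h1 := (List.isChain_cons_cons.mp hl.2).1
      refine ⟨hab, ih b c ?_ hl.2⟩
      exact lt_of_not_ge fun hc => hab.not_ge ((h _ hl.1 _ h1).mpr hc)
  cases l with
  | nil => simp
  | cons b l =>
    have hab := (List.isChain_cons_cons.mp hl).1
    rcases lt_trichotomy a b with h1 | h1 | h1
    · exact (List.isChain_iff_pairwise.mp (up l a b h1 hl)).imp ne_of_lt
    · exact absurd (h1 ▸ hab) (ha a)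
    · exact (List.isChain_iff_pairwise.mp (down l a b h1 hl)).imp ne_of_gt

theorem OrderMatching.mem_iff_reach {ι : Type*} [LinearOrder ι] {β : Finset (ι × ι)}
    (h : OrderMatching β) {a : ι} {l : List ι} (hl : (a :: l).IsChain fun i j => (i, j) ∈ β)
    (hlast : ∀ w, ((a :: l).getLast (List.cons_ne_nil _ _), w) ∉ β) (w : ι) :
    w ∈ a :: l ↔ Reach β a w := by
  induction l generalizing a with
  | nil =>
    rw [List.mem_singleton]
    exact ⟨fun h => h ▸ Relation.ReflTransGen.refl, fun h => (h.eq_of_not_source hlast).symm⟩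
  | cons b l ih =>
    rw [List.isChain_cons_cons] at hl
    rw [List.mem_cons, ih hl.2 (by simpa using hlast)]
    constructor
    · rintro (rfl | h1)
      · exact Relation.ReflTransGen.refl
      · exact Relation.ReflTransGen.head hl.1 h1
    · intro h1
      rcases Relation.ReflTransGen.cases_head h1 with h2 | ⟨c, hc, h2⟩
      · exact Or.inl h2.symm
      · rw [h.right_unique hl.1 hc]
        exact Or.inr h2

theorem OrderMatching.eq_of_isChain {ι : Type*} [LinearOrder ι] {β : Finset (ι × ι)}
    (h : OrderMatching β) {a : ι} {l l' : List ι} (hl : (a :: l).IsChain fun i j => (i, j) ∈ β)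
    (hlast : ∀ w, ((a :: l).getLast (List.cons_ne_nil _ _), w) ∉ β)
    (hl' : (a :: l').IsChain fun i j => (i, j) ∈ β)
    (hlast' : ∀ w, ((a :: l').getLast (List.cons_ne_nil _ _), w) ∉ β) : l = l' := by
  induction l generalizing a l' with
  | nil =>
    cases l' with
    | nil => rfl
    | cons b l' => exact absurd (List.isChain_cons_cons.mp hl').1 (hlast b)
  | cons b l ih =>
    cases l' with
    | nil => exact absurd (List.isChain_cons_cons.mp hl).1 (hlast' b)
    | cons c l' =>
      rw [List.isChain_cons_cons] at hl hl'
      obtain rfl := h.right_unique hl.1 hl'.1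
      rw [ih hl.2 (by simpa using hlast) hl'.2 (by simpa using hlast')]

theorem OrderMatching.length_eq_chainLen {ι : Type*} [LinearOrder ι] [Fintype ι]
    {β : Finset (ι × ι)} (h : OrderMatching β) {a : ι} {l : List ι}
    (hl : (a :: l).IsChain fun i j => (i, j) ∈ β)
    (hlast : ∀ w, ((a :: l).getLast (List.cons_ne_nil _ _), w) ∉ β) (hnd : (a :: l).Nodup) :
    (a :: l).length = chainLen β (fun _ => 1) a := by
  classical
  rw [chainLen, ← Finset.card_eq_sum_ones, ← List.toFinset_card_of_nodup hnd]
  congr 1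
  ext w
  rw [List.mem_toFinset, h.mem_iff_reach hl hlast, Finset.mem_filter]
  simp

open scoped Classical in
-- A chain is determined by its head, since successors are unique, and every vertex without incoming
-- edge heads a chain by finiteness.
theorem numChains_eq {r : ℕ} {α : Finset (Fin r × Fin r)} (h : OrderMatching α) (j : ℕ) :
    numChains α j =
      (univ.filter fun v : Fin r => (∀ w, (w, v) ∉ α) ∧ chainLen α (fun _ => 1) v = j).card := by
  rw [numChains, ← Set.ncard_coe_finset]
  have hlast : ∀ (a : Fin r) (l : List (Fin r)),
      (∀ i ∈ (a :: l).getLast?, ∀ k, (i, k) ∉ α) ↔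
        ∀ w, ((a :: l).getLast (List.cons_ne_nil _ _), w) ∉ α := by
    intro a l
    rw [List.getLast?_eq_some_getLast (List.cons_ne_nil a l)]
    simp
  refine Set.ncard_congr (fun l hl => l.head hl.1.1) ?_ ?_ ?_
  · rintro l ⟨⟨hne, hnd, hch, hh, hl⟩, rfl⟩
    obtain ⟨a, l, rfl⟩ := List.exists_cons_of_ne_nil hne
    rw [hlast] at hl
    simp only [List.head?_cons, Option.mem_some_iff, forall_eq'] at hh
    simp only [coe_filter, mem_univ, true_and, Set.mem_ofPred_eq, List.head_cons]
    exact ⟨hh, (h.length_eq_chainLen hch hl hnd).symm⟩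
  · rintro l l' ⟨⟨hne, hnd, hch, hh, hl⟩, _⟩ ⟨⟨hne', hnd', hch', hh', hl'⟩, _⟩ hll
    have h3 : l.head? = l'.head? := by
      rw [List.head?_eq_some_head hne, List.head?_eq_some_head hne', hll]
    clear hll
    obtain ⟨a, l, rfl⟩ := List.exists_cons_of_ne_nil hne
    obtain ⟨a', l', rfl⟩ := List.exists_cons_of_ne_nil hne'
    obtain rfl : a = a' := by simpa using h3
    rw [hlast] at hl hl'
    rw [h.eq_of_isChain hch hl hch' hl']
  · intro v hv
    simp only [coe_filter, mem_univ, true_and, Set.mem_ofPred_eq] at hv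
    obtain ⟨t, hvt, ht⟩ := exists_reach_not_source h hv.1
    obtain ⟨l, hch, hl⟩ := List.exists_isChain_cons_of_relationReflTransGen hvt
    have hnd := h.nodup_of_isChain hch hv.1
    have hl' : ∀ w, ((v :: l).getLast (List.cons_ne_nil _ _), w) ∉ α := by rw [hl]; exact ht
    refine ⟨v :: l, ⟨⟨List.cons_ne_nil _ _, hnd, hch, ?_, (hlast v l).mpr hl'⟩, ?_⟩, rfl⟩
    · simpa using hv.1
    · rw [h.length_eq_chainLen hch hl' hnd, hv.2]

/-! ### Relative orders as shuffles -/

/-- `e₁` and `e₀` enumerate the vertices with label `true` and `false` in increasing order. -/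
structure IsShuffle {N a b : ℕ} (m : Fin N → Bool) (e₁ : Fin a → Fin N) (e₀ : Fin b → Fin N) :
    Prop where
  mono₁ : StrictMono e₁
  mono₀ : StrictMono e₀
  label₁ : ∀ v, m v = true ↔ ∃ i, e₁ i = v
  label₀ : ∀ v, m v = false ↔ ∃ i, e₀ i = v

section Shuffle
variable {a b : ℕ}

open scoped Classical in
/-- The position of `i` in the shuffle of `[a]` and `[b]` given by the relative order `R`. -/
noncomputable def leftPos (R : Finset (Fin a × Fin b)) (i : Fin a) : Fin (a + b) :=
  ⟨i + (univ.filter fun j => (i, j) ∉ R).card, by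
    have := Finset.card_filter_le (univ : Finset (Fin b)) fun j => (i, j) ∉ R
    rw [Finset.card_univ, Fintype.card_fin] at this
    omega⟩

open scoped Classical in
/-- The position of `j` in the shuffle of `[a]` and `[b]` given by the relative order `R`. -/
noncomputable def rightPos (R : Finset (Fin a × Fin b)) (j : Fin b) : Fin (a + b) :=
  ⟨j + (univ.filter fun i => (i, j) ∈ R).card, by
    have := Finset.card_filter_le (univ : Finset (Fin a)) fun i => (i, j) ∈ R
    rw [Finset.card_univ, Fintype.card_fin] at this
    omega⟩

open scoped Classical in
/-- The labels of the shuffle given by a relative order. -/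
noncomputable def shuffleLabel (R : Finset (Fin a × Fin b)) (v : Fin (a + b)) : Bool :=
  decide (∃ i, leftPos R i = v)

/-- Only `j'` below `j` can fail `i R j'`, while all `i' ≤ i` satisfy `i' R j`. So the position of
`i` is at most `i + j`, and that of `j` is at least `i + j + 1`. -/
theorem IsRelOrder.leftPos_lt_rightPos {R : Finset (Fin a × Fin b)} (h : IsRelOrder R)
    {i : Fin a} {j : Fin b} (hij : (i, j) ∈ R) : leftPos R i < rightPos R j := by
  classical
  rw [Fin.lt_def, leftPos, rightPos]
  have h1 : (univ.filter fun j' => (i, j') ∉ R).card ≤ j := by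
    rw [← Fin.card_Iio]
    refine Finset.card_le_card fun j' hj' => Finset.mem_Iio.mpr (lt_of_not_ge fun hle => ?_)
    exact (Finset.mem_filter.mp hj').2 (h i i j j' le_rfl hle hij)
  have h2 : (i : ℕ) + 1 ≤ (univ.filter fun i' => (i', j) ∈ R).card := by
    rw [← Fin.card_Iic]
    exact Finset.card_le_card fun i' hi' => Finset.mem_filter.mpr
      ⟨Finset.mem_univ _, h i i' j j (Finset.mem_Iic.mp hi') le_rfl hij⟩
  simp only
  omega

theorem IsRelOrder.rightPos_lt_leftPos {R : Finset (Fin a × Fin b)} (h : IsRelOrder R)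
    {i : Fin a} {j : Fin b} (hij : (i, j) ∉ R) : rightPos R j < leftPos R i := by
  classical
  rw [Fin.lt_def, leftPos, rightPos]
  have h1 : (univ.filter fun i' => (i', j) ∈ R).card ≤ i := by
    rw [← Fin.card_Iio]
    refine Finset.card_le_card fun i' hi' => Finset.mem_Iio.mpr (lt_of_not_ge fun hle => ?_)
    exact hij (h i' i j j hle le_rfl (Finset.mem_filter.mp hi').2)
  have h2 : (j : ℕ) + 1 ≤ (univ.filter fun j' => (i, j') ∉ R).card := by
    rw [← Fin.card_Iic]
    exact Finset.card_le_card fun j' hj' => Finset.mem_filter.mpr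
      ⟨Finset.mem_univ _, fun h' => hij (h i i j' j le_rfl (Finset.mem_Iic.mp hj') h')⟩
  simp only
  omega

theorem IsRelOrder.mem_iff {R : Finset (Fin a × Fin b)} (h : IsRelOrder R) (i : Fin a)
    (j : Fin b) : (i, j) ∈ R ↔ leftPos R i < rightPos R j :=
  ⟨h.leftPos_lt_rightPos, fun h1 => by_contra fun h2 => (h.rightPos_lt_leftPos h2).not_gt h1⟩

theorem IsRelOrder.isShuffle {R : Finset (Fin a × Fin b)} (h : IsRelOrder R) :
    IsShuffle (shuffleLabel R) (leftPos R) (rightPos R) := by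
  classical
  have hm₁ : StrictMono (leftPos R) := by
    intro i i' hii
    rw [Fin.lt_def, leftPos, leftPos]
    have h1 : (univ.filter fun j => (i, j) ∉ R).card ≤ (univ.filter fun j => (i', j) ∉ R).card :=
      Finset.card_le_card fun j hj => Finset.mem_filter.mpr ⟨Finset.mem_univ _,
        fun h' => (Finset.mem_filter.mp hj).2 (h i' i j j hii.le le_rfl h')⟩
    have := Fin.lt_def.mp hii
    simp only
    omega
  have hm₀ : StrictMono (rightPos R) := by
    intro j j' hjj
    rw [Fin.lt_def, rightPos, rightPos]
    have h1 : (univ.filter fun i => (i, j) ∈ R).card ≤ (univ.filter fun i => (i, j') ∈ R).card :=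
      Finset.card_le_card fun i hi => Finset.mem_filter.mpr ⟨Finset.mem_univ _,
        h i i j j' le_rfl hjj.le (Finset.mem_filter.mp hi).2⟩
    have := Fin.lt_def.mp hjj
    simp only
    omega
  have hne : ∀ i j, leftPos R i ≠ rightPos R j := by
    intro i j
    by_cases hij : (i, j) ∈ R
    · exact (h.leftPos_lt_rightPos hij).ne
    · exact (h.rightPos_lt_leftPos hij).ne'
  -- The two position maps have disjoint images, and `a + b` elements fit injectively into `a + b`
  -- places only by filling all of them.
  have hinj : Function.Injective (Sum.elim (leftPos R) (rightPos R)) :=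
    hm₁.injective.sumElim hm₀.injective hne
  have hsurj := ((Fintype.bijective_iff_injective_and_card _).mpr ⟨hinj, by simp⟩).2
  have hl : ∀ v, shuffleLabel R v = true ↔ ∃ i, leftPos R i = v := by simp [shuffleLabel]
  refine ⟨hm₁, hm₀, hl, fun v => ?_⟩
  rw [← Bool.not_eq_true, hl]
  constructor
  · intro hv
    obtain ⟨x | x, hx⟩ := hsurj v
    · exact absurd ⟨x, hx⟩ hv
    · exact ⟨x, hx⟩
  · rintro ⟨j, rfl⟩ ⟨i, hi⟩
    exact hne i j hi

/-- The relative order given by two enumerations. -/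
def shuffleOrder {N : ℕ} (e₁ : Fin a → Fin N) (e₀ : Fin b → Fin N) : Finset (Fin a × Fin b) :=
  univ.filter fun p => e₁ p.1 < e₀ p.2

theorem mem_shuffleOrder {N : ℕ} {e₁ : Fin a → Fin N} {e₀ : Fin b → Fin N} {i : Fin a}
    {j : Fin b} : (i, j) ∈ shuffleOrder e₁ e₀ ↔ e₁ i < e₀ j := by
  simp [shuffleOrder]

namespace IsShuffle

theorem ne {N : ℕ} {m : Fin N → Bool} {e₁ : Fin a → Fin N} {e₀ : Fin b → Fin N}
    (h : IsShuffle m e₁ e₀) (i : Fin a) (j : Fin b) : e₁ i ≠ e₀ j := by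
  intro hij
  have h1 := (h.label₁ (e₁ i)).mpr ⟨i, rfl⟩
  have h0 := (h.label₀ (e₁ i)).mpr ⟨j, hij.symm⟩
  simp [h1] at h0

theorem isRelOrder {N : ℕ} {m : Fin N → Bool} {e₁ : Fin a → Fin N} {e₀ : Fin b → Fin N}
    (h : IsShuffle m e₁ e₀) : IsRelOrder (shuffleOrder e₁ e₀) := by
  intro i i' j j' hi hj hij
  rw [mem_shuffleOrder] at hij ⊢
  exact ((h.mono₁.monotone hi).trans_lt hij).trans_le (h.mono₀.monotone hj)

/-- A position is the number of vertices before it, counted by colour; this recovers the position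
maps from the relative order. -/
theorem card_lt {N : ℕ} {m : Fin N → Bool} {e₁ : Fin a → Fin N} {e₀ : Fin b → Fin N}
    (h : IsShuffle m e₁ e₀) (v : Fin N) :
    (v : ℕ) = (univ.filter fun i => e₁ i < v).card + (univ.filter fun j => e₀ j < v).card := by
  classical
  rw [← Finset.card_image_of_injective (univ.filter fun i => e₁ i < v) h.mono₁.injective,
    ← Finset.card_image_of_injective (univ.filter fun i => e₀ i < v) h.mono₀.injective,
    ← Finset.card_union_of_disjoint, ← Fin.card_Iio]
  · congr 1
    ext w
    simp only [Finset.mem_Iio, Finset.mem_union, Finset.mem_image, Finset.mem_filter,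
      Finset.mem_univ, true_and]
    constructor
    · intro hw
      cases hm : m w
      · obtain ⟨j, rfl⟩ := (h.label₀ w).mp hm
        exact Or.inr ⟨j, hw, rfl⟩
      · obtain ⟨j, rfl⟩ := (h.label₁ w).mp hm
        exact Or.inl ⟨j, hw, rfl⟩
    · rintro (⟨j, hj, rfl⟩ | ⟨j, hj, rfl⟩) <;> exact hj
  · rw [Finset.disjoint_left]
    simp only [Finset.mem_image, Finset.mem_filter, Finset.mem_univ, true_and]
    rintro w ⟨i, -, rfl⟩ ⟨j, -, hj⟩
    exact h.ne i j hj.symm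

theorem leftPos_shuffleOrder {m : Fin (a + b) → Bool} {e₁ : Fin a → Fin (a + b)}
    {e₀ : Fin b → Fin (a + b)} (h : IsShuffle m e₁ e₀) : leftPos (shuffleOrder e₁ e₀) = e₁ := by
  classical
  funext i
  have h1 : (univ.filter fun x => e₁ x < e₁ i).card = i := by
    simp only [h.mono₁.lt_iff_lt]
    rw [← Fin.card_Iio]
    congr 1
    ext
    simp
  have h2 : (univ.filter fun j => e₀ j < e₁ i).card =
      (univ.filter fun j => (i, j) ∉ shuffleOrder e₁ e₀).card := by
    congr 1
    ext j
    simp only [mem_shuffleOrder, Finset.mem_filter, Finset.mem_univ, true_and, not_lt]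
    exact ⟨le_of_lt, fun hle => lt_of_le_of_ne hle (h.ne i j).symm⟩
  rw [Fin.ext_iff, h.card_lt (e₁ i), h1, h2]
  rfl

theorem rightPos_shuffleOrder {m : Fin (a + b) → Bool} {e₁ : Fin a → Fin (a + b)}
    {e₀ : Fin b → Fin (a + b)} (h : IsShuffle m e₁ e₀) : rightPos (shuffleOrder e₁ e₀) = e₀ := by
  classical
  funext j
  have h1 : (univ.filter fun x => e₀ x < e₀ j).card = j := by
    simp only [h.mono₀.lt_iff_lt]
    rw [← Fin.card_Iio]
    congr 1
    ext
    simp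
  have h2 : (univ.filter fun i => e₁ i < e₀ j).card =
      (univ.filter fun i => (i, j) ∈ shuffleOrder e₁ e₀).card := by
    simp only [mem_shuffleOrder]
  rw [Fin.ext_iff, h.card_lt (e₀ j), h1, h2]
  exact Nat.add_comm _ _

theorem shuffleLabel_shuffleOrder {m : Fin (a + b) → Bool} {e₁ : Fin a → Fin (a + b)}
    {e₀ : Fin b → Fin (a + b)} (h : IsShuffle m e₁ e₀) :
    shuffleLabel (shuffleOrder e₁ e₀) = m := by
  funext v
  rw [Bool.eq_iff_iff, h.label₁, h.isRelOrder.isShuffle.label₁, h.leftPos_shuffleOrder]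

/-- The labels determine the shuffle. -/
theorem unique {N : ℕ} {m : Fin N → Bool} {e₁ e₁' : Fin a → Fin N} {e₀ e₀' : Fin b → Fin N}
    (h : IsShuffle m e₁ e₀) (h' : IsShuffle m e₁' e₀') : e₁ = e₁' ∧ e₀ = e₀' := by
  constructor
  · refine (StrictMono.range_inj h.mono₁ h'.mono₁).mp ?_
    ext v
    rw [Set.mem_range, Set.mem_range, ← h.label₁, ← h'.label₁]
  · refine (StrictMono.range_inj h.mono₀ h'.mono₀).mp ?_
    ext v
    rw [Set.mem_range, Set.mem_range, ← h.label₀, ← h'.label₀]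

end IsShuffle

theorem exists_isShuffle {N : ℕ} (m : Fin N → Bool) (ha : (univ.filter fun v => m v = true).card = a)
    (hb : (univ.filter fun v => m v = false).card = b) :
    ∃ (e₁ : Fin a → Fin N) (e₀ : Fin b → Fin N), IsShuffle m e₁ e₀ := by
  refine ⟨Finset.orderEmbOfFin _ ha, Finset.orderEmbOfFin _ hb, OrderEmbedding.strictMono _,
    OrderEmbedding.strictMono _, fun v => ?_, fun v => ?_⟩
  · have := Finset.range_orderEmbOfFin _ ha
    rw [← Set.mem_range, this]
    simp
  · have := Finset.range_orderEmbOfFin _ hb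
    rw [← Set.mem_range, this]
    simp

end Shuffle

/-! ### Gluing two arrangements along a shuffle -/

/-- The union of two graphs, placed on the vertices with label `true` and `false`. -/
def glue {N a b : ℕ} (e₁ : Fin a → Fin N) (e₀ : Fin b → Fin N) (α : Finset (Fin a × Fin a))
    (γ : Finset (Fin b × Fin b)) : Finset (Fin N × Fin N) :=
  α.image (Prod.map e₁ e₁) ∪ γ.image (Prod.map e₀ e₀)

open scoped Classical in
/-- `β` is a label-preserving arrangement; the part with label `true` has chain type `τ`, the part
with label `false` has `a` initial vertices and `b` edges. -/
structure IsMarkedArr {N r : ℕ} (τ : ChainType r) (a b : ℕ) (m : Fin N → Bool)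
    (β : Finset (Fin N × Fin N)) : Prop where
  matching : OrderMatching β
  label : ∀ p ∈ β, m p.1 = m p.2
  card_head : (univ.filter fun v => m v = false ∧ ∀ w, (w, v) ∉ β).card = a
  card_edge : (β.filter fun p => m p.1 = false).card = b
  card_loop : (β.filter fun p => m p.1 = true ∧ p.1 = p.2).card = τ.rank
  card_chain : ∀ j, (univ.filter fun v => m v = true ∧ (∀ w, (w, v) ∉ β) ∧
    chainLen β (fun _ => 1) v = j).card = τ.mult j

section Glue
variable {N a b : ℕ} {m : Fin N → Bool} {e₁ : Fin a → Fin N} {e₀ : Fin b → Fin N}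
  {α : Finset (Fin a × Fin a)} {γ : Finset (Fin b × Fin b)}

namespace IsShuffle

theorem label_e₁ (h : IsShuffle m e₁ e₀) (i : Fin a) : m (e₁ i) = true := (h.label₁ _).mpr ⟨i, rfl⟩

theorem label_e₀ (h : IsShuffle m e₁ e₀) (i : Fin b) : m (e₀ i) = false := (h.label₀ _).mpr ⟨i, rfl⟩

theorem label_glue (h : IsShuffle m e₁ e₀) : ∀ p ∈ glue e₁ e₀ α γ, m p.1 = m p.2 := by
  intro p hp
  rcases Finset.mem_union.mp hp with hp | hp
  · obtain ⟨q, -, rfl⟩ := Finset.mem_image.mp hp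
    simp [h.label_e₁]
  · obtain ⟨q, -, rfl⟩ := Finset.mem_image.mp hp
    simp [h.label_e₀]

theorem mem_glue₁ (h : IsShuffle m e₁ e₀) {i i' : Fin a} :
    (e₁ i, e₁ i') ∈ glue e₁ e₀ α γ ↔ (i, i') ∈ α := by
  rw [glue, Finset.mem_union, Finset.mem_image, Finset.mem_image]
  constructor
  · rintro (⟨⟨x, y⟩, hxy, hp⟩ | ⟨⟨x, y⟩, -, hp⟩)
    · obtain ⟨h1, h2⟩ := Prod.mk.inj hp
      rwa [← h.mono₁.injective h1, ← h.mono₁.injective h2]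
    · exact absurd (Prod.mk.inj hp).1.symm (h.ne _ _)
  · exact fun hi => Or.inl ⟨_, hi, rfl⟩

theorem mem_glue₀ (h : IsShuffle m e₁ e₀) {i i' : Fin b} :
    (e₀ i, e₀ i') ∈ glue e₁ e₀ α γ ↔ (i, i') ∈ γ := by
  rw [glue, Finset.mem_union, Finset.mem_image, Finset.mem_image]
  constructor
  · rintro (⟨⟨x, y⟩, -, hp⟩ | ⟨⟨x, y⟩, hxy, hp⟩)
    · exact absurd (Prod.mk.inj hp).1 (h.ne _ _)
    · obtain ⟨h1, h2⟩ := Prod.mk.inj hp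
      rwa [← h.mono₀.injective h1, ← h.mono₀.injective h2]
  · exact fun hi => Or.inr ⟨_, hi, rfl⟩

theorem not_target₁ (h : IsShuffle m e₁ e₀) {i : Fin a} :
    (∀ w, (w, e₁ i) ∉ glue e₁ e₀ α γ) ↔ ∀ w, (w, i) ∉ α := by
  constructor
  · exact fun h1 w hw => h1 (e₁ w) (h.mem_glue₁.mpr hw)
  · intro h1 w hw
    obtain ⟨x, rfl⟩ := (h.label₁ w).mp ((h.label_glue _ hw).trans (h.label_e₁ i))
    exact h1 x (h.mem_glue₁.mp hw)

theorem not_target₀ (h : IsShuffle m e₁ e₀) {i : Fin b} :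
    (∀ w, (w, e₀ i) ∉ glue e₁ e₀ α γ) ↔ ∀ w, (w, i) ∉ γ := by
  constructor
  · exact fun h1 w hw => h1 (e₀ w) (h.mem_glue₀.mpr hw)
  · intro h1 w hw
    obtain ⟨x, rfl⟩ := (h.label₀ w).mp ((h.label_glue _ hw).trans (h.label_e₀ i))
    exact h1 x (h.mem_glue₀.mp hw)

theorem reach_glue (h : IsShuffle m e₁ e₀) {i : Fin a} {w : Fin N} :
    Reach (glue e₁ e₀ α γ) (e₁ i) w ↔ ∃ i', Reach α i i' ∧ e₁ i' = w := by
  constructor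
  · intro hw
    induction hw with
    | refl => exact ⟨i, Relation.ReflTransGen.refl, rfl⟩
    | tail _ hbc ih =>
      obtain ⟨x, hx, rfl⟩ := ih
      obtain ⟨y, rfl⟩ := (h.label₁ _).mp ((h.label_glue _ hbc).symm.trans (h.label_e₁ x))
      exact ⟨y, hx.tail (h.mem_glue₁.mp hbc), rfl⟩
  · rintro ⟨i', hi, rfl⟩
    induction hi with
    | refl => exact Relation.ReflTransGen.refl
    | tail _ hbc ih => exact ih.tail (h.mem_glue₁.mpr hbc)

theorem chainLen_glue (h : IsShuffle m e₁ e₀) (i : Fin a) :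
    chainLen (glue e₁ e₀ α γ) (fun _ => 1) (e₁ i) = chainLen α (fun _ => 1) i := by
  classical
  rw [chainLen, chainLen, ← Finset.card_eq_sum_ones, ← Finset.card_eq_sum_ones,
    ← Finset.card_image_of_injective _ h.mono₁.injective]
  congr 1
  ext w
  simp [h.reach_glue]

/-- For edges of different colours `≤` is the same as `<`, so the matching condition becomes the
compatibility of the relative order with `α` and `γ`. -/
theorem orderMatching_glue (h : IsShuffle m e₁ e₀) :
    OrderMatching (glue e₁ e₀ α γ) ↔ OrderMatching α ∧ OrderMatching γ ∧
      ∀ p ∈ α, ∀ q ∈ γ, e₁ p.1 < e₀ q.1 ↔ e₁ p.2 < e₀ q.2 := by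
  constructor
  · intro hg
    refine ⟨fun p hp q hq => ?_, fun p hp q hq => ?_, fun p hp q hq => ?_⟩
    · rw [← h.mono₁.le_iff_le, ← h.mono₁.le_iff_le]
      exact hg _ (h.mem_glue₁.mpr hp) _ (h.mem_glue₁.mpr hq)
    · rw [← h.mono₀.le_iff_le, ← h.mono₀.le_iff_le]
      exact hg _ (h.mem_glue₀.mpr hp) _ (h.mem_glue₀.mpr hq)
    · rw [lt_iff_le_and_ne, lt_iff_le_and_ne]
      simp only [ne_eq, h.ne, not_false_iff, and_true]
      exact hg _ (h.mem_glue₁.mpr hp) _ (h.mem_glue₀.mpr hq)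
  · rintro ⟨hα, hγ, hx⟩ p hp q hq
    rcases Finset.mem_union.mp hp with hp | hp <;> rcases Finset.mem_union.mp hq with hq | hq <;>
      obtain ⟨p', hp', rfl⟩ := Finset.mem_image.mp hp <;>
      obtain ⟨q', hq', rfl⟩ := Finset.mem_image.mp hq <;> simp only [Prod.map_fst, Prod.map_snd]
    · rw [h.mono₁.le_iff_le, h.mono₁.le_iff_le]
      exact hα _ hp' _ hq'
    · rw [le_iff_lt_or_eq, le_iff_lt_or_eq, hx _ hp' _ hq']
      simp [h.ne]
    · rw [← not_lt, ← not_lt, hx _ hq' _ hp']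
    · rw [h.mono₀.le_iff_le, h.mono₀.le_iff_le]
      exact hγ _ hp' _ hq'

/-- Distinct edges have distinct targets, so `γ.card` is the number of targets. This is why the
exponent of `x`, length minus degree, counts the vertices that no edge enters. -/
theorem card_head_glue (h : IsShuffle m e₁ e₀) (hγ : OrderMatching γ) :
    (univ.filter fun v => m v = false ∧ ∀ w, (w, v) ∉ glue e₁ e₀ α γ).card + γ.card = b := by
  classical
  have h1 : (univ.filter fun v => m v = false ∧ ∀ w, (w, v) ∉ glue e₁ e₀ α γ) =
      (univ.filter fun j => ∀ w, (w, j) ∉ γ).image e₀ := by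
    ext v
    simp only [Finset.mem_filter, Finset.mem_univ, true_and, Finset.mem_image, h.label₀]
    constructor
    · rintro ⟨⟨j, rfl⟩, hj⟩
      exact ⟨j, h.not_target₀.mp hj, rfl⟩
    · rintro ⟨j, hj, rfl⟩
      exact ⟨⟨j, rfl⟩, h.not_target₀.mpr hj⟩
  have h2 : γ.card = (univ.filter fun j => ¬ ∀ w, (w, j) ∉ γ).card := by
    rw [← Finset.card_image_of_injOn (f := Prod.snd) (s := γ)]
    · congr 1
      ext j
      simp
    · rintro ⟨x, y⟩ hx ⟨x', y'⟩ hy hxy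
      obtain rfl : y = y' := hxy
      rw [hγ.left_unique hx hy]
  rw [h1, Finset.card_image_of_injective _ h.mono₀.injective, h2,
    Finset.card_filter_add_card_filter_not, Finset.card_univ, Fintype.card_fin]

theorem card_edge_glue (h : IsShuffle m e₁ e₀) :
    ((glue e₁ e₀ α γ).filter fun p => m p.1 = false).card = γ.card := by
  rw [← Finset.card_image_of_injective γ
    (h.mono₀.injective.prodMap h.mono₀.injective)]
  congr 1
  ext p
  rw [Finset.mem_filter, glue, Finset.mem_union]
  constructor
  · rintro ⟨hp | hp, hm⟩
    · obtain ⟨q, -, rfl⟩ := Finset.mem_image.mp hp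
      simp [h.label_e₁] at hm
    · exact hp
  · intro hp
    refine ⟨Or.inr hp, ?_⟩
    obtain ⟨q, -, rfl⟩ := Finset.mem_image.mp hp
    simp [h.label_e₀]

theorem card_loop_glue (h : IsShuffle m e₁ e₀) :
    ((glue e₁ e₀ α γ).filter fun p => m p.1 = true ∧ p.1 = p.2).card = numLoops α := by
  rw [numLoops, ← Finset.card_image_of_injective (univ.filter fun i => (i, i) ∈ α)
    (f := fun i => (e₁ i, e₁ i)) fun i j hij => h.mono₁.injective (Prod.mk.inj hij).1]
  congr 1
  ext ⟨v, w⟩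
  simp only [Finset.mem_filter, Finset.mem_image, Finset.mem_univ, true_and, h.label₁]
  constructor
  · rintro ⟨hp, ⟨i, rfl⟩, rfl⟩
    exact ⟨i, h.mem_glue₁.mp hp, rfl⟩
  · rintro ⟨i, hi, hp⟩
    obtain ⟨rfl, rfl⟩ := Prod.mk.inj hp
    exact ⟨h.mem_glue₁.mpr hi, ⟨i, rfl⟩, rfl⟩

open scoped Classical in
theorem card_chain_glue (h : IsShuffle m e₁ e₀) (j : ℕ) :
    (univ.filter fun v => m v = true ∧ (∀ w, (w, v) ∉ glue e₁ e₀ α γ) ∧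
      chainLen (glue e₁ e₀ α γ) (fun _ => 1) v = j).card =
    (univ.filter fun i => (∀ w, (w, i) ∉ α) ∧ chainLen α (fun _ => 1) i = j).card := by
  rw [← Finset.card_image_of_injective _ h.mono₁.injective]
  congr 1
  ext v
  simp only [Finset.mem_filter, Finset.mem_univ, true_and, Finset.mem_image, h.label₁]
  constructor
  · rintro ⟨⟨i, rfl⟩, h1, h2⟩
    exact ⟨i, ⟨h.not_target₁.mp h1, by rwa [h.chainLen_glue] at h2⟩, rfl⟩
  · rintro ⟨i, ⟨h1, h2⟩, rfl⟩
    exact ⟨⟨i, rfl⟩, h.not_target₁.mpr h1, by rwa [h.chainLen_glue]⟩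

theorem exists_glue (h : IsShuffle m e₁ e₀) {β : Finset (Fin N × Fin N)}
    (hβ : ∀ p ∈ β, m p.1 = m p.2) : ∃ α γ, glue e₁ e₀ α γ = β := by
  refine ⟨univ.filter fun p => (e₁ p.1, e₁ p.2) ∈ β, univ.filter fun p => (e₀ p.1, e₀ p.2) ∈ β, ?_⟩
  ext ⟨v, w⟩
  rw [glue, Finset.mem_union]
  constructor
  · rintro (hp | hp)
    · obtain ⟨q, hq, h1⟩ := Finset.mem_image.mp hp
      rw [← h1]
      exact (Finset.mem_filter.mp hq).2
    · obtain ⟨q, hq, h1⟩ := Finset.mem_image.mp hp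
      rw [← h1]
      exact (Finset.mem_filter.mp hq).2
  · intro hp
    have hl : m v = m w := hβ _ hp
    cases hm : m v
    · obtain ⟨i, rfl⟩ := (h.label₀ v).mp hm
      obtain ⟨j, rfl⟩ := (h.label₀ w).mp (hl ▸ hm)
      exact Or.inr (Finset.mem_image.mpr ⟨(i, j), by simpa using hp, rfl⟩)
    · obtain ⟨i, rfl⟩ := (h.label₁ v).mp hm
      obtain ⟨j, rfl⟩ := (h.label₁ w).mp (hl ▸ hm)
      exact Or.inl (Finset.mem_image.mpr ⟨(i, j), by simpa using hp, rfl⟩)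

theorem glue_injective (h : IsShuffle m e₁ e₀) {α' : Finset (Fin a × Fin a)}
    {γ' : Finset (Fin b × Fin b)} (he : glue e₁ e₀ α γ = glue e₁ e₀ α' γ') : α = α' ∧ γ = γ' := by
  constructor
  · ext ⟨i, j⟩
    rw [← h.mem_glue₁ (α := α) (γ := γ), he, h.mem_glue₁]
  · ext ⟨i, j⟩
    rw [← h.mem_glue₀ (α := α) (γ := γ), he, h.mem_glue₀]

theorem isMarkedArr_glue (h : IsShuffle m e₁ e₀) (τ : ChainType a) (n k : ℕ) (hb : b = n + k) :
    IsMarkedArr τ n k m (glue e₁ e₀ α γ) ↔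
      α ∈ arrangementsOfType τ ∧ γ ∈ seqArrangements b k ∧
        ∀ p ∈ α, ∀ q ∈ γ, (p.1, q.1) ∈ shuffleOrder e₁ e₀ ↔ (p.2, q.2) ∈ shuffleOrder e₁ e₀ := by
  classical
  rw [arrangementsOfType, seqArrangements, Finset.mem_filter, Finset.mem_filter]
  simp only [mem_shuffleOrder, Finset.mem_univ, true_and]
  constructor
  · intro hM
    obtain ⟨h1, h2, h3⟩ := h.orderMatching_glue.mp hM.matching
    refine ⟨⟨h1, ?_, fun j => ?_⟩, ⟨h2, ?_⟩, h3⟩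
    · rw [← h.card_loop_glue (γ := γ), hM.card_loop]
    · rw [numChains_eq h1, ← hM.card_chain j, h.card_chain_glue]
    · rw [← hM.card_edge, h.card_edge_glue]
  · rintro ⟨⟨h1, h2, h3⟩, ⟨h4, h5⟩, h6⟩
    have h1 : OrderMatching α := h1
    have h4 : OrderMatching γ := h4
    have h7 := h.card_head_glue (α := α) h4
    refine ⟨h.orderMatching_glue.mpr ⟨h1, h4, h6⟩, h.label_glue, ?_, ?_, ?_,
      fun j => ?_⟩
    · apply Nat.add_right_cancel (m := γ.card)
      rw [h5, ← hb]
      rw [h5] at h7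
      exact h7
    · rw [← h5, ← h.card_edge_glue (α := α) (γ := γ)]
    · rw [← h2, ← h.card_loop_glue (α := α) (γ := γ)]
    · rw [← h3, numChains_eq h1, ← h.card_chain_glue (α := α) (γ := γ)]

end IsShuffle

theorem IsMarkedArr.card_false {r : ℕ} {τ : ChainType r} {n k : ℕ} {β : Finset (Fin N × Fin N)}
    (h : IsMarkedArr τ n k m β) : (univ.filter fun v => m v = false).card = n + k := by
  classical
  rw [← h.card_head, ← h.card_edge, ← Finset.card_filter_add_card_filter_not
    (s := univ.filter fun v => m v = false) (fun v => ∀ w, (w, v) ∉ β), Finset.filter_filter,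
    Finset.filter_filter]
  congr 1
  rw [← Finset.card_image_of_injOn (f := Prod.snd) (s := β.filter fun p => m p.1 = false)]
  · congr 1
    ext v
    simp only [not_forall, not_not, mem_filter, mem_univ, true_and, mem_image, Prod.exists,
      exists_eq_right]
    constructor
    · rintro ⟨hv, w, hw⟩
      exact ⟨w, hw, (h.label _ hw).trans hv⟩
    · rintro ⟨w, hw, hv⟩
      exact ⟨(h.label _ hw).symm.trans hv, w, hw⟩
  · rintro ⟨x, y⟩ hx ⟨x', y'⟩ hy hxy
    obtain rfl : y = y' := hxy
    rw [h.matching.left_unique (Finset.mem_filter.mp hx).1 (Finset.mem_filter.mp hy).1]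

end Glue

open scoped Classical in
-- Triples `(α, γ, R)` correspond to marked arrangements: `R` becomes the labelling of the shuffled
-- line and `α`, `γ` become the two coloured parts of one graph.
theorem hCount_eq {r : ℕ} (τ : ChainType r) (n k : ℕ) :
    hCount τ (n + k) k = (univ.filter fun p : (Fin (r + (n + k)) → Bool) ×
      Finset (Fin (r + (n + k)) × Fin (r + (n + k))) => IsMarkedArr τ n k p.1 p.2).card := by
  have h0 : hCount τ (n + k) k = ((arrangementsOfType τ ×ˢ seqArrangements (n + k) k).sigma
      fun p => relOrders p.1 p.2).card := by
    rw [Finset.card_sigma, hCount, Finset.sum_product]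
  rw [h0]
  refine Finset.card_bij (fun x _ => (shuffleLabel x.2,
    glue (leftPos x.2) (rightPos x.2) x.1.1 x.1.2)) ?_ ?_ ?_
  · rintro ⟨⟨α, γ⟩, R⟩ hx
    obtain ⟨hx, hR⟩ := Finset.mem_sigma.mp hx
    obtain ⟨hα, hγ⟩ := Finset.mem_product.mp hx
    obtain ⟨-, hR, hc⟩ := Finset.mem_filter.mp hR
    refine Finset.mem_filter.mpr ⟨Finset.mem_univ _, ?_⟩
    rw [hR.isShuffle.isMarkedArr_glue τ n k rfl]
    refine ⟨hα, hγ, fun p hp q hq => ?_⟩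
    rw [mem_shuffleOrder, mem_shuffleOrder, ← hR.mem_iff, ← hR.mem_iff]
    exact hc p hp q hq
  · rintro ⟨⟨α, γ⟩, R⟩ hx ⟨⟨α', γ'⟩, R'⟩ hx' he
    have hR := (Finset.mem_filter.mp (Finset.mem_sigma.mp hx).2).2.1
    have hR' := (Finset.mem_filter.mp (Finset.mem_sigma.mp hx').2).2.1
    obtain ⟨h1, h2⟩ := Prod.mk.inj he
    simp only at h1 h2 hR hR'
    obtain ⟨h3, h4⟩ := hR.isShuffle.unique (h1 ▸ hR'.isShuffle)
    obtain rfl : R = R' := by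
      ext ⟨i, j⟩
      rw [hR.mem_iff, hR'.mem_iff, h3, h4]
    obtain ⟨rfl, rfl⟩ := hR.isShuffle.glue_injective h2
    rfl
  · rintro ⟨m, β⟩ hx
    have hM := (Finset.mem_filter.mp hx).2
    have h1 : (univ.filter fun v => m v = false).card = n + k := hM.card_false
    have h2 : (univ.filter fun v => m v = true).card = r := by
      have := Finset.card_filter_add_card_filter_not (s := univ) fun v => m v = true
      simp only [Bool.not_eq_true, Finset.card_univ, Fintype.card_fin, h1] at this
      omega
    obtain ⟨e₁, e₀, he⟩ := exists_isShuffle m h2 h1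
    obtain ⟨α, γ, rfl⟩ := he.exists_glue hM.label
    obtain ⟨hα, hγ, hc⟩ := (he.isMarkedArr_glue τ n k rfl).mp hM
    refine ⟨⟨(α, γ), shuffleOrder e₁ e₀⟩, Finset.mem_sigma.mpr ⟨Finset.mem_product.mpr ⟨hα, hγ⟩,
      Finset.mem_filter.mpr ⟨Finset.mem_univ _, he.isRelOrder, hc⟩⟩, ?_⟩
    simp only [he.shuffleLabel_shuffleOrder, he.leftPos_shuffleOrder, he.rightPos_shuffleOrder]

/-! ### Monomial weights recording the chain type -/

/-- Exponents of `x`, `y`, of the variable counting components, and of the variables which record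
the sizes of the chains (and, for index `0`, the loops). -/
abbrev Expo : Type := (Fin 2 →₀ ℕ) × ℕ × (ℕ →₀ ℕ)

/-- The exponents of the variables recording a chain type. -/
noncomputable def ChainType.expo {r : ℕ} (τ : ChainType r) : ℕ →₀ ℕ :=
  Finsupp.single 0 τ.rank + Multiset.toFinsupp τ.partition.parts

theorem ChainType.mult_zero {r : ℕ} (τ : ChainType r) : τ.mult 0 = 0 :=
  Multiset.count_eq_zero_of_notMem fun h => (τ.partition.parts_pos h).ne rfl

theorem ChainType.mult_of_lt {r : ℕ} (τ : ChainType r) {j : ℕ} (hj : r < j) : τ.mult j = 0 := by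
  refine Multiset.count_eq_zero_of_notMem fun h => ?_
  have h1 := Multiset.single_le_sum (fun x _ => Nat.zero_le x) j h
  have h2 := τ.partition.parts_sum
  have h3 := τ.rank_add_size
  omega

theorem ChainType.expo_zero {r : ℕ} (τ : ChainType r) : τ.expo 0 = τ.rank := by
  have := τ.mult_zero
  rw [ChainType.mult] at this
  simp [ChainType.expo, this]

theorem ChainType.expo_of_ne {r : ℕ} (τ : ChainType r) {j : ℕ} (hj : j ≠ 0) :
    τ.expo j = τ.mult j := by
  simp [ChainType.expo, ChainType.mult, hj.symm]

theorem ChainType.degree_expo {r : ℕ} (τ : ChainType r) :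
    τ.expo.degree = τ.rank + τ.partition.parts.card := by
  rw [ChainType.expo, map_add, Finsupp.degree_single]
  congr 1
  rw [Finsupp.degree_apply, Multiset.toFinsupp_support]
  exact Multiset.toFinset_sum_count_eq _

section Weights
variable {R : Type*} [CommSemiring R] (mon : Multiplicative Expo →* R)

/-- The weight of a chain; chains of the marked part with more than `r` vertices are excluded. -/
noncomputable def chainWt (r : ℕ) (b : Bool) (j : ℕ) : R :=
  if b then (if j ≤ r then mon (.ofAdd (0, 1, Finsupp.single j 1)) else 0)
  else mon (.ofAdd (Finsupp.single 0 1, 0, 0))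

/-- The weight of an edge. -/
noncomputable def edgeWt (b : Bool) : R :=
  if b then 1 else mon (.ofAdd (Finsupp.single 1 1, 0, 0))

/-- The additional weight of a loop. -/
noncomputable def loopWt (b : Bool) : R :=
  if b then mon (.ofAdd (0, 1, Finsupp.single 0 1)) else 1

variable {N : ℕ}

/-- The exponents of the weight of an edge. -/
noncomputable def edgeExpo (m : Fin N → Bool) (p : Fin N × Fin N) : Expo :=
  if m p.1 = true then (if p.1 = p.2 then (0, 1, Finsupp.single 0 1) else 0)
  else (Finsupp.single 1 1, 0, 0)

open scoped Classical in
/-- The exponents of the weight of a vertex. -/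
noncomputable def headExpo (m : Fin N → Bool) (β : Finset (Fin N × Fin N)) (v : Fin N) : Expo :=
  if ∀ w, (w, v) ∉ β then
    (if m v = true then (0, 1, Finsupp.single (chainLen β (fun _ => 1) v) 1)
      else (Finsupp.single 0 1, 0, 0))
  else 0

/-- The exponents of the weight of an arrangement. -/
noncomputable def arrExpo (m : Fin N → Bool) (β : Finset (Fin N × Fin N)) : Expo :=
  ∑ p ∈ β, edgeExpo m p + ∑ v, headExpo m β v

open scoped Classical in
-- The cutoff at `r` keeps the number of size variables finite and is harmless: no chain of an
-- arrangement of type `τ` has more than `r` vertices.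
theorem arrWeight_eq (r : ℕ) (m : Fin N → Bool) (β : Finset (Fin N × Fin N)) :
    arrWeight (chainWt mon r) (edgeWt mon) (loopWt mon) m (fun _ => 1) (List.finRange N) β =
      if ∀ v, m v = true → (∀ w, (w, v) ∉ β) → chainLen β (fun _ => 1) v ≤ r then
        mon (.ofAdd (arrExpo m β)) else 0 := by
  have h1 : ∏ p ∈ β, edgeWeight (edgeWt mon) (loopWt mon) m p =
      mon (.ofAdd (∑ p ∈ β, edgeExpo m p)) := by
    rw [ofAdd_sum, map_prod]
    refine Finset.prod_congr rfl fun p _ => ?_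
    rw [edgeWeight, edgeWt, loopWt, edgeExpo]
    cases h1 : m p.1 <;> by_cases h2 : p.1 = p.2 <;> simp [h2]
  have h2 : ((List.finRange N).map (headWeight (chainWt mon r) m (fun _ => 1) β)).prod =
      ∏ v, headWeight (chainWt mon r) m (fun _ => 1) β v := by
    rw [← List.ofFn_eq_map, List.prod_ofFn]
  rw [arrWeight, h1, h2]
  split_ifs with h
  · rw [arrExpo, ofAdd_add, map_mul, ofAdd_sum Finset.univ, map_prod]
    congr 1
    refine Finset.prod_congr rfl fun v _ => ?_
    rw [headWeight, headExpo, chainWt]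
    by_cases h3 : ∀ w, (w, v) ∉ β
    · rw [if_neg (by simpa using h3), if_pos h3]
      by_cases h4 : m v = true
      · rw [if_pos h4, if_pos h4, if_pos (h v h4 h3)]
      · rw [if_neg h4, if_neg h4]
    · rw [if_pos (by simpa using h3), if_neg h3]
      simp
  · push Not at h
    obtain ⟨v, h4, h3, h5⟩ := h
    rw [Finset.prod_eq_zero (Finset.mem_univ v), mul_zero]
    rw [headWeight, if_neg (by simpa using h3), chainWt, if_pos h4, if_neg h5.not_ge]

open scoped Classical in
theorem arrExpo_fst_zero (m : Fin N → Bool) (β : Finset (Fin N × Fin N)) :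
    (arrExpo m β).1 0 = (univ.filter fun v => m v = false ∧ ∀ w, (w, v) ∉ β).card := by
  rw [arrExpo, Prod.fst_add, Finsupp.add_apply, Prod.fst_sum, Prod.fst_sum, Finsupp.finsetSum_apply,
    Finsupp.finsetSum_apply, Finset.card_filter, Finset.sum_eq_zero, zero_add]
  · refine Finset.sum_congr rfl fun v _ => ?_
    rw [headExpo]
    by_cases h1 : m v = true <;> by_cases h2 : ∀ w, (w, v) ∉ β <;> simp [h1, h2]
  · intro p _
    rw [edgeExpo]
    cases h1 : m p.1 <;> by_cases h2 : p.1 = p.2 <;> simp [h2]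

theorem arrExpo_fst_one (m : Fin N → Bool) (β : Finset (Fin N × Fin N)) :
    (arrExpo m β).1 1 = (β.filter fun p => m p.1 = false).card := by
  classical
  rw [arrExpo, Prod.fst_add, Finsupp.add_apply, Prod.fst_sum, Prod.fst_sum, Finsupp.finsetSum_apply,
    Finsupp.finsetSum_apply, Finset.card_filter, Finset.sum_eq_zero (s := univ), add_zero]
  · refine Finset.sum_congr rfl fun p _ => ?_
    rw [edgeExpo]
    cases h1 : m p.1 <;> by_cases h2 : p.1 = p.2 <;> simp [h2]
  · intro v _
    rw [headExpo]
    by_cases h1 : m v = true <;> by_cases h2 : ∀ w, (w, v) ∉ β <;> simp [h1, h2]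

open scoped Classical in
theorem arrExpo_snd_snd (m : Fin N → Bool) (β : Finset (Fin N × Fin N)) (j : ℕ) :
    (arrExpo m β).2.2 j = (if j = 0 then (β.filter fun p => m p.1 = true ∧ p.1 = p.2).card else 0) +
      (univ.filter fun v => m v = true ∧ (∀ w, (w, v) ∉ β) ∧
        chainLen β (fun _ => 1) v = j).card := by
  rw [arrExpo, Prod.snd_add, Prod.snd_add, Finsupp.add_apply, Prod.snd_sum, Prod.snd_sum,
    Prod.snd_sum, Prod.snd_sum, Finsupp.finsetSum_apply, Finsupp.finsetSum_apply,
    Finset.card_filter, Finset.card_filter]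
  congr 1
  · split_ifs with hj
    · subst hj
      refine Finset.sum_congr rfl fun p _ => ?_
      rw [edgeExpo]
      cases h1 : m p.1 <;> by_cases h2 : p.1 = p.2 <;> simp [h2]
    · refine Finset.sum_eq_zero fun p _ => ?_
      rw [edgeExpo]
      cases h1 : m p.1 <;> by_cases h2 : p.1 = p.2 <;> simp [h2, Ne.symm hj]
  · refine Finset.sum_congr rfl fun v _ => ?_
    rw [headExpo]
    by_cases h1 : m v = true <;> by_cases h2 : ∀ w, (w, v) ∉ β <;>
      simp [h1, h2, Finsupp.single_apply]

/-- Each marked loop or chain contributes one to both sides. The component variable therefore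
carries no new information; it serves as the variable for the `X`-adic fixed point argument. -/
theorem arrExpo_snd_fst (m : Fin N → Bool) (β : Finset (Fin N × Fin N)) :
    (arrExpo m β).2.1 = (arrExpo m β).2.2.degree := by
  classical
  have h : ∀ {ι : Type} (s : Finset ι) (f : ι → Expo), (∀ i, (f i).2.1 = (f i).2.2.degree) →
      (∑ i ∈ s, f i).2.1 = (∑ i ∈ s, f i).2.2.degree := by
    intro ι s f hf
    rw [Prod.snd_sum, Prod.fst_sum, Prod.snd_sum, map_sum]
    exact Finset.sum_congr rfl fun i _ => hf i
  rw [arrExpo, Prod.snd_add, Prod.fst_add, Prod.snd_add, map_add, h, h]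
  · intro v
    rw [headExpo]
    by_cases h1 : m v = true <;> by_cases h2 : ∀ w, (w, v) ∉ β <;> simp [h1, h2]
  · intro p
    rw [edgeExpo]
    cases h1 : m p.1 <;> by_cases h2 : p.1 = p.2 <;> simp [h2]

theorem chainLen_pos (β : Finset (Fin N × Fin N)) (v : Fin N) : 0 < chainLen β (fun _ => 1) v := by
  classical
  rw [chainLen, ← Finset.card_eq_sum_ones, Finset.card_pos]
  exact ⟨v, Finset.mem_filter.mpr ⟨Finset.mem_univ _, Relation.ReflTransGen.refl⟩⟩

theorem isMarkedArr_iff {r : ℕ} (τ : ChainType r) (m : Fin N → Bool) {β : Finset (Fin N × Fin N)}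
    (h1 : OrderMatching β) (h2 : ∀ p ∈ β, m p.1 = m p.2) (e : Fin 2 →₀ ℕ) :
    IsMarkedArr τ (e 0) (e 1) m β ↔ arrExpo m β = (e, τ.expo.degree, τ.expo) := by
  classical
  have h0 : (univ.filter fun v => m v = true ∧ (∀ w, (w, v) ∉ β) ∧
        chainLen β (fun _ => 1) v = 0).card = 0 := by
    rw [Finset.card_eq_zero]
    refine Finset.filter_eq_empty_iff.mpr fun v _ hv => ?_
    exact (chainLen_pos β v).ne' hv.2.2
  constructor
  · intro h
    have h3 : (arrExpo m β).2.2 = τ.expo := by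
      ext j
      rw [arrExpo_snd_snd]
      split_ifs with hj
      · subst hj
        rw [h0, h.card_loop, τ.expo_zero, add_zero]
      · rw [h.card_chain, τ.expo_of_ne hj, zero_add]
    refine Prod.ext ?_ (Prod.ext ?_ h3)
    · ext i
      fin_cases i
      · exact (arrExpo_fst_zero m β).trans (h.card_head)
      · exact (arrExpo_fst_one m β).trans h.card_edge
    · rw [arrExpo_snd_fst, h3]
  · intro h
    have h3 : ∀ j, (arrExpo m β).2.2 j = τ.expo j := fun j => by rw [h]
    refine ⟨h1, h2, ?_, ?_, ?_, fun j => ?_⟩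
    · rw [← arrExpo_fst_zero, h]
    · rw [← arrExpo_fst_one, h]
    · have h4 := h3 0
      rw [arrExpo_snd_snd, if_pos rfl, h0, add_zero, τ.expo_zero] at h4
      exact h4
    · by_cases hj : j = 0
      · subst hj
        rw [h0, τ.mult_zero]
      · have h4 := h3 j
        rw [arrExpo_snd_snd, if_neg hj, zero_add, τ.expo_of_ne hj] at h4
        exact h4

theorem IsMarkedArr.chainLen_le {r : ℕ} {τ : ChainType r} {a b : ℕ} {m : Fin N → Bool}
    {β : Finset (Fin N × Fin N)} (h : IsMarkedArr τ a b m β) (v : Fin N) (hv : m v = true)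
    (hv' : ∀ w, (w, v) ∉ β) : chainLen β (fun _ => 1) v ≤ r := by
  classical
  by_contra! hlt
  have h1 := h.card_chain (chainLen β (fun _ => 1) v)
  rw [τ.mult_of_lt hlt, Finset.card_eq_zero, Finset.filter_eq_empty_iff] at h1
  exact h1 (Finset.mem_univ v) ⟨hv, hv', rfl⟩

theorem mem_openArrs_finRange {m : Fin N → Bool} {β : Finset (Fin N × Fin N)} :
    β ∈ openArrs m [] (List.finRange N) ↔ OrderMatching β ∧ ∀ p ∈ β, m p.1 = m p.2 := by
  rw [mem_openArrs]
  exact ⟨fun h => ⟨h.matching, h.label⟩, fun h => ⟨h.1, by simp, h.2, by simp, by simp⟩⟩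

theorem queueSum_ofFn (s : Bool → ℕ → R) (ye yl : Bool → R) (m : Fin N → Bool) :
    queueSum s ye yl (List.ofFn m) [] =
      ∑ β ∈ openArrs m [] (List.finRange N),
        arrWeight s ye yl m (fun _ => 1) (List.finRange N) β := by
  rw [List.ofFn_eq_map]
  exact (sum_arrWeight s ye yl m (fun _ => 1) [] (List.finRange N)
    (by simpa using List.pairwise_lt_finRange N) (fun _ _ => rfl)).symm

open scoped Classical in
/-- The functional `φ` extracts the coefficient of the monomial with the given exponents. -/
theorem map_queueSum_total {A : Type*} [AddCommMonoidWithOne A] (φ : R →+ A) {r : ℕ}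
    (τ : ChainType r) (e : Fin 2 →₀ ℕ)
    (hφ : ∀ d, φ (mon (.ofAdd d)) = if d = (e, τ.expo.degree, τ.expo) then 1 else 0) :
    φ (∑ m : Fin (r + (e 0 + e 1)) → Bool,
      queueSum (chainWt mon r) (edgeWt mon) (loopWt mon) (List.ofFn m) []) =
        hCount τ (e 0 + e 1) (e 1) := by
  rw [hCount_eq, map_sum, Finset.card_filter, ← Finset.univ_product_univ, Finset.sum_product,
    Nat.cast_sum]
  refine Finset.sum_congr rfl fun m _ => ?_
  rw [queueSum_ofFn, map_sum, Nat.cast_sum, openArrs, Finset.sum_filter]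
  refine Finset.sum_congr rfl fun β _ => ?_
  have h0 := mem_openArrs_finRange (m := m) (β := β)
  rw [mem_openArrs] at h0
  by_cases h : OrderMatching β ∧ ∀ p ∈ β, m p.1 = m p.2
  · rw [if_pos (h0.mpr h), arrWeight_eq]
    by_cases h1 : IsMarkedArr τ (e 0) (e 1) m β
    · rw [if_pos h1.chainLen_le, hφ, if_pos ((isMarkedArr_iff τ m h.1 h.2 e).mp h1), if_pos h1,
        Nat.cast_one]
    · rw [if_neg h1, Nat.cast_zero]
      split_ifs
      · rw [hφ, if_neg fun h2 => h1 ((isMarkedArr_iff τ m h.1 h.2 e).mpr h2)]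
      · exact map_zero φ
  · rw [if_neg fun h1 => h (h0.mp h1), if_neg fun h1 => h ⟨h1.matching, h1.label⟩, Nat.cast_zero]

end Weights

/-! ### The linear recursion and its product solution -/

section Total
variable {R : Type*} [CommSemiring R] (s : Bool → ℕ → R) (ye yl : Bool → R)

/-- The sum of `queueSum` over all lists of `n` labels. -/
def queueTotal (n : ℕ) (q : List (Bool × ℕ)) : R :=
  ∑ m : Fin n → Bool, queueSum s ye yl (List.ofFn m) q

/-- The linear operator which describes the effect of reading one more vertex. -/
def queueStep (D : List (Bool × ℕ) → R) : List (Bool × ℕ) → R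
  | [] => ∑ b, ((s b 1 + ye b * yl b) * D [] + 2 * D [(b, 1)])
  | (c, k) :: q => ∑ b, (s b 1 * D ((c, k) :: q) + D ((c, k) :: q ++ [(b, 1)])) +
      ye c * (s c (k + 1) * D q + D (q ++ [(c, k + 1)]))

theorem queueTotal_zero_nil : queueTotal s ye yl 0 [] = 1 := by
  simp [queueTotal, queueSum]

theorem queueTotal_zero_cons (p : Bool × ℕ) (q : List (Bool × ℕ)) :
    queueTotal s ye yl 0 (p :: q) = 0 := by
  simp [queueTotal, queueSum]

theorem queueTotal_succ (n : ℕ) (q : List (Bool × ℕ)) :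
    queueTotal s ye yl (n + 1) q = queueStep s ye yl (queueTotal s ye yl n) q := by
  have h : ∀ q, queueTotal s ye yl (n + 1) q =
      ∑ b : Bool, ∑ m : Fin n → Bool, queueSum s ye yl (b :: List.ofFn m) q := by
    intro q
    rw [queueTotal, ← (Fin.consEquiv fun _ => Bool).sum_comp, Fintype.sum_prod_type]
    simp [Fin.consEquiv, List.ofFn_succ]
  rw [h]
  cases q with
  | nil =>
    simp only [queueSum, queueStep, queueTotal, Finset.sum_add_distrib, Finset.mul_sum]
  | cons p q =>
    obtain ⟨c, k⟩ := p
    simp only [queueSum, queueStep, queueTotal, Finset.sum_add_distrib, Finset.mul_sum, mul_add]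
    congr 1
    -- Only a vertex with the label of the head can continue or close its chain.
    · rw [Finset.sum_eq_single c]
      · simp [Finset.sum_add_distrib]
      · intro b _ hb
        simp [hb]
      · simp

end Total

/-- The number of vertices which an element of the queue stands for. -/
def queueSize (q : List (Bool × ℕ)) : ℕ := (q.map fun p => if p.1 then p.2 else 1).sum

section Filtration
variable {R : Type*} [CommRing R] {s : Bool → ℕ → R} {ye yl : Bool → R}

/-- Reading a vertex raises the order by one. A pending unmarked chain stands for one vertex, the
others being recorded by the factor `y` of its edges; a pending marked chain stands for all of its
vertices, since marked edges have weight one. The filtration is abstract because it is used both for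
order at least `n` and for order exactly `n`. -/
theorem queueStep_mem (F : ℕ → AddSubgroup R) (hmul : ∀ {i j a b}, a ∈ F i → b ∈ F j → a * b ∈ F (i + j))
    (hs : ∀ b k, s b (k + 1) ∈ F (if b then k + 1 else 1)) (hye : ∀ b, ye b ∈ F (if b then 0 else 1))
    (hyl : ∀ b, yl b ∈ F (if b then 1 else 0)) {D : List (Bool × ℕ) → R} {n : ℕ}
    (hD : ∀ q, D q ∈ F (n + queueSize q)) (q : List (Bool × ℕ)) :
    queueStep s ye yl D q ∈ F (n + 1 + queueSize q) := by
  have hcast : ∀ {i j a}, a ∈ F i → i = j → a ∈ F j := fun h hij => hij ▸ h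
  have happ : ∀ q p, queueSize (q ++ [p]) = queueSize q + if p.1 then p.2 else 1 := by
    intro q p
    simp [queueSize]
  have hcons : ∀ q p, queueSize (p :: q) = (if p.1 then p.2 else 1) + queueSize q := by
    intro q p
    simp [queueSize]
  cases q with
  | nil =>
    refine AddSubgroup.sum_mem _ fun b _ => AddSubgroup.add_mem _ ?_ ?_
    · have h1 : s b 1 + ye b * yl b ∈ F 1 := by
        refine AddSubgroup.add_mem _ (hcast (hs b 0) (by cases b <;> rfl)) ?_
        exact hcast (hmul (hye b) (hyl b)) (by cases b <;> rfl)
      exact hcast (hmul h1 (hD [])) (by omega)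
    · rw [two_mul]
      have h1 : D [(b, 1)] ∈ F (n + 1 + queueSize []) :=
        hcast (hD _) (by cases b <;> simp [queueSize])
      exact AddSubgroup.add_mem _ h1 h1
  | cons p q =>
    obtain ⟨c, k⟩ := p
    refine AddSubgroup.add_mem _ (AddSubgroup.sum_mem _ fun b _ => AddSubgroup.add_mem _ ?_ ?_) ?_
    · exact hcast (hmul (hs b 0) (hD _)) (by cases b <;> simp <;> omega)
    · exact hcast (hD _) (by rw [happ]; cases b <;> simp <;> omega)
    · rw [mul_add]
      refine AddSubgroup.add_mem _ ?_ ?_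
      · refine hcast (hmul (hye c) (hmul (hs c k) (hD q))) ?_
        rw [hcons]
        cases c <;> simp <;> omega
      · refine hcast (hmul (hye c) (hD _)) ?_
        rw [hcons, happ]
        cases c <;> simp <;> omega

theorem queueTotal_mem (F : ℕ → AddSubgroup R)
    (hmul : ∀ {i j a b}, a ∈ F i → b ∈ F j → a * b ∈ F (i + j)) (hone : (1 : R) ∈ F 0)
    (hs : ∀ b k, s b (k + 1) ∈ F (if b then k + 1 else 1)) (hye : ∀ b, ye b ∈ F (if b then 0 else 1))
    (hyl : ∀ b, yl b ∈ F (if b then 1 else 0)) (n : ℕ) (q : List (Bool × ℕ)) :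
    queueTotal s ye yl n q ∈ F (n + queueSize q) := by
  induction n generalizing q with
  | zero =>
    cases q with
    | nil => rw [queueTotal_zero_nil]; exact hone
    | cons p q => rw [queueTotal_zero_cons]; exact AddSubgroup.zero_mem _
  | succ n ih =>
    rw [queueTotal_succ]
    exact queueStep_mem F hmul hs hye hyl ih q

/-- The conditions under which `A * ∏ V` solves the linear recursion for `queueTotal`. -/
structure QueueSolution (s : Bool → ℕ → R) (ye yl : Bool → R) (V : Bool → ℕ → R) (W A : R) :
    Prop where
  step : ∀ b k, V b k * W = ye b * (s b (k + 1) + V b (k + 1))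
  start : ∑ b, (s b 1 + V b 1) = 1 - W
  total : A * (1 - ∑ b, (s b 1 + ye b * yl b) - 2 * ∑ b, V b 1) = 1

/-- The product is a fixed point of the recursion with source term `1` at the empty queue.
Subtracting partial sums therefore amounts to iterating `queueStep` on the product, and each
iteration raises the order by one. -/
theorem QueueSolution.sub_sum_mem {V : Bool → ℕ → R} {W A : R}
    (h : QueueSolution s ye yl V W A) (F : ℕ → AddSubgroup R)
    (hmul : ∀ {i j a b}, a ∈ F i → b ∈ F j → a * b ∈ F (i + j)) (htop : ∀ a, a ∈ F 0)
    (hs : ∀ b k, s b (k + 1) ∈ F (if b then k + 1 else 1)) (hye : ∀ b, ye b ∈ F (if b then 0 else 1))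
    (hyl : ∀ b, yl b ∈ F (if b then 1 else 0)) (hV : ∀ b k, V b k ∈ F (if b then k else 1))
    (n : ℕ) (q : List (Bool × ℕ)) :
    A * (q.map fun p => V p.1 p.2).prod - ∑ i ∈ range n, queueTotal s ye yl i q ∈
      F (n + queueSize q) := by
  induction n generalizing q with
  | zero =>
    rw [Finset.range_zero, Finset.sum_empty, sub_zero, zero_add]
    induction q with
    | nil => exact htop _
    | cons p q ih =>
      rw [List.map_cons, List.prod_cons, mul_left_comm]
      exact hmul (hV p.1 p.2) ih
  | succ n ih =>
    have key : A * (q.map fun p => V p.1 p.2).prod - ∑ i ∈ range (n + 1), queueTotal s ye yl i q =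
        queueStep s ye yl (fun q => A * (q.map fun p => V p.1 p.2).prod -
          ∑ i ∈ range n, queueTotal s ye yl i q) q := by
      rw [Finset.sum_range_succ']
      simp only [queueTotal_succ]
      cases q with
      | nil =>
        have h1 := h.total
        simp only [Fintype.sum_bool] at h1
        simp only [queueStep, queueTotal_zero_nil, List.map_nil, List.prod_nil, List.map_cons,
          List.prod_cons, Fintype.sum_bool, Finset.sum_add_distrib, ← Finset.mul_sum]
        linear_combination h1
      | cons p q =>
        obtain ⟨c, k⟩ := p
        have h1 := h.step c k
        have h2 := h.start
        simp only [Fintype.sum_bool] at h2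
        simp only [queueStep, queueTotal_zero_cons, List.map_nil, List.prod_nil, List.map_cons,
          List.prod_cons, List.map_append, List.prod_append, Fintype.sum_bool,
          Finset.sum_add_distrib, ← Finset.mul_sum]
        linear_combination (-A * V c k * (q.map fun p => V p.1 p.2).prod) * h2 +
          (A * (q.map fun p => V p.1 p.2).prod) * h1
    rw [key]
    exact queueStep_mem F hmul hs hye hyl ih q

end Filtration

/-! ### Coefficients, supports and the number of vertices -/

section Coef
variable (R : Type*) [CommRing R]

/-- Power series in the variable counting components over polynomials in the variables recording
the sizes, over power series in `x` and `y`. -/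
abbrev Ser : Type _ := PowerSeries (MvPolynomial ℕ (MvPowerSeries (Fin 2) R))

variable {R}

/-- The coefficient of the monomial with exponents `d`. -/
noncomputable def coef (d : Expo) : Ser R →+ R :=
  ((MvPowerSeries.coeff (R := R) d.1).toAddMonoidHom.comp
    (MvPolynomial.lcoeff (MvPowerSeries (Fin 2) R) d.2.2).toAddMonoidHom).comp
    (PowerSeries.coeff (R := MvPolynomial ℕ (MvPowerSeries (Fin 2) R)) d.2.1).toAddMonoidHom

theorem coef_apply (d : Expo) (f : Ser R) :
    coef d f = MvPowerSeries.coeff d.1 ((PowerSeries.coeff d.2.1 f).coeff d.2.2) := rfl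

theorem exists_coef_mul_ne_zero {f g : Ser R} {d : Expo} (h : coef d (f * g) ≠ 0) :
    ∃ d₁ d₂, d₁ + d₂ = d ∧ coef d₁ f ≠ 0 ∧ coef d₂ g ≠ 0 := by
  classical
  rw [coef_apply, PowerSeries.coeff_mul, MvPolynomial.coeff_sum, map_sum] at h
  obtain ⟨n, hn, h⟩ := Finset.exists_ne_zero_of_sum_ne_zero h
  rw [MvPolynomial.coeff_mul, map_sum] at h
  obtain ⟨σ, hσ, h⟩ := Finset.exists_ne_zero_of_sum_ne_zero h
  rw [MvPowerSeries.coeff_mul] at h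
  obtain ⟨e, he, h⟩ := Finset.exists_ne_zero_of_sum_ne_zero h
  refine ⟨(e.1, n.1, σ.1), (e.2, n.2, σ.2), ?_, left_ne_zero_of_mul h, right_ne_zero_of_mul h⟩
  rw [Finset.HasAntidiagonal.mem_antidiagonal] at hn hσ he
  exact Prod.ext he (Prod.ext hn hσ)

/-- The series all of whose exponents belong to `S`. -/
def suppOn (R : Type*) [CommRing R] (S : Set Expo) : AddSubgroup (Ser R) where
  carrier := {f | ∀ d, coef d f ≠ 0 → d ∈ S}
  zero_mem' := fun d h => absurd (map_zero _) h
  add_mem' := by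
    intro f g hf hg d h
    by_cases h1 : coef d f = 0
    · refine hg d fun h2 => h ?_
      rw [map_add, h1, h2, add_zero]
    · exact hf d h1
  neg_mem' := by
    intro f hf d h
    refine hf d fun h2 => h ?_
    rw [map_neg, h2, neg_zero]

theorem mul_mem_suppOn {S S' S'' : Set Expo} (hS : ∀ d ∈ S, ∀ d' ∈ S', d + d' ∈ S'') {f g : Ser R}
    (hf : f ∈ suppOn R S) (hg : g ∈ suppOn R S') : f * g ∈ suppOn R S'' := by
  intro d hd
  obtain ⟨d₁, d₂, rfl, h1, h2⟩ := exists_coef_mul_ne_zero hd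
  exact hS _ (hf _ h1) _ (hg _ h2)

variable (R) in
/-- The monomials of `Ser R`. -/
noncomputable def serMon : Multiplicative Expo →* Ser R where
  toFun d := PowerSeries.monomial d.toAdd.2.1
    (MvPolynomial.monomial d.toAdd.2.2 (MvPowerSeries.monomial d.toAdd.1 (1 : R)))
  map_one' := by
    simp only [toAdd_one, Prod.fst_zero, Prod.snd_zero]
    rw [PowerSeries.monomial_zero_eq_C_apply, MvPowerSeries.monomial_zero_eq_C_apply]
    simp
  map_mul' d d' := by
    simp only [toAdd_mul, Prod.fst_add, Prod.snd_add]
    rw [PowerSeries.monomial_mul_monomial, MvPolynomial.monomial_mul,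
      MvPowerSeries.monomial_mul_monomial, one_mul]

theorem coef_serMon (d d' : Expo) :
    coef d' (serMon R (.ofAdd d)) = if d = d' then 1 else 0 := by
  classical
  obtain ⟨e, n, σ⟩ := d
  obtain ⟨e', n', σ'⟩ := d'
  rw [coef_apply]
  simp only [serMon, MonoidHom.coe_mk, OneHom.coe_mk, toAdd_ofAdd]
  rw [PowerSeries.coeff_monomial]
  by_cases hn : n' = n
  · rw [if_pos hn, MvPolynomial.coeff_monomial]
    by_cases hσ : σ = σ'
    · rw [if_pos hσ, MvPowerSeries.coeff_monomial]
      simp [hn, hσ, eq_comm]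
    · rw [if_neg hσ]
      simp [hσ]
  · rw [if_neg hn]
    simp [Ne.symm hn]

theorem serMon_mem_suppOn {S : Set Expo} {d : Expo} (hd : d ∈ S) :
    serMon R (.ofAdd d) ∈ suppOn R S := by
  intro d' h
  rw [coef_serMon] at h
  rwa [← (ite_ne_right_iff.mp h).1]

/-- The number of vertices recorded by a monomial. -/
noncomputable def vertexCount : Expo →+ ℕ :=
  (Finsupp.degree.comp (AddMonoidHom.fst _ _)) +
    ((Finsupp.weight fun j => max j 1).comp
      ((AddMonoidHom.snd _ _).comp (AddMonoidHom.snd (Fin 2 →₀ ℕ) (ℕ × (ℕ →₀ ℕ)))))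

theorem vertexCount_apply (d : Expo) :
    vertexCount d = d.1.degree + Finsupp.weight (fun j => max j 1) d.2.2 := rfl

/-- The weight `max j 1` lets the loop variable, of index `0`, count for one vertex. -/
theorem vertexCount_chainType {r : ℕ} (τ : ChainType r) (e : Fin 2 →₀ ℕ) (n : ℕ) :
    vertexCount (e, n, τ.expo) = r + (e 0 + e 1) := by
  have h : Finsupp.weight (fun j => max j 1) (Multiset.toFinsupp τ.partition.parts) = τ.size := by
    rw [Finsupp.weight_apply, Finsupp.sum, Multiset.toFinsupp_support]
    conv_rhs => rw [← τ.partition.parts_sum, Finset.sum_multiset_count]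
    refine Finset.sum_congr rfl fun j hj => ?_
    rw [Multiset.mem_toFinset] at hj
    rw [max_eq_left (τ.partition.parts_pos hj), Multiset.toFinsupp_apply]
  rw [vertexCount_apply, ChainType.expo, map_add, h, Finsupp.weight_single, Finsupp.degree_eq_sum,
    Fin.sum_univ_two]
  have := τ.rank_add_size
  simp
  omega

variable (r : ℕ) {V : Bool → ℕ → Ser R} {W A : Ser R}

theorem chainWt_mem (F : ℕ → AddSubgroup (Ser R))
    (hF : ∀ d, serMon R (.ofAdd d) ∈ F (vertexCount d)) (b : Bool) (k : ℕ) :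
    chainWt (serMon R) r b (k + 1) ∈ F (if b then k + 1 else 1) := by
  rw [chainWt]
  cases b
  · simpa [vertexCount_apply] using hF (Finsupp.single 0 1, 0, 0)
  · simp only [if_true]
    split_ifs
    · have := hF (0, 1, Finsupp.single (k + 1) 1)
      rw [vertexCount_apply] at this
      simpa [Finsupp.weight_single] using this
    · exact AddSubgroup.zero_mem _

theorem edgeWt_mem (F : ℕ → AddSubgroup (Ser R))
    (hF : ∀ d, serMon R (.ofAdd d) ∈ F (vertexCount d)) (b : Bool) :
    edgeWt (serMon R) b ∈ F (if b then 0 else 1) := by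
  rw [edgeWt]
  cases b
  · simpa [vertexCount_apply] using hF (Finsupp.single 1 1, 0, 0)
  · simpa using hF 0

theorem loopWt_mem (F : ℕ → AddSubgroup (Ser R))
    (hF : ∀ d, serMon R (.ofAdd d) ∈ F (vertexCount d)) (b : Bool) :
    loopWt (serMon R) b ∈ F (if b then 1 else 0) := by
  rw [loopWt]
  cases b
  · simpa using hF 0
  · simpa [vertexCount_apply, Finsupp.weight_single] using hF (0, 1, Finsupp.single 0 1)

/-- Only arrangements with `vertexCount d` vertices contribute to the monomial `d`: `queueTotal` is
homogeneous (`F₂`), and `A` agrees with the partial sums up to terms of higher order (`F₁`). -/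
theorem coef_eq_hCount {r : ℕ} (τ : ChainType r) {V : Bool → ℕ → Ser R} {W A : Ser R}
    (h : QueueSolution (chainWt (serMon R) r) (edgeWt (serMon R)) (loopWt (serMon R)) V W A)
    (hV : ∀ b k, V b k ∈ suppOn R {d | (if b then k else 1) ≤ vertexCount d}) (e : Fin 2 →₀ ℕ) :
    coef (e, τ.expo.degree, τ.expo) A = hCount τ (e 0 + e 1) (e 1) := by
  set F₁ : ℕ → AddSubgroup (Ser R) := fun n => suppOn R {d | n ≤ vertexCount d} with hF₁
  set F₂ : ℕ → AddSubgroup (Ser R) := fun n => suppOn R {d | vertexCount d = n} with hF₂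
  have hm₁ : ∀ {i j a b}, a ∈ F₁ i → b ∈ F₁ j → a * b ∈ F₁ (i + j) := fun ha hb =>
    mul_mem_suppOn (fun d hd d' hd' => by
      simp only [Set.mem_ofPred_eq, map_add] at hd hd' ⊢
      omega) ha hb
  have hm₂ : ∀ {i j a b}, a ∈ F₂ i → b ∈ F₂ j → a * b ∈ F₂ (i + j) := fun ha hb =>
    mul_mem_suppOn (fun d hd d' hd' => by
      simp only [Set.mem_ofPred_eq, map_add] at hd hd' ⊢
      omega) ha hb
  have hg₁ : ∀ d, serMon R (.ofAdd d) ∈ F₁ (vertexCount d) := fun d =>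
    serMon_mem_suppOn (le_refl (vertexCount d))
  have hg₂ : ∀ d, serMon R (.ofAdd d) ∈ F₂ (vertexCount d) := fun d =>
    serMon_mem_suppOn (rfl : vertexCount d = vertexCount d)
  have h1 := h.sub_sum_mem F₁ hm₁ (fun a d _ => Nat.zero_le _) (chainWt_mem r F₁ hg₁)
    (edgeWt_mem F₁ hg₁) (loopWt_mem F₁ hg₁) hV
  have h2 := queueTotal_mem F₂ hm₂ (by simpa using hg₂ 0) (chainWt_mem r F₂ hg₂)
    (edgeWt_mem F₂ hg₂) (loopWt_mem F₂ hg₂)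
  set d : Expo := (e, τ.expo.degree, τ.expo) with hd
  have hN : vertexCount d = r + (e 0 + e 1) := vertexCount_chainType τ e _
  rw [← map_queueSum_total (serMon R) (coef d) τ e fun d' => coef_serMon d' d, ← hN]
  change coef d A = coef d (queueTotal _ _ _ (vertexCount d) [])
  have h3 : coef d (A * (([] : List (Bool × ℕ)).map fun p => V p.1 p.2).prod -
      ∑ i ∈ range (vertexCount d + 1),
        queueTotal (chainWt (serMon R) r) (edgeWt (serMon R)) (loopWt (serMon R)) i []) = 0 := by
    by_contra h3
    have := h1 _ _ _ h3
    simp only [Set.mem_ofPred_eq] at this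
    omega
  rw [map_sub, sub_eq_zero, List.map_nil, List.prod_nil, mul_one, map_sum] at h3
  rw [h3]
  refine Finset.sum_eq_single _ (fun i _ hi => ?_) fun h4 => ?_
  · by_contra h4
    have : vertexCount d = i + queueSize [] := h2 i [] d h4
    simp [queueSize] at this
    exact hi this.symm
  · exact absurd (Finset.mem_range.mpr (Nat.lt_succ_self _)) h4

end Coef

/-! ### Contractions of power series and the perturbation equation -/

section Fixpoint
open PowerSeries
variable {R : Type*} [CommRing R]

theorem eq_of_forall_X_pow_dvd {f g : PowerSeries R} (h : ∀ n, X ^ n ∣ f - g) : f = g := by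
  ext n
  have := X_pow_dvd_iff.mp (h (n + 1)) n (Nat.lt_succ_self n)
  rwa [map_sub, sub_eq_zero] at this

/-- `Φ` is contracting with respect to the `X`-adic topology. -/
def IsContraction (Φ : PowerSeries R → PowerSeries R) : Prop :=
  ∀ n f g, X ^ n ∣ f - g → X ^ (n + 1) ∣ Φ f - Φ g

namespace IsContraction
variable {Φ : PowerSeries R → PowerSeries R}

theorem unique (hΦ : IsContraction Φ) {f g : PowerSeries R} (hf : Φ f = f) (hg : Φ g = g) :
    f = g := by
  refine eq_of_forall_X_pow_dvd fun n => ?_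
  induction n with
  | zero => simp
  | succ n ih =>
    rw [← hf, ← hg]
    exact hΦ n f g ih

theorem dvd_sub_iterate (hΦ : IsContraction Φ) {f : PowerSeries R} (hf : Φ f = f) (n : ℕ) :
    X ^ n ∣ f - Φ^[n] 0 := by
  induction n with
  | zero => simp
  | succ n ih =>
    rw [Function.iterate_succ_apply', ← hf]
    exact hΦ n f _ ih

/-- The first `n` coefficients of the iterates of `0` are constant from the `n`-th iterate on, so
the limit can be read off coefficientwise. -/
theorem exists_fixpoint (hΦ : IsContraction Φ) : ∃ f, Φ f = f := by
  have h1 : ∀ n m, X ^ n ∣ Φ^[n + m] 0 - Φ^[n] 0 := by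
    intro n
    induction n with
    | zero => simp
    | succ n ih =>
      intro m
      rw [Nat.succ_add, Function.iterate_succ_apply', Function.iterate_succ_apply']
      exact hΦ n _ _ (ih m)
  set f : PowerSeries R := PowerSeries.mk fun n => coeff n (Φ^[n + 1] 0) with hf
  have h2 : ∀ n, X ^ n ∣ f - Φ^[n] 0 := by
    intro n
    rw [X_pow_dvd_iff]
    intro i hi
    obtain ⟨m, rfl⟩ := Nat.exists_eq_add_of_lt hi
    have h3 := X_pow_dvd_iff.mp (h1 (i + 1) m) i (Nat.lt_succ_self i)
    rw [map_sub, sub_eq_zero] at h3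
    rw [map_sub, hf, coeff_mk, show i + m + 1 = i + 1 + m by omega, h3, sub_self]
  refine ⟨f, eq_of_forall_X_pow_dvd fun n => ?_⟩
  have h3 := hΦ n _ _ (h2 n)
  have h4 := h2 (n + 1)
  rw [Function.iterate_succ_apply'] at h4
  have h5 := dvd_sub h3 h4
  rw [sub_sub_sub_cancel_right] at h5
  exact (pow_dvd_pow X (Nat.le_succ n)).trans h5

theorem mem_of_closed (hΦ : IsContraction Φ) {f : PowerSeries R} (hf : Φ f = f)
    {D : Set (PowerSeries R)} (hD : ∀ f, (∀ n, ∃ g ∈ D, X ^ n ∣ f - g) → f ∈ D) (h0 : 0 ∈ D)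
    (hΦD : ∀ g ∈ D, Φ g ∈ D) : f ∈ D := by
  refine hD f fun n => ⟨Φ^[n] 0, ?_, hΦ.dvd_sub_iterate hf n⟩
  induction n with
  | zero => exact h0
  | succ n ih =>
    rw [Function.iterate_succ_apply']
    exact hΦD _ ih

end IsContraction

/-- The inverse of `1 + X * f`. -/
noncomputable def seriesInv (f : PowerSeries R) : PowerSeries R := invOfUnit (1 + X * f) 1

theorem mul_seriesInv (f : PowerSeries R) : (1 + X * f) * seriesInv f = 1 :=
  mul_invOfUnit _ _ (by simp)

theorem seriesInv_eq_of_mul {f g : PowerSeries R} (h : (1 + X * f) * g = 1) : g = seriesInv f :=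
  left_inv_eq_right_inv (by rw [mul_comm]; exact h) (mul_seriesInv f)

theorem seriesInv_sub (f g : PowerSeries R) :
    seriesInv f - seriesInv g = X * (g - f) * (seriesInv f * seriesInv g) := by
  linear_combination (-seriesInv f) * mul_seriesInv g + seriesInv g * mul_seriesInv f

theorem map_seriesInv {S : Type*} [CommRing S] (φ : R →+* S) (f : PowerSeries R) :
    PowerSeries.map φ (seriesInv f) = seriesInv (PowerSeries.map φ f) := by
  refine seriesInv_eq_of_mul ?_
  have := congrArg (PowerSeries.map φ) (mul_seriesInv f)
  simpa using this

/-- The inverse of `1 + X f` is the fixed point of `k ↦ 1 - X f k`, whose iterates stay in `D`;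
closedness passes to the limit. -/
theorem seriesInv_mem (D : Subring (PowerSeries R))
    (hD : ∀ f, (∀ n, ∃ g ∈ D, X ^ n ∣ f - g) → f ∈ D) {f : PowerSeries R} (hf : X * f ∈ D) :
    seriesInv f ∈ D := by
  have hc : IsContraction fun k => 1 - X * f * k := by
    intro n k k' h
    obtain ⟨c, hc⟩ := h
    exact ⟨-f * c, by linear_combination (-X * f) * hc⟩
  refine hc.mem_of_closed (D := D) ?_ hD D.zero_mem fun g hg => ?_
  · linear_combination -mul_seriesInv f
  · exact D.sub_mem D.one_mem (D.mul_mem hf hg)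

variable (r : ℕ)

/-- The sum over the chain sizes in the equation for the perturbation. -/
noncomputable def sizeSum (T : ℕ → R) (k : PowerSeries R) : PowerSeries R :=
  ∑ j ∈ Finset.Icc 1 r, C (T j) * k ^ (j - 1)

/-- The operator whose fixed point is the perturbation caused by the marked chains. -/
noncomputable def perturb (a b c d : R) (T : ℕ → R) (f : PowerSeries R) : PowerSeries R :=
  -(C a + C b * (X * f)) * sizeSum r T (seriesInv (C c * f)) - C d * (X * f ^ 2)

/-- Every occurrence of `f` carries a factor `X`. -/
theorem isContraction_perturb (a b c d : R) (T : ℕ → R) :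
    IsContraction (perturb r a b c d T) := by
  intro n f g h
  have h1 : X ^ (n + 1) ∣ seriesInv (C c * f) - seriesInv (C c * g) := by
    obtain ⟨e, he⟩ := h
    rw [seriesInv_sub]
    exact ⟨-C c * e * (seriesInv (C c * f) * seriesInv (C c * g)), by
      linear_combination (-X * C c * (seriesInv (C c * f) * seriesInv (C c * g))) * he⟩
  have h2 : X ^ (n + 1) ∣ sizeSum r T (seriesInv (C c * f)) - sizeSum r T (seriesInv (C c * g)) := by
    rw [sizeSum, sizeSum, ← Finset.sum_sub_distrib]
    refine Finset.dvd_sum fun j _ => ?_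
    rw [← mul_sub]
    exact (h1.trans (sub_dvd_pow_sub_pow _ _ _)).mul_left _
  obtain ⟨e, he⟩ := h
  obtain ⟨e', he'⟩ := h2
  refine ⟨-C b * e * sizeSum r T (seriesInv (C c * f)) - (C a + C b * (X * g)) * e' -
    C d * e * (f + g), ?_⟩
  rw [perturb, perturb]
  linear_combination (-C b * X * sizeSum r T (seriesInv (C c * f)) - C d * X * (f + g)) * he -
    (C a + C b * (X * g)) * he'

theorem map_perturb {S : Type*} [CommRing S] (φ : R →+* S) (a b c d : R) (T : ℕ → R)
    (f : PowerSeries R) :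
    PowerSeries.map φ (perturb r a b c d T f) =
      perturb r (φ a) (φ b) (φ c) (φ d) (fun j => φ (T j)) (PowerSeries.map φ f) := by
  simp [perturb, sizeSum, map_seriesInv]

theorem perturb_congr (a b c d : R) {T T' : ℕ → R} (h : ∀ j ∈ Finset.Icc 1 r, T j = T' j)
    (f : PowerSeries R) : perturb r a b c d T f = perturb r a b c d T' f := by
  have : ∀ k, sizeSum r T k = sizeSum r T' k := fun k =>
    Finset.sum_congr rfl fun j hj => by rw [h j hj]
  rw [perturb, perturb, this]

/-- The change of variables between the two forms of the equation for the perturbation. -/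
theorem perturb_scale {u v z w : R} (hv : v * w = 1) (hu : u * z = -1) (T : ℕ → R)
    (f : PowerSeries R) :
    perturb r u (u + v) 1 (v + 1) T (C w * f) =
      C w * perturb r 1 (w - z) w (1 + w) (fun j => u * v * T j) f := by
  have hv' : (C v : PowerSeries R) * C w = 1 := by rw [← map_mul, hv, map_one]
  have hu' : (C u : PowerSeries R) * C z = -1 := by rw [← map_mul, hu, map_neg, map_one]
  have h1 : ∀ k, sizeSum r (fun j => u * v * T j) k = C u * C v * sizeSum r T k := by
    intro k
    rw [sizeSum, sizeSum, Finset.mul_sum]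
    refine Finset.sum_congr rfl fun j _ => ?_
    rw [map_mul, map_mul]
    ring
  rw [perturb, perturb, h1, map_one, one_mul, map_add, map_add, map_add, map_sub, map_one]
  set S := sizeSum r T (seriesInv (C w * f))
  linear_combination (C u * S + (X * f) * C w * C u * S - C w * X * f ^ 2) * hv' - (C v * C w * X * f * S) * hu'

end Fixpoint

/-! ### The series `Q`, `u`, `v` and the unperturbed solution -/

section Base

/-- The power series `u`. -/
noncomputable def serU : MvPowerSeries (Fin 2) ℚ :=
  (1 + MvPowerSeries.X 0 - MvPowerSeries.X 1 + serQ) * (MvPowerSeries.C (1 / 2) * serQ⁻¹)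

/-- The power series `v`. -/
noncomputable def serV : MvPowerSeries (Fin 2) ℚ :=
  (1 - MvPowerSeries.X 0 + MvPowerSeries.X 1 - serQ) * (MvPowerSeries.C (1 / 2) * serQ⁻¹)

/-- The inverse of the generating function of the nonnesting partitions. -/
noncomputable def serW : MvPowerSeries (Fin 2) ℚ := (serV + 1) * serQ

theorem serQ_mul_inv : serQ * serQ⁻¹ = 1 :=
  MvPowerSeries.mul_inv_cancel _ (by rw [constantCoeff_serQ]; exact one_ne_zero)

theorem two_mul_C_half : 2 * (MvPowerSeries.C (1 / 2) : MvPowerSeries (Fin 2) ℚ) = 1 := by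
  rw [← map_ofNat MvPowerSeries.C 2, ← map_mul, ← map_one MvPowerSeries.C]
  norm_num

theorem two_ne_zero_ser : (2 : MvPowerSeries (Fin 2) ℚ) ≠ 0 :=
  left_ne_zero_of_mul_eq_one two_mul_C_half

theorem serU_mul : serU * (2 * serQ) = 1 + MvPowerSeries.X 0 - MvPowerSeries.X 1 + serQ := by
  rw [serU]
  linear_combination (1 + MvPowerSeries.X 0 - MvPowerSeries.X 1 + serQ) * two_mul_C_half +
    2 * MvPowerSeries.C (1 / 2) * (1 + MvPowerSeries.X 0 - MvPowerSeries.X 1 + serQ) * serQ_mul_inv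

theorem serV_mul : serV * (2 * serQ) = 1 - MvPowerSeries.X 0 + MvPowerSeries.X 1 - serQ := by
  rw [serV]
  linear_combination (1 - MvPowerSeries.X 0 + MvPowerSeries.X 1 - serQ) * two_mul_C_half +
    2 * MvPowerSeries.C (1 / 2) * (1 - MvPowerSeries.X 0 + MvPowerSeries.X 1 - serQ) * serQ_mul_inv

theorem serU_add_serV : (serU + serV) * serQ = 1 := by
  have h2 : (2 : MvPowerSeries (Fin 2) ℚ) ≠ 0 := two_ne_zero_ser
  apply mul_left_cancel₀ h2
  linear_combination serU_mul + serV_mul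

/-- From `2vQ = 1 - x + y - Q` follows `4v(v+1)Q² = (1-x+y)² - Q²`, which is `4y`. -/
theorem X_one_eq : (MvPowerSeries.X 1 : MvPowerSeries (Fin 2) ℚ) = serV * (serV + 1) * serQ ^ 2 := by
  have h2 : (4 : MvPowerSeries (Fin 2) ℚ) ≠ 0 := by
    rw [show (4 : MvPowerSeries (Fin 2) ℚ) = 2 * 2 by norm_num]
    exact mul_ne_zero two_ne_zero_ser two_ne_zero_ser
  apply mul_left_cancel₀ h2
  have h1 := serQ_sq
  rw [discr] at h1
  have h3 := serV_mul
  linear_combination h1 - (serV * (2 * serQ) + 1 - MvPowerSeries.X 0 + MvPowerSeries.X 1 - serQ + 2 * serQ) * h3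

theorem X_zero_eq : (MvPowerSeries.X 0 : MvPowerSeries (Fin 2) ℚ) = serU * (serU - 1) * serQ ^ 2 := by
  have h2 : (4 : MvPowerSeries (Fin 2) ℚ) ≠ 0 := by
    rw [show (4 : MvPowerSeries (Fin 2) ℚ) = 2 * 2 by norm_num]
    exact mul_ne_zero two_ne_zero_ser two_ne_zero_ser
  apply mul_left_cancel₀ h2
  have h1 := serQ_sq
  rw [discr] at h1
  have h3 := serU_mul
  linear_combination h1 - (serU * (2 * serQ) + 1 + MvPowerSeries.X 0 - MvPowerSeries.X 1 + serQ - 2 * serQ) * h3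

theorem constantCoeff_serU : MvPowerSeries.constantCoeff serU = 1 := by
  simp [serU, constantCoeff_serQ]
  norm_num

theorem constantCoeff_serV : MvPowerSeries.constantCoeff serV = 0 := by
  simp [serV, constantCoeff_serQ]

theorem constantCoeff_serW : MvPowerSeries.constantCoeff serW = 1 := by
  simp [serW, constantCoeff_serQ, constantCoeff_serV]

theorem serU_mul_inv : serU * serU⁻¹ = 1 :=
  MvPowerSeries.mul_inv_cancel _ (by rw [constantCoeff_serU]; exact one_ne_zero)

theorem serW_mul_inv : serW * serW⁻¹ = 1 :=
  MvPowerSeries.mul_inv_cancel _ (by rw [constantCoeff_serW]; exact one_ne_zero)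

end Base

/-! ### The generating function as the inverse of a perturbed series -/

section Generating

/-- The constants of `Ser ℚ`. -/
noncomputable def serC : MvPowerSeries (Fin 2) ℚ →+* Ser ℚ :=
  PowerSeries.C.comp MvPolynomial.C

theorem serMon_size (j : ℕ) : serMon ℚ (.ofAdd (0, 1, Finsupp.single j 1)) =
    PowerSeries.X * PowerSeries.C (MvPolynomial.X j) := by
  simp only [serMon, MonoidHom.coe_mk, OneHom.coe_mk, toAdd_ofAdd]
  rw [MvPowerSeries.monomial_zero_eq_C_apply, map_one]
  ext n
  rw [PowerSeries.coeff_monomial]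
  cases n with
  | zero => simp
  | succ n => rw [PowerSeries.coeff_succ_X_mul, PowerSeries.coeff_C]; simp [MvPolynomial.X]

theorem serMon_base (i : Fin 2) : serMon ℚ (.ofAdd (Finsupp.single i 1, 0, 0)) =
    serC (MvPowerSeries.X i) := by
  simp only [serMon, MonoidHom.coe_mk, OneHom.coe_mk, toAdd_ofAdd]
  rw [PowerSeries.monomial_zero_eq_C_apply]
  rfl

theorem serC_mem_suppOn {b : MvPowerSeries (Fin 2) ℚ} (hb : MvPowerSeries.constantCoeff b = 0) :
    serC b ∈ suppOn ℚ {d | 1 ≤ vertexCount d} := by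
  rintro ⟨e, n, σ⟩ h
  rw [coef_apply] at h
  simp only [serC, RingHom.comp_apply, PowerSeries.coeff_C] at h
  split_ifs at h with hn
  · rw [MvPolynomial.coeff_C] at h
    split_ifs at h with hσ
    · simp only [Set.mem_ofPred_eq, vertexCount_apply]
      have he : e ≠ 0 := by
        rintro rfl
        exact h hb
      have := Finsupp.degree_eq_zero_iff e |>.not.mpr he
      omega
    · simp at h
  · simp at h

variable (r : ℕ)

/-- The coefficients of the equation for the perturbation, over `ℚ⟦x, y⟧`. -/
noncomputable def sizeVar (j : ℕ) : MvPolynomial ℕ (MvPowerSeries (Fin 2) ℚ) :=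
  MvPolynomial.C (serW⁻¹ ^ (j - 1)) * MvPolynomial.X j

/-- The variable for chains of size one, if there are any. -/
noncomputable def oneVar (R : Type*) [CommSemiring R] : MvPolynomial ℕ R :=
  if 1 ≤ r then MvPolynomial.X 1 else 0

/-- The reciprocal of the generating function is this series times `Q`. -/
noncomputable def recipSeries (f : Ser ℚ) : Ser ℚ :=
  serC (2 * (serV + 1)) * f + serC (serU + serV) *
    (PowerSeries.C (oneVar r _) - PowerSeries.C (MvPolynomial.X 0))

/-- For marked chains the recursion gives `V_k = ∑_{i>k} t_i W^{k-i}`, for unmarked ones `V = xy/(W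
- y)`. With `W = (v+1)Q(1+ε)` one has `W - y = (v+1)Q²δ` for `δ = u + (u+v)ε`, so `start` becomes,
after multiplication by `δ`, the fixed point equation for `ε = X f`. -/
theorem exists_queueSolution {f : Ser ℚ}
    (hf : perturb r (MvPolynomial.C serU) (MvPolynomial.C (serU + serV)) 1
      (MvPolynomial.C (serV + 1)) sizeVar f = f) :
    ∃ V W, QueueSolution (chainWt (serMon ℚ) r) (edgeWt (serMon ℚ)) (loopWt (serMon ℚ)) V W
        (serC serQ⁻¹ * seriesInv (recipSeries r f)) ∧
      ∀ b k, V b k ∈ suppOn ℚ {d | (if b then k else 1) ≤ vertexCount d} := by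
  set k := seriesInv f with hk
  set ε : Ser ℚ := PowerSeries.X * f with hε
  have hεk : (1 + ε) * k = 1 := mul_seriesInv f
  set S : Ser ℚ := PowerSeries.X * sizeSum r sizeVar k with hS
  have hQ : serC serQ * serC serQ⁻¹ = 1 := by rw [← map_mul, serQ_mul_inv, map_one]
  have hW0 : serC serW * serC serW⁻¹ = 1 := by rw [← map_mul, serW_mul_inv, map_one]
  have hU : serC serU * serC serU⁻¹ = 1 := by rw [← map_mul, serU_mul_inv, map_one]
  have hW : serC serW = (serC serV + 1) * serC serQ := by rw [serW]; simp
  have hUV : (serC serU + serC serV) * serC serQ = 1 := by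
    rw [← map_add, ← map_mul, serU_add_serV, map_one]
  have hy : serC (MvPowerSeries.X 1) = serC serV * (serC serV + 1) * serC serQ ^ 2 := by
    rw [X_one_eq]; simp
  have hx : serC (MvPowerSeries.X 0) = serC serU * (serC serU - 1) * serC serQ ^ 2 := by
    rw [X_zero_eq]; simp
  have hVQ : 2 * serC serV * serC serQ = 1 - serC (MvPowerSeries.X 0) +
      serC (MvPowerSeries.X 1) - serC serQ := by
    have := congrArg serC serV_mul
    simp only [map_mul, map_add, map_sub, map_one, map_ofNat] at this
    linear_combination this
  have heq : ε = -(serC serU + (serC serU + serC serV) * ε) * S - (serC serV + 1) * ε ^ 2 := by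
    have h1 : f = -(serC serU + (serC serU + serC serV) * ε) * sizeSum r sizeVar k -
        (serC serV + 1) * (PowerSeries.X * f ^ 2) := by
      nth_rewrite 1 [← hf]
      rw [perturb, map_one, one_mul, ← hk]
      simp [serC, hε]
    rw [hε, hS]
    linear_combination PowerSeries.X * h1
  set δ : Ser ℚ := serC serU + (serC serU + serC serV) * ε with hδ
  set g : Ser ℚ := serC serU⁻¹ * seriesInv (serC (serU⁻¹ * (serU + serV)) * f) with hg
  have hδg : δ * g = 1 := by
    have h1 := mul_seriesInv (serC (serU⁻¹ * (serU + serV)) * f)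
    rw [hδ, hg, hε]
    simp only [map_mul, map_add] at h1 ⊢
    linear_combination h1 + (seriesInv (serC serU⁻¹ * (serC serU + serC serV) * f)) * hU
  -- This is `xv/δ`, the unmarked `V`, which does not depend on the length of the chain. The factor
  -- `v` shows that it has no constant term.
  set c : Ser ℚ := serC (serU * (serU - 1) * serQ ^ 2) * serC serV * g with hc
  have hcx : c = serC (MvPowerSeries.X 0) * serC serV * g := by rw [hc, ← X_zero_eq]
  set t : ℕ → Ser ℚ := chainWt (serMon ℚ) r true with ht
  have ht' : ∀ j, t j = if j ≤ r then PowerSeries.X * PowerSeries.C (MvPolynomial.X j) else 0 := by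
    intro j
    rw [ht, chainWt, if_pos rfl, serMon_size]
  set U : Ser ℚ := serC serW⁻¹ * k with hUU
  set W : Ser ℚ := serC serW * (1 + ε) with hWW
  have hUW : U * W = 1 := by
    rw [hUU, hWW]
    linear_combination hW0 * ((1 + ε) * k) + hεk
  set Vt : ℕ → Ser ℚ := fun k => ∑ i ∈ Finset.Ioc k r, t i * U ^ (i - k) with hVt
  have hstep : ∀ j, Vt j * W = t (j + 1) + Vt (j + 1) := by
    intro j
    have h1 : ∀ i ∈ Finset.Ioc j r, t i * U ^ (i - j) * W = t i * U ^ (i - (j + 1)) := by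
      intro i hi
      have h2 : i - j = i - (j + 1) + 1 := by
        have := (Finset.mem_Ioc.mp hi).1
        omega
      rw [h2, pow_succ]
      linear_combination (t i * U ^ (i - (j + 1))) * hUW
    simp only [hVt]
    rw [Finset.sum_mul, Finset.sum_congr rfl h1]
    by_cases hj : j < r
    · have : Finset.Ioc j r = insert (j + 1) (Finset.Ioc (j + 1) r) := by
        ext i
        simp only [Finset.mem_Ioc, Finset.mem_insert]
        omega
      rw [this, Finset.sum_insert (by simp)]
      simp
    · rw [Finset.Ioc_eq_empty hj, Finset.Ioc_eq_empty (by omega), ht', if_neg (by omega)]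
      simp
  -- The left side is `Vt 0 * W`, so each `t i` ends up with `W` to the power `-(i - 1)`; the part
  -- of this coming from the unperturbed `W` is built into `sizeVar`.
  have hSum : t 1 + Vt 1 = S := by
    rw [← hstep 0, hS, sizeSum, Finset.mul_sum, Finset.sum_mul]
    refine Finset.sum_congr rfl fun i hi => ?_
    have hi' := Finset.mem_Icc.mp hi
    have h2 : i - 0 = i - 1 + 1 := by omega
    rw [h2, pow_succ, ht', if_pos hi'.2, sizeVar, map_mul]
    have h3 : PowerSeries.C (MvPolynomial.C (σ := ℕ) (serW⁻¹ ^ (i - 1))) = serC serW⁻¹ ^ (i - 1) := by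
      rw [← map_pow]
      rfl
    rw [h3, hUU, mul_pow]
    rw [hUU] at hUW
    linear_combination (PowerSeries.X * PowerSeries.C (MvPolynomial.X i) *
      (serC serW⁻¹ ^ (i - 1) * k ^ (i - 1))) * hUW
  have ht1 : t 1 = PowerSeries.X * PowerSeries.C (oneVar r _) := by
    rw [ht', oneVar]
    split_ifs
    · rfl
    · simp
  have hfalse : c * W = serC (MvPowerSeries.X 1) * (serC (MvPowerSeries.X 0) + c) := by
    have h1 : W - serC (MvPowerSeries.X 1) = (serC serV + 1) * serC serQ ^ 2 * δ := by
      rw [hWW, hy, hW, hδ]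
      linear_combination (-(serC serV + 1) * serC serQ * (1 + ε)) * hUV
    rw [hcx]
    linear_combination (serC (MvPowerSeries.X 0) * serC serV * g) * h1 +
      (serC (MvPowerSeries.X 0) * serC serV * (serC serV + 1) * serC serQ ^ 2) * hδg -
      serC (MvPowerSeries.X 0) * hy
  have hstart : S + serC (MvPowerSeries.X 0) + c = 1 - W := by
    have h1 : (S + serC (MvPowerSeries.X 0) - 1 + W) * δ +
        serC (MvPowerSeries.X 0) * serC serV = 0 := by
      have h2 : S * δ = -ε - (serC serV + 1) * ε ^ 2 := by linear_combination heq
      rw [hδ] at h2 ⊢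
      rw [hWW]
      linear_combination h2 + (serC serU + (serC serU + serC serV) * ε + serC serV) * hx +
        (1 + ε) * (serC serU + (serC serU + serC serV) * ε) * hW +
        (serC serU * (serC serU - 1) * serC serQ * (1 + ε) + (serC serV + 1) * (1 + ε) * ε +
          (1 + ε) * serC serU) * hUV
    linear_combination g * h1 - (S + serC (MvPowerSeries.X 0) - 1 + W) * hδg + hcx
  have hxw : ∀ j, chainWt (serMon ℚ) r false j = serC (MvPowerSeries.X 0) := fun j =>
    serMon_base 0
  have hyw : edgeWt (serMon ℚ) false = serC (MvPowerSeries.X 1) := serMon_base 1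
  have hyt : edgeWt (serMon ℚ) true = 1 := rfl
  have hlt : loopWt (serMon ℚ) true = PowerSeries.X * PowerSeries.C (MvPolynomial.X 0) :=
    serMon_size 0
  have hlf : loopWt (serMon ℚ) false = 1 := rfl
  refine ⟨fun b j => if b then Vt j else c, W, ⟨?_, ?_, ?_⟩, ?_⟩
  · intro b j
    cases b
    · simp only [Bool.false_eq_true, if_false, hxw, hyw]
      exact hfalse
    · simp only [if_true, hyt, one_mul]
      exact hstep j
  · simp only [Fintype.sum_bool, hxw, Bool.false_eq_true, if_true, if_false]
    linear_combination hstart + hSum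
  · simp only [Fintype.sum_bool, hxw, hyw, hyt, hlt, hlf, Bool.false_eq_true, if_true, if_false]
    change _ * (1 - (t 1 + _ + _) - _) = 1
    -- By `start` the left side is `2W - (1 - x + y)` plus `t 1` minus the loop weight. Its
    -- unperturbed part is `Q`, and `1 = (u+v)Q` lets `Q` be factored out of the rest.
    have h1 : 1 - (t 1 + 1 * (PowerSeries.X * PowerSeries.C (MvPolynomial.X 0)) +
        (serC (MvPowerSeries.X 0) + serC (MvPowerSeries.X 1) * 1)) - 2 * (Vt 1 + c) =
        serC serQ * (1 + PowerSeries.X * recipSeries r f) := by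
      have h2 : PowerSeries.X * recipSeries r f = 2 * (serC serV + 1) * ε +
          (serC serU + serC serV) * (t 1 - PowerSeries.X * PowerSeries.C (MvPolynomial.X 0)) := by
        rw [ht1, recipSeries, hε]
        simp only [map_mul, map_add, map_one, map_ofNat]
        ring
      rw [h2]
      have h3 : W = (serC serV + 1) * serC serQ * (1 + ε) := by rw [hWW, hW]
      linear_combination -2 * hstart - 2 * hSum + 2 * h3 + hVQ -
        (t 1 - PowerSeries.X * PowerSeries.C (MvPolynomial.X 0)) * hUV
    rw [h1]
    linear_combination (seriesInv (recipSeries r f) * (1 + PowerSeries.X * recipSeries r f)) * hQ +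
      mul_seriesInv (recipSeries r f)
  · intro b j
    have hF : ∀ d, serMon ℚ (.ofAdd d) ∈ suppOn ℚ {d' | vertexCount d ≤ vertexCount d'} := fun d =>
      serMon_mem_suppOn (le_refl (vertexCount d))
    cases b
    · simp only [Bool.false_eq_true, if_false, hc]
      refine mul_mem_suppOn (S := {d | 1 ≤ vertexCount d}) (S' := Set.univ) ?_
        (mul_mem_suppOn (S := Set.univ) ?_ (fun _ _ => Set.mem_univ _)
          (serC_mem_suppOn constantCoeff_serV)) (fun _ _ => Set.mem_univ _) <;>
      · intro d hd d' hd'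
        simp only [Set.mem_ofPred_eq, map_add] at hd hd' ⊢
        omega
    · simp only [if_true, hVt]
      refine AddSubgroup.sum_mem _ fun i hi => ?_
      have hi := (Finset.mem_Ioc.mp hi).1
      obtain ⟨i, rfl⟩ : ∃ i', i = i' + 1 := ⟨i - 1, by omega⟩
      refine mul_mem_suppOn (S' := Set.univ) ?_
        (chainWt_mem r (fun n => suppOn ℚ {d | n ≤ vertexCount d}) hF true i)
        (fun _ _ => Set.mem_univ _)
      intro d hd d' _
      simp only [Set.mem_ofPred_eq, map_add, if_true] at hd ⊢
      omega

end Generating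

theorem coeff_generating {r : ℕ} (τ : ChainType r) {f : Ser ℚ}
    (hf : perturb r (MvPolynomial.C serU) (MvPolynomial.C (serU + serV)) 1
      (MvPolynomial.C (serV + 1)) sizeVar f = f) :
    serQ⁻¹ * (PowerSeries.coeff τ.expo.degree (seriesInv (recipSeries r f))).coeff τ.expo =
      MvPowerSeries.map (Int.castRingHom ℚ) (genH τ) := by
  obtain ⟨V, W, h, hV⟩ := exists_queueSolution r hf
  ext e
  have h1 := coef_eq_hCount τ h hV e
  rw [coef_apply, serC, RingHom.comp_apply, PowerSeries.coeff_C_mul, MvPolynomial.coeff_C_mul] at h1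
  rw [MvPowerSeries.coeff_map]
  simp only at h1
  rw [h1]
  exact (map_natCast (Int.castRingHom ℚ) _).symm

/-! ### The universal equation over `ℤ[z, w]` and the polynomials -/

section Universal

/-- The reciprocal of the generating function of the polynomials `P` is `1 + X` times this. -/
noncomputable def polyRecip (r : ℕ) (f : PowerSeries (MvPolynomial ℕ (MvPolynomial (Fin 2) ℤ))) :
    PowerSeries (MvPolynomial ℕ (MvPolynomial (Fin 2) ℤ)) :=
  PowerSeries.C (MvPolynomial.C (2 * (MvPolynomial.X 1 + 1))) * f +
    PowerSeries.C (MvPolynomial.C (MvPolynomial.X 1 - MvPolynomial.X 0)) *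
      PowerSeries.C (oneVar r _) - PowerSeries.C (MvPolynomial.X 0)

/-- The operator defining the perturbation over `ℤ[z, w]`. -/
noncomputable def polyPerturb (r : ℕ) :
    PowerSeries (MvPolynomial ℕ (MvPolynomial (Fin 2) ℤ)) →
      PowerSeries (MvPolynomial ℕ (MvPolynomial (Fin 2) ℤ)) :=
  perturb r 1 (MvPolynomial.C (MvPolynomial.X 1 - MvPolynomial.X 0))
    (MvPolynomial.C (MvPolynomial.X 1)) (MvPolynomial.C (1 + MvPolynomial.X 1)) MvPolynomial.X

theorem isContraction_polyPerturb (r : ℕ) : IsContraction (polyPerturb r) :=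
  isContraction_perturb r _ _ _ _ _

/-- The inclusion of `ℤ[z, w]` into `ℤ⟦z, w⟧`, applied to all coefficients. -/
noncomputable def polyToSer : PowerSeries (MvPolynomial ℕ (MvPolynomial (Fin 2) ℤ)) →+* Ser ℤ :=
  PowerSeries.map (MvPolynomial.map MvPolynomial.coeToMvPowerSeries.ringHom)

theorem coef_polyToSer (d : Expo) (f : PowerSeries (MvPolynomial ℕ (MvPolynomial (Fin 2) ℤ))) :
    coef d (polyToSer f) = ((PowerSeries.coeff d.2.1 f).coeff d.2.2).coeff d.1 := by
  simp [coef_apply, polyToSer, MvPolynomial.coeff_map]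

/-- The series all of whose exponents belong to a submonoid. -/
def suppRing (S : AddSubmonoid Expo) : Subring (Ser ℤ) :=
  { suppOn ℤ (S : Set Expo) with
    one_mem' := by
      have := serMon_mem_suppOn (R := ℤ) (S := (S : Set Expo)) (d := 0) S.zero_mem
      simpa using this
    mul_mem' := fun ha hb => mul_mem_suppOn (fun d hd d' hd' => S.add_mem hd hd') ha hb }

/-- Each coefficient is determined by a truncation in `X`, so a condition on supports survives
limits. -/
theorem polyToSer_closed {S : Set Expo} {f : PowerSeries (MvPolynomial ℕ (MvPolynomial (Fin 2) ℤ))}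
    (h : ∀ n, ∃ g, polyToSer g ∈ suppOn ℤ S ∧ PowerSeries.X ^ n ∣ f - g) :
    polyToSer f ∈ suppOn ℤ S := by
  intro d hd
  obtain ⟨g, hg, hdvd⟩ := h (d.2.1 + 1)
  refine hg d ?_
  rw [coef_polyToSer] at hd ⊢
  have := PowerSeries.X_pow_dvd_iff.mp hdvd d.2.1 (Nat.lt_succ_self _)
  rw [map_sub, sub_eq_zero] at this
  rwa [← this]

/-- The series in `ℤ[z, w]` all of whose exponents belong to a submonoid. -/
noncomputable def polySuppRing (S : AddSubmonoid Expo) :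
    Subring (PowerSeries (MvPolynomial ℕ (MvPolynomial (Fin 2) ℤ))) :=
  (suppRing S).comap polyToSer

theorem mem_polySuppRing {S : AddSubmonoid Expo}
    {f : PowerSeries (MvPolynomial ℕ (MvPolynomial (Fin 2) ℤ))} :
    f ∈ polySuppRing S ↔
      ∀ d : Expo, ((PowerSeries.coeff d.2.1 f).coeff d.2.2).coeff d.1 ≠ 0 → d ∈ S := by
  simp only [← coef_polyToSer]
  rfl

theorem polySuppRing_closed (S : AddSubmonoid Expo)
    (f : PowerSeries (MvPolynomial ℕ (MvPolynomial (Fin 2) ℤ)))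
    (h : ∀ n, ∃ g ∈ polySuppRing S, PowerSeries.X ^ n ∣ f - g) : f ∈ polySuppRing S :=
  polyToSer_closed h

/-- Exponents `(e, n, σ)` with `|e| + σ 0 ≤ n`. -/
def degreeBound : AddSubmonoid Expo where
  carrier := {d | d.1.degree + d.2.2 0 ≤ d.2.1}
  zero_mem' := by simp
  add_mem' := by
    intro d d' h h'
    simp only [Set.mem_ofPred_eq, Prod.fst_add, Prod.snd_add, map_add, Finsupp.add_apply] at h h' ⊢
    omega

theorem mem_degreeBound {d : Expo} : d ∈ degreeBound ↔ d.1.degree + d.2.2 0 ≤ d.2.1 := Iff.rfl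

theorem linear_mem_degreeBound {p : MvPolynomial (Fin 2) ℤ} (hp : p.totalDegree ≤ 1) :
    PowerSeries.X * PowerSeries.C (MvPolynomial.C p) ∈ polySuppRing degreeBound := by
  rw [mem_polySuppRing]
  rintro ⟨e, n, σ⟩ h
  cases n with
  | zero => simp at h
  | succ n =>
    simp only [PowerSeries.coeff_succ_X_mul, PowerSeries.coeff_C] at h
    split_ifs at h with hn
    · rw [MvPolynomial.coeff_C] at h
      split_ifs at h with hσ
      · have h1 := MvPolynomial.le_totalDegree (MvPolynomial.mem_support_iff.mpr h)
        rw [mem_degreeBound, ← hσ, hn]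
        rw [Finsupp.sum, ← Finsupp.degree_apply] at h1
        simpa using h1.trans hp
      · simp at h
    · simp at h

theorem sizeVar_mem_degreeBound {j : ℕ} (hj : j ≠ 0) :
    PowerSeries.C (MvPolynomial.X j) ∈ polySuppRing degreeBound := by
  rw [mem_polySuppRing]
  rintro ⟨e, n, σ⟩ h
  simp only [PowerSeries.coeff_C] at h
  split_ifs at h with hn
  · rw [MvPolynomial.coeff_X] at h
    split_ifs at h with hσ
    · rw [MvPolynomial.coeff_one] at h
      split_ifs at h with he
      · rw [mem_degreeBound, ← he, ← hσ]
        simp [hj.symm]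
      · simp at h
    · simp at h
  · simp at h

theorem loopVar_mem_degreeBound :
    PowerSeries.X * PowerSeries.C (MvPolynomial.X 0) ∈ polySuppRing degreeBound := by
  rw [mem_polySuppRing]
  rintro ⟨e, n, σ⟩ h
  cases n with
  | zero => simp at h
  | succ n =>
    simp only [PowerSeries.coeff_succ_X_mul, PowerSeries.coeff_C] at h
    split_ifs at h with hn
    · rw [MvPolynomial.coeff_X] at h
      split_ifs at h with hσ
      · rw [MvPolynomial.coeff_one] at h
        split_ifs at h with he
        · rw [mem_degreeBound, ← he, ← hσ]
          simp
        · simp at h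
      · simp at h
    · simp at h

variable {r : ℕ} {f : PowerSeries (MvPolynomial ℕ (MvPolynomial (Fin 2) ℤ))}

theorem totalDegree_X_sub_X_le :
    (MvPolynomial.X 1 - MvPolynomial.X 0 : MvPolynomial (Fin 2) ℤ).totalDegree ≤ 1 :=
  (MvPolynomial.totalDegree_sub _ _).trans (by simp)

theorem totalDegree_one_add_X_le :
    (1 + MvPolynomial.X 1 : MvPolynomial (Fin 2) ℤ).totalDegree ≤ 1 :=
  (MvPolynomial.totalDegree_add _ _).trans (by simp)

/-- In the equations every coefficient linear in `z, w`, and also the loop variable, comes with its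
own factor `X`, whereas the chain variables are free. These building blocks satisfy the bound, and
it passes to products, sums and limits. -/
theorem seriesInv_polyRecip_mem (hf : polyPerturb r f = f) :
    seriesInv (polyRecip r f) ∈ polySuppRing degreeBound := by
  have h1 := linear_mem_degreeBound totalDegree_X_sub_X_le
  have h2 := linear_mem_degreeBound totalDegree_one_add_X_le
  have h3 := linear_mem_degreeBound (p := MvPolynomial.X 1) (by simp)
  have hfD : f ∈ polySuppRing degreeBound := by
    refine (isContraction_polyPerturb r).mem_of_closed hf (polySuppRing_closed degreeBound)
      (Subring.zero_mem _) fun g hg => ?_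
    have hk : seriesInv (PowerSeries.C (MvPolynomial.C (MvPolynomial.X 1)) * g) ∈
        polySuppRing degreeBound := by
      refine seriesInv_mem _ (polySuppRing_closed degreeBound) ?_
      rw [← mul_assoc]
      exact Subring.mul_mem _ h3 hg
    have hS : sizeSum r MvPolynomial.X
        (seriesInv (PowerSeries.C (MvPolynomial.C (MvPolynomial.X 1)) * g)) ∈
        polySuppRing degreeBound := by
      refine Subring.sum_mem _ fun j hj => Subring.mul_mem _ ?_ (Subring.pow_mem _ hk _)
      exact sizeVar_mem_degreeBound (by have := (Finset.mem_Icc.mp hj).1; omega)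
    rw [polyPerturb, perturb, map_one, ← mul_assoc, mul_comm (PowerSeries.C _) PowerSeries.X,
      mul_left_comm, ← mul_assoc PowerSeries.X]
    exact Subring.sub_mem _ (Subring.mul_mem _ (Subring.neg_mem _ (Subring.add_mem _
      (Subring.one_mem _) (Subring.mul_mem _ h1 hg))) hS)
      (Subring.mul_mem _ h2 (Subring.pow_mem _ hg 2))
  refine seriesInv_mem _ (polySuppRing_closed degreeBound) ?_
  have h4 : PowerSeries.C (oneVar r (MvPolynomial (Fin 2) ℤ)) ∈ polySuppRing degreeBound := by
    rw [oneVar]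
    split_ifs
    · exact sizeVar_mem_degreeBound one_ne_zero
    · rw [map_zero]
      exact Subring.zero_mem _
  have h5 : PowerSeries.X * polyRecip r f =
      2 * (PowerSeries.X * PowerSeries.C (MvPolynomial.C (1 + MvPolynomial.X 1)) * f) +
      PowerSeries.X * PowerSeries.C (MvPolynomial.C (MvPolynomial.X 1 - MvPolynomial.X 0)) *
        PowerSeries.C (oneVar r _) - PowerSeries.X * PowerSeries.C (MvPolynomial.X 0) := by
    rw [polyRecip]
    simp only [map_mul, map_add, map_one, map_ofNat]
    ring
  rw [h5, two_mul]
  have h6 := Subring.mul_mem _ h2 hfD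
  exact Subring.sub_mem _ (Subring.add_mem _ (Subring.add_mem _ h6 h6) (Subring.mul_mem _ h1 h4))
    loopVar_mem_degreeBound

/-- The polynomial belonging to a chain type. -/
noncomputable def chainPoly {r : ℕ} (τ : ChainType r)
    (f : PowerSeries (MvPolynomial ℕ (MvPolynomial (Fin 2) ℤ))) : MvPolynomial (Fin 2) ℤ :=
  (PowerSeries.coeff τ.expo.degree (seriesInv (polyRecip r f))).coeff τ.expo

theorem degree_le_of_coeff_ne_zero (hf : polyPerturb r f = f) (τ : ChainType r) {e : Fin 2 →₀ ℕ}
    (he : (chainPoly τ f).coeff e ≠ 0) : e.degree ≤ τ.partition.parts.card := by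
  have h1 := mem_polySuppRing.mp (seriesInv_polyRecip_mem hf) (e, τ.expo.degree, τ.expo) he
  rw [mem_degreeBound] at h1
  simp only at h1
  rw [τ.expo_zero, τ.degree_expo] at h1
  omega

/-- If some chain has at least two vertices, then the polynomial is divisible by `2 (w + 1)`. -/
theorem dvd_chainPoly (τ : ChainType r) {j : ℕ} (hj : 2 ≤ j) (hjτ : τ.expo j ≠ 0) :
    2 * (MvPolynomial.X 1 + 1) ∣ chainPoly τ f := by
  set S : AddSubmonoid Expo :=
    { carrier := {d | d.2.2 j = 0}
      zero_mem' := by simp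
      add_mem' := by
        intro d d' h h'
        simp only [Set.mem_ofPred_eq, Prod.snd_add, Finsupp.add_apply] at h h' ⊢
        omega } with hS
  -- This is `polyRecip r f` modulo `2(w+1)`. It does not involve the variable of index `j ≥ 2`, so
  -- its inverse contributes nothing to the monomial of `τ`.
  set a : PowerSeries (MvPolynomial ℕ (MvPolynomial (Fin 2) ℤ)) :=
    PowerSeries.C (MvPolynomial.C (MvPolynomial.X 1 - MvPolynomial.X 0)) *
      PowerSeries.C (oneVar r _) - PowerSeries.C (MvPolynomial.X 0) with ha
  have hvar : ∀ i, i ≠ j → PowerSeries.C (MvPolynomial.X i) ∈ polySuppRing S := by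
    intro i hi
    rw [mem_polySuppRing]
    rintro ⟨e, n, σ⟩ h
    simp only [PowerSeries.coeff_C] at h
    split_ifs at h with hn
    · rw [MvPolynomial.coeff_X] at h
      split_ifs at h with hσ
      · change σ j = 0
        rw [← hσ]
        simp [hi]
      · simp at h
    · simp at h
  have hconst : ∀ p : MvPolynomial (Fin 2) ℤ,
      PowerSeries.C (MvPolynomial.C p) ∈ polySuppRing S := by
    intro p
    rw [mem_polySuppRing]
    rintro ⟨e, n, σ⟩ h
    simp only [PowerSeries.coeff_C] at h
    split_ifs at h with hn
    · rw [MvPolynomial.coeff_C] at h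
      split_ifs at h with hσ
      · change σ j = 0
        rw [← hσ]
        simp
      · simp at h
    · simp at h
  have hX : PowerSeries.X ∈ polySuppRing S := by
    rw [mem_polySuppRing]
    rintro ⟨e, n, σ⟩ h
    simp only [PowerSeries.coeff_X] at h
    split_ifs at h with hn
    · rw [MvPolynomial.coeff_one] at h
      split_ifs at h with hσ
      · change σ j = 0
        rw [← hσ]
        simp
      · simp at h
    · simp at h
  have haS : seriesInv a ∈ polySuppRing S := by
    refine seriesInv_mem _ (polySuppRing_closed S) (Subring.mul_mem _ hX (Subring.sub_mem _
      (Subring.mul_mem _ (hconst _) ?_) (hvar 0 (by omega))))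
    rw [oneVar]
    split_ifs
    · exact hvar 1 (by omega)
    · rw [map_zero]
      exact Subring.zero_mem _
  have h0 : (PowerSeries.coeff τ.expo.degree (seriesInv a)).coeff τ.expo = 0 := by
    ext e
    by_contra h
    exact hjτ (mem_polySuppRing.mp haS (e, τ.expo.degree, τ.expo) (by simpa using h))
  have h1 : seriesInv (polyRecip r f) = seriesInv a +
      PowerSeries.C (MvPolynomial.C (2 * (MvPolynomial.X 1 + 1))) *
        (-(PowerSeries.X * f * (seriesInv (polyRecip r f) * seriesInv a))) := by
    have h2 := seriesInv_sub (polyRecip r f) a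
    have h3 : a - polyRecip r f =
        -(PowerSeries.C (MvPolynomial.C (2 * (MvPolynomial.X 1 + 1))) * f) := by
      rw [ha, polyRecip]
      ring
    rw [h3] at h2
    linear_combination h2
  rw [chainPoly, h1, map_add, MvPolynomial.coeff_add, h0, zero_add, PowerSeries.coeff_C_mul,
    MvPolynomial.coeff_C_mul]
  exact dvd_mul_right _ _

/-- If there are only loops, then the polynomial is equal to `1`. -/
theorem chainPoly_eq_one (hf : polyPerturb r f = f) (τ : ChainType r)
    (hτ : τ.partition.parts = 0) : chainPoly τ f = 1 := by
  -- Monomials containing at least one chain variable. They span an ideal that contains `f` and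
  -- `T_1`; modulo it the generating function is `1 / (1 - X T_0)`, all of whose coefficients are
  -- `1`.
  set S : Set Expo := {d | ∃ j, j ≠ 0 ∧ d.2.2 j ≠ 0} with hS
  have hmul : ∀ a b, polyToSer a ∈ suppOn ℤ S → polyToSer (a * b) ∈ suppOn ℤ S := by
    intro a b ha
    rw [map_mul]
    refine mul_mem_suppOn (S' := Set.univ) ?_ ha fun _ _ => Set.mem_univ _
    rintro d ⟨j, hj, hd⟩ d' -
    refine ⟨j, hj, ?_⟩
    rw [Prod.snd_add, Prod.snd_add, Finsupp.add_apply]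
    omega
  have hvar : ∀ j, j ≠ 0 → polyToSer (PowerSeries.C (MvPolynomial.X j)) ∈ suppOn ℤ S := by
    rintro j hj ⟨e, n, σ⟩ h
    rw [coef_polyToSer] at h
    simp only [PowerSeries.coeff_C] at h
    split_ifs at h with hn
    · rw [MvPolynomial.coeff_X] at h
      split_ifs at h with hσ
      · exact ⟨j, hj, by simp [← hσ]⟩
      · simp at h
    · simp at h
  have hfS : polyToSer f ∈ suppOn ℤ S := by
    refine (isContraction_polyPerturb r).mem_of_closed (D := {f | polyToSer f ∈ suppOn ℤ S}) hf
      (fun f h => polyToSer_closed h) (by simp) fun g hg => ?_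
    rw [Set.mem_ofPred_eq] at hg ⊢
    rw [polyPerturb, perturb, map_sub]
    refine AddSubgroup.sub_mem _ ?_ ?_
    · rw [mul_comm]
      refine hmul _ _ ?_
      rw [sizeSum, map_sum]
      refine AddSubgroup.sum_mem _ fun j hj => hmul _ _ (hvar j ?_)
      have := (Finset.mem_Icc.mp hj).1
      omega
    · rw [pow_two, mul_left_comm PowerSeries.X, mul_left_comm]
      exact hmul _ _ hg
  have hone : polyToSer (PowerSeries.C (oneVar r (MvPolynomial (Fin 2) ℤ))) ∈ suppOn ℤ S := by
    rw [oneVar]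
    split_ifs
    · exact hvar 1 one_ne_zero
    · rw [map_zero, map_zero]
      exact AddSubgroup.zero_mem _
  have hG : PowerSeries.mk (fun n => (MvPolynomial.X 0 : MvPolynomial ℕ (MvPolynomial (Fin 2) ℤ)) ^ n) =
      seriesInv (-PowerSeries.C (MvPolynomial.X 0)) := by
    refine seriesInv_eq_of_mul ?_
    ext1 n
    cases n with
    | zero => simp
    | succ n =>
      have : (1 + PowerSeries.X * -PowerSeries.C (MvPolynomial.X 0)) * PowerSeries.mk
          (fun n => (MvPolynomial.X 0 : MvPolynomial ℕ (MvPolynomial (Fin 2) ℤ)) ^ n) =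
          PowerSeries.mk (fun n => MvPolynomial.X 0 ^ n) - PowerSeries.X *
            (PowerSeries.C (MvPolynomial.X 0) * PowerSeries.mk fun n => MvPolynomial.X 0 ^ n) := by
        ring
      rw [this, map_sub, PowerSeries.coeff_succ_X_mul, PowerSeries.coeff_C_mul,
        PowerSeries.coeff_mk, PowerSeries.coeff_mk, PowerSeries.coeff_one,
        if_neg (Nat.succ_ne_zero n), pow_succ']
      exact sub_self _
  have h1 : polyToSer (seriesInv (polyRecip r f) -
      seriesInv (-PowerSeries.C (MvPolynomial.X 0))) ∈ suppOn ℤ S := by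
    rw [seriesInv_sub]
    have h2 : PowerSeries.X * (-PowerSeries.C (MvPolynomial.X 0) - polyRecip r f) =
        f * -(PowerSeries.X * PowerSeries.C (MvPolynomial.C (2 * (MvPolynomial.X 1 + 1)))) +
        PowerSeries.C (oneVar r _) * -(PowerSeries.X *
          PowerSeries.C (MvPolynomial.C (MvPolynomial.X 1 - MvPolynomial.X 0))) := by
      rw [polyRecip]
      ring
    rw [h2]
    refine hmul _ _ ?_
    rw [map_add]
    exact AddSubgroup.add_mem _ (hmul _ _ hfS) (hmul _ _ hone)
  have hexpo : τ.expo = Finsupp.single 0 τ.rank := by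
    rw [ChainType.expo, hτ, map_zero, add_zero]
  have h2 : (PowerSeries.coeff τ.expo.degree (seriesInv (polyRecip r f) -
      seriesInv (-PowerSeries.C (MvPolynomial.X 0)))).coeff τ.expo = 0 := by
    ext e
    by_contra h
    obtain ⟨j, hj, hj'⟩ := h1 (e, τ.expo.degree, τ.expo)
      (by rw [coef_polyToSer]; simpa using h)
    simp only [hexpo] at hj'
    simp [hj.symm] at hj'
  rw [map_sub, MvPolynomial.coeff_sub, sub_eq_zero] at h2
  rw [chainPoly, h2, ← hG, PowerSeries.coeff_mk, hexpo, Finsupp.degree_single]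
  simp [MvPolynomial.X_pow_eq_monomial]

end Universal

/-! ### Existence of arrangements of each chain type -/

section Positivity
variable {R : Type*} [CommSemiring R] (s : Bool → ℕ → R) (ye yl : Bool → R)

/-- One reading is singled out: the pending chain takes the next `i + 1` vertices and closes. All
other readings go into `P`; over a semiring without cancellation they can do no harm. -/
theorem exists_queueSum_replicate_succ (b : Bool) (bs : List Bool) (i k : ℕ) :
    ∃ P, queueSum s ye yl (List.replicate (i + 1) b ++ bs) [(b, k)] =
      ye b ^ (i + 1) * s b (k + (i + 1)) * queueSum s ye yl bs [] + P := by
  induction i generalizing k with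
  | zero =>
    refine ⟨s b 1 * queueSum s ye yl bs [(b, k)] + queueSum s ye yl bs [(b, k), (b, 1)] +
      ye b * queueSum s ye yl bs [(b, k + 1)], ?_⟩
    simp only [List.replicate_succ, List.replicate_zero, List.cons_append, List.nil_append,
      queueSum, if_true, zero_add, pow_one]
    ring
  | succ i ih =>
    obtain ⟨P, hP⟩ := ih (k + 1)
    set bs' := List.replicate (i + 1) b ++ bs with hbs
    refine ⟨s b 1 * queueSum s ye yl bs' [(b, k)] + queueSum s ye yl bs' [(b, k), (b, 1)] +
      ye b * (s b (k + 1) * queueSum s ye yl bs' [] + P), ?_⟩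
    rw [List.replicate_succ, List.cons_append, ← hbs]
    simp only [queueSum, if_true, List.cons_append, List.nil_append]
    rw [hP, show k + 1 + (i + 1) = k + (i + 1 + 1) by ring]
    ring

theorem exists_queueSum_replicate (b : Bool) (bs : List Bool) (j : ℕ) :
    ∃ P, queueSum s ye yl (List.replicate (j + 1) b ++ bs) [] =
      ye b ^ j * s b (j + 1) * queueSum s ye yl bs [] + P := by
  cases j with
  | zero =>
    refine ⟨ye b * yl b * queueSum s ye yl bs [] + 2 * queueSum s ye yl bs [(b, 1)], ?_⟩
    simp only [List.replicate_succ, List.replicate_zero, List.cons_append, List.nil_append,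
      queueSum, zero_add]
    ring
  | succ j =>
    obtain ⟨P, hP⟩ := exists_queueSum_replicate_succ s ye yl b bs j 1
    set bs' := List.replicate (j + 1) b ++ bs with hbs
    refine ⟨(s b 1 + ye b * yl b) * queueSum s ye yl bs' [] + P +
      queueSum s ye yl bs' [(b, 1)], ?_⟩
    rw [List.replicate_succ, List.cons_append, ← hbs]
    simp only [queueSum]
    rw [two_mul, hP, show 1 + (j + 1) = j + 1 + 1 by ring]
    ring

variable (mon : Multiplicative Expo →* R)

/-- The chains are laid out as consecutive blocks, followed by the loops. -/
theorem exists_queueSum_chainType {r : ℕ} (ν : ℕ) (μ : Multiset ℕ)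
    (hμ : ∀ j ∈ μ, 0 < j ∧ j ≤ r) :
    ∃ P, queueSum (chainWt mon r) (edgeWt mon) (loopWt mon) (List.replicate (ν + μ.sum) true) [] =
      mon (.ofAdd (0, ν + μ.card, Finsupp.single 0 ν + Multiset.toFinsupp μ)) + P := by
  induction μ using Multiset.induction_on with
  | empty =>
    induction ν with
    | zero =>
      refine ⟨0, ?_⟩
      simp only [Multiset.sum_zero, add_zero, List.replicate_zero, queueSum, Multiset.card_zero,
        map_zero, Finsupp.single_zero]
      exact (map_one mon).symm
    | succ ν ih =>
      obtain ⟨P, hP⟩ := ih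
      simp only [Multiset.sum_zero, add_zero, Multiset.card_zero, map_zero] at hP ⊢
      set bs := List.replicate ν true
      refine ⟨loopWt mon true * P + chainWt mon r true 1 *
        queueSum (chainWt mon r) (edgeWt mon) (loopWt mon) bs [] +
        2 * queueSum (chainWt mon r) (edgeWt mon) (loopWt mon) bs [(true, 1)], ?_⟩
      have h1 : mon (.ofAdd (0, ν + 1, Finsupp.single 0 (ν + 1))) =
          loopWt mon true * mon (.ofAdd (0, ν, Finsupp.single 0 ν)) := by
        rw [loopWt, if_pos rfl, ← map_mul, ← ofAdd_add, Prod.mk_add_mk, Prod.mk_add_mk,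
          ← Finsupp.single_add, add_comm 1, zero_add]
      rw [h1, List.replicate_succ]
      simp only [queueSum]
      have h2 : edgeWt mon true = 1 := rfl
      rw [h2, one_mul, add_mul, hP]
      ring
  | cons j μ ih =>
    obtain ⟨P, hP⟩ := ih fun i hi => hμ i (Multiset.mem_cons_of_mem hi)
    obtain ⟨hj, hjr⟩ := hμ j (Multiset.mem_cons_self j μ)
    obtain ⟨i, rfl⟩ : ∃ i, j = i + 1 := ⟨j - 1, by omega⟩
    obtain ⟨P', hP'⟩ := exists_queueSum_replicate (chainWt mon r) (edgeWt mon) (loopWt mon) true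
      (List.replicate (ν + μ.sum) true) i
    refine ⟨chainWt mon r true (i + 1) * P + P', ?_⟩
    have h1 : mon (.ofAdd (0, ν + (μ.card + 1), Finsupp.single 0 ν +
          (Finsupp.single (i + 1) 1 + Multiset.toFinsupp μ))) =
        chainWt mon r true (i + 1) *
          mon (.ofAdd (0, ν + μ.card, Finsupp.single 0 ν + Multiset.toFinsupp μ)) := by
      rw [chainWt, if_pos rfl, if_pos hjr, ← map_mul, ← ofAdd_add, Prod.mk_add_mk, Prod.mk_add_mk,
        zero_add, add_left_comm (Finsupp.single 0 ν), ← add_assoc ν, add_comm 1]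
    rw [Multiset.sum_cons, Multiset.card_cons, ← Multiset.singleton_add, map_add,
      Multiset.toFinsupp_singleton, h1, ← add_assoc, add_comm ν, add_assoc, List.replicate_add, hP', hP]
    have h2 : edgeWt mon true = 1 := rfl
    rw [h2, one_pow, one_mul]
    ring

/-- There are arrangements of every chain type. -/
theorem hCount_zero_pos {r : ℕ} (τ : ChainType r) : 0 < hCount τ 0 0 := by
  classical
  -- Coefficients in `ℕ` cannot cancel, so one reading with the right monomial makes the whole
  -- coefficient positive.
  set φ : AddMonoidAlgebra ℕ Expo →+ ℕ :=
    { toFun := fun f => f.coeff (0, τ.expo.degree, τ.expo)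
      map_zero' := rfl
      map_add' := fun _ _ => rfl } with hφ
  have hφ' : ∀ d, φ (AddMonoidAlgebra.of ℕ Expo (.ofAdd d)) =
      if d = (0, τ.expo.degree, τ.expo) then 1 else 0 := by
    intro d
    change (AddMonoidAlgebra.single d 1).coeff _ = _
    rw [AddMonoidAlgebra.coeff_single, Finsupp.single_apply]
  have h1 := map_queueSum_total (AddMonoidAlgebra.of ℕ Expo) φ τ 0 hφ'
  simp only [Finsupp.coe_zero, Pi.zero_apply, Nat.cast_id] at h1
  change 0 < hCount τ (0 + 0) 0
  rw [← h1, map_sum]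
  obtain ⟨P, hP⟩ := exists_queueSum_chainType (AddMonoidAlgebra.of ℕ Expo) (r := r) τ.rank
    τ.partition.parts fun j hj => ⟨τ.partition.parts_pos hj, by
      by_contra! h
      exact Multiset.count_ne_zero.mpr hj (τ.mult_of_lt h)⟩
  rw [τ.partition.parts_sum, τ.rank_add_size, ← τ.degree_expo, ← ChainType.expo] at hP
  refine (Nat.lt_of_lt_of_le ?_ (Finset.single_le_sum (fun _ _ => Nat.zero_le _)
    (Finset.mem_univ fun _ => true)))
  have h2 : queueSum (chainWt (AddMonoidAlgebra.of ℕ Expo) r) (edgeWt _) (loopWt _)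
      (List.ofFn fun _ : Fin (r + (0 + 0)) => true) [] = _ :=
    (congrArg (queueSum _ _ _ · []) (List.ofFn_const r true)).trans hP
  refine lt_of_lt_of_eq ?_ (congrArg φ h2).symm
  rw [map_add, hφ', if_pos rfl]
  omega

end Positivity

/-! ### Rescaling the variables in the fraction field -/

section ScaleVars
variable {A K : Type*} [CommRing A] [CommRing K]

/-- The ring homomorphism that applies `φ` to the coefficients and multiplies every variable by a
constant. -/
noncomputable def scaleVars (φ : A →+* K) (c : ℕ → K) : MvPolynomial ℕ A →+* MvPolynomial ℕ K :=
  MvPolynomial.eval₂Hom (MvPolynomial.C.comp φ) fun j => MvPolynomial.C (c j) * MvPolynomial.X j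

theorem scaleVars_C (φ : A →+* K) (c : ℕ → K) (a : A) :
    scaleVars φ c (MvPolynomial.C a) = MvPolynomial.C (φ a) := by
  simp [scaleVars]

theorem scaleVars_X (φ : A →+* K) (c : ℕ → K) (j : ℕ) :
    scaleVars φ c (MvPolynomial.X j) = MvPolynomial.C (c j) * MvPolynomial.X j := by
  simp [scaleVars]

theorem coeff_scaleVars (φ : A →+* K) (c : ℕ → K) (p : MvPolynomial ℕ A) (σ : ℕ →₀ ℕ) :
    (scaleVars φ c p).coeff σ = (σ.prod fun j k => c j ^ k) * φ (p.coeff σ) := by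
  induction p using MvPolynomial.induction_on' with
  | monomial u a =>
    have h : scaleVars φ c (MvPolynomial.monomial u a) =
        MvPolynomial.monomial u (φ a * u.prod fun j k => c j ^ k) := by
      rw [scaleVars, MvPolynomial.coe_eval₂Hom, MvPolynomial.eval₂_monomial,
        MvPolynomial.monomial_eq, map_mul]
      simp only [mul_pow, Finsupp.prod, map_prod, map_pow, RingHom.comp_apply,
        Finset.prod_mul_distrib, mul_assoc]
    rw [h, MvPolynomial.coeff_monomial, MvPolynomial.coeff_monomial]
    split_ifs with hu
    · rw [hu, mul_comm]
    · rw [map_zero, mul_zero]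
  | add p q hp hq => rw [map_add, MvPolynomial.coeff_add, hp, hq, MvPolynomial.coeff_add, map_add, mul_add]

end ScaleVars

theorem toField_injective : Function.Injective toField :=
  IsFractionRing.injective (MvPowerSeries (Fin 2) ℚ) SeriesField

theorem toField_ne_zero {f : MvPowerSeries (Fin 2) ℚ} (hf : f ≠ 0) : toField f ≠ 0 :=
  (map_ne_zero_iff toField toField_injective).mpr hf

theorem fieldQ_ne_zero : fieldQ ≠ 0 :=
  toField_ne_zero (left_ne_zero_of_mul_eq_one serQ_mul_inv)

theorem toField_two : toField 2 = 2 := map_ofNat toField 2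

theorem two_ne_zero_field : (2 : SeriesField) ≠ 0 := by
  rw [← toField_two]
  exact toField_ne_zero two_ne_zero_ser

theorem toField_serU : toField serU = fieldU := by
  rw [fieldU, eq_div_iff (mul_ne_zero two_ne_zero_field fieldQ_ne_zero)]
  simpa [fieldX, fieldY, fieldQ, toField_two] using congrArg toField serU_mul

theorem toField_serV : toField serV = fieldV := by
  rw [fieldV, eq_div_iff (mul_ne_zero two_ne_zero_field fieldQ_ne_zero)]
  simpa [fieldX, fieldY, fieldQ, toField_two] using congrArg toField serV_mul

theorem fieldU_ne_zero : fieldU ≠ 0 := by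
  rw [← toField_serU]
  exact toField_ne_zero (left_ne_zero_of_mul_eq_one serU_mul_inv)

theorem serV_mul_ne_zero : serV * (serV + 1) * serQ ^ 2 ≠ 0 := by
  rw [← X_one_eq]
  intro h
  have h1 := congrArg (MvPowerSeries.coeff (Finsupp.single 1 1)) h
  rw [MvPowerSeries.coeff_index_single_self_X, map_zero] at h1
  exact one_ne_zero h1

theorem fieldV_ne_zero : fieldV ≠ 0 := by
  rw [← toField_serV]
  exact toField_ne_zero (left_ne_zero_of_mul (left_ne_zero_of_mul serV_mul_ne_zero))

theorem fieldV_add_one_ne_zero : fieldV + 1 ≠ 0 := by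
  rw [← toField_serV, ← map_one toField, ← map_add]
  exact toField_ne_zero (right_ne_zero_of_mul (left_ne_zero_of_mul serV_mul_ne_zero))

theorem fieldEta_eq : fieldEta = fieldV * (fieldV + 1) := by
  rw [fieldEta, div_eq_iff (pow_ne_zero 2 fieldQ_ne_zero), fieldY, X_one_eq]
  simp [toField_serV, fieldQ]

theorem fieldU_add_fieldV : (fieldU + fieldV) * fieldQ = 1 := by
  simpa [toField_serU, toField_serV, fieldQ] using congrArg toField serU_add_serV

/-- `(v + 1) Q` in the field. -/
noncomputable def fieldW : SeriesField := (fieldV + 1) * fieldQ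

theorem toField_serW : toField serW = fieldW := by
  rw [serW, fieldW, map_mul, map_add, map_one, toField_serV, fieldQ]

theorem fieldW_ne_zero : fieldW ≠ 0 := mul_ne_zero fieldV_add_one_ne_zero fieldQ_ne_zero

theorem toField_serW_inv : toField serW⁻¹ = fieldW⁻¹ := by
  refine eq_inv_of_mul_eq_one_right ?_
  rw [← toField_serW, ← map_mul, serW_mul_inv, map_one]

/-- The factors of the variables recording the numbers of loops and of chains. -/
noncomputable def varFactor (j : ℕ) : SeriesField :=
  if j = 0 then fieldU + fieldV else fieldU * fieldV * fieldW⁻¹ ^ (j - 1)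

/-- The substitution of `-1/u` and `1/v` for `z` and `w`, together with the scaling. -/
noncomputable def specialize :
    MvPolynomial ℕ (MvPolynomial (Fin 2) ℤ) →+* MvPolynomial ℕ SeriesField :=
  scaleVars (MvPolynomial.aeval ![-1 / fieldU, 1 / fieldV] :
    MvPolynomial (Fin 2) ℤ →ₐ[ℤ] SeriesField).toRingHom varFactor

theorem specialize_C (p : MvPolynomial (Fin 2) ℤ) : specialize (MvPolynomial.C p) =
    MvPolynomial.C (MvPolynomial.aeval ![-1 / fieldU, 1 / fieldV] p) := scaleVars_C _ _ _

theorem specialize_X (j : ℕ) :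
    specialize (MvPolynomial.X j) = MvPolynomial.C (varFactor j) * MvPolynomial.X j :=
  scaleVars_X _ _ _

theorem aeval_X_zero : MvPolynomial.aeval ![-1 / fieldU, 1 / fieldV]
    (MvPolynomial.X 0 : MvPolynomial (Fin 2) ℤ) = -1 / fieldU := by
  rw [MvPolynomial.aeval_X]; rfl

theorem aeval_X_one : MvPolynomial.aeval ![-1 / fieldU, 1 / fieldV]
    (MvPolynomial.X 1 : MvPolynomial (Fin 2) ℤ) = 1 / fieldV := by
  rw [MvPolynomial.aeval_X]; rfl

/-! ### Comparison of the two equations and the degree of the polynomials -/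

section Comparison
variable {r : ℕ} {f : Ser ℚ} {g : PowerSeries (MvPolynomial ℕ (MvPolynomial (Fin 2) ℤ))}

/-- After rescaling both sides are fixed points of the same contraction over the field, hence equal.
-/
theorem map_toField_eq (hf : perturb r (MvPolynomial.C serU) (MvPolynomial.C (serU + serV)) 1
      (MvPolynomial.C (serV + 1)) sizeVar f = f) (hg : polyPerturb r g = g) :
    PowerSeries.map (MvPolynomial.map toField) f =
      PowerSeries.C (MvPolynomial.C (1 / fieldV)) * PowerSeries.map specialize g := by
  have hV := fieldV_ne_zero
  have hU := fieldU_ne_zero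
  refine (isContraction_perturb r (MvPolynomial.C fieldU)
    (MvPolynomial.C fieldU + MvPolynomial.C fieldV) 1 (MvPolynomial.C fieldV + 1)
    (fun j => MvPolynomial.C (fieldW⁻¹ ^ (j - 1)) * MvPolynomial.X j)).unique ?_ ?_
  · nth_rewrite 2 [← hf]
    rw [map_perturb]
    simp only [sizeVar, map_mul, map_add, map_one, map_pow, MvPolynomial.map_C, MvPolynomial.map_X,
      toField_serU, toField_serV, toField_serW_inv]
  · rw [perturb_scale r (z := MvPolynomial.C (-1 / fieldU))
      (by rw [← map_mul, mul_one_div_cancel hV, map_one])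
      (by rw [← map_mul, mul_div_cancel₀ _ hU, map_neg, map_one])]
    nth_rewrite 2 [← hg]
    rw [polyPerturb, map_perturb]
    simp only [map_one, specialize_C, map_sub, map_add, aeval_X_zero, aeval_X_one]
    rw [perturb_congr]
    intro j hj
    have := (Finset.mem_Icc.mp hj).1
    rw [specialize_X, varFactor, if_neg (by omega), map_mul, map_mul]
    ring

/-- The scaling factors match because `(v+1)/v = 1/v + 1` and `(1/v + 1/u)uv = u + v`. -/
theorem map_recipSeries (h : PowerSeries.map (MvPolynomial.map toField) f =
      PowerSeries.C (MvPolynomial.C (1 / fieldV)) * PowerSeries.map specialize g) :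
    PowerSeries.map (MvPolynomial.map toField) (recipSeries r f) =
      PowerSeries.map specialize (polyRecip r g) := by
  have hV := fieldV_ne_zero
  have hU := fieldU_ne_zero
  have h1 : specialize (oneVar r _) = MvPolynomial.C (fieldU * fieldV) * oneVar r _ := by
    rw [oneVar, oneVar]
    split_ifs
    · rw [specialize_X, varFactor]
      simp
    · simp
  have h2 : MvPolynomial.map toField (oneVar r _) = oneVar r _ := by
    rw [oneVar, oneVar]
    split_ifs <;> simp
  rw [recipSeries, polyRecip]
  simp only [map_add, map_mul, map_sub, h, serC, RingHom.comp_apply, PowerSeries.map_C,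
    MvPolynomial.map_C, h1, h2, MvPolynomial.map_X, specialize_C, specialize_X, aeval_X_zero,
    aeval_X_one, toField_serU, toField_serV, map_one, map_ofNat]
  have h3 : varFactor 0 = fieldU + fieldV := if_pos rfl
  rw [h3]
  have h4 : (fieldV + 1) * (1 / fieldV) = 1 / fieldV + 1 := by
    field_simp
    ring
  have h5 : (1 / fieldV - -1 / fieldU) * (fieldU * fieldV) = fieldU + fieldV := by
    field_simp
    ring
  have h4' := congrArg (fun x => PowerSeries.C (MvPolynomial.C (σ := ℕ) x)) h4
  have h5' := congrArg (fun x => PowerSeries.C (MvPolynomial.C (σ := ℕ) x)) h5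
  simp only [map_add, map_mul, map_sub, map_one] at h4' h5' ⊢
  linear_combination (2 * PowerSeries.map specialize g) * h4' -
    PowerSeries.C (oneVar r _) * h5'

/-- A part `j` contributes `uv` divided by the `(j-1)`-st power of `fieldW`; multiplying by its
`j`-th power leaves `uv * fieldW` for each part. -/
theorem prod_varFactor (τ : ChainType r) :
    fieldW ^ τ.size * (τ.expo.prod fun j k => varFactor j ^ k) =
      (fieldU + fieldV) ^ τ.rank * (fieldU * fieldV * fieldW) ^ τ.partition.parts.card := by
  have h1 : ∀ μ : Multiset ℕ, (∀ j ∈ μ, 0 < j) →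
      fieldW ^ μ.sum * ((Multiset.toFinsupp μ).prod fun j k => varFactor j ^ k) =
        (fieldU * fieldV * fieldW) ^ μ.card := by
    intro μ hμ
    induction μ using Multiset.induction_on with
    | empty => simp
    | cons j μ ih =>
      have h2 := ih fun i hi => hμ i (Multiset.mem_cons_of_mem hi)
      have hj := hμ j (Multiset.mem_cons_self j μ)
      obtain ⟨i, rfl⟩ : ∃ i, j = i + 1 := ⟨j - 1, by omega⟩
      have h3 : fieldW ^ (i + 1) * varFactor (i + 1) = fieldU * fieldV * fieldW := by
        rw [varFactor, if_neg (Nat.succ_ne_zero i), Nat.add_sub_cancel, inv_pow, pow_succ]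
        field_simp [fieldW_ne_zero]
      rw [← Multiset.singleton_add, map_add, Multiset.toFinsupp_singleton, Multiset.sum_add,
        Multiset.card_add, Multiset.sum_singleton, Multiset.card_singleton,
        Finsupp.prod_add_index' (h := fun j k => varFactor j ^ k) (fun _ => pow_zero _)
          (fun _ => pow_add _),
        Finsupp.prod_single_index (h := fun j k => varFactor j ^ k) (pow_zero _), pow_one,
        pow_add _ _ μ.sum, pow_add _ 1, pow_one, ← h2, ← h3]
      ring
  rw [ChainType.expo, Finsupp.prod_add_index' (h := fun j k => varFactor j ^ k)
      (fun _ => pow_zero _) (fun _ => pow_add _),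
    Finsupp.prod_single_index (h := fun j k => varFactor j ^ k) (pow_zero _), ← h1 _ fun j hj => τ.partition.parts_pos hj,
    τ.partition.parts_sum, varFactor, if_pos rfl]
  ring

/-- The formula for `H^τ` with denominators cleared. The factor `(u+v)^ν` from the loops cancels
against `Q^ν`, and the remaining `Q` comes from `A = Q⁻¹ * seriesInv (recipSeries r f)`. -/
theorem intToField_genH (τ : ChainType r) (hg : polyPerturb r g = g) :
    fieldW ^ τ.size * (fieldQ ^ (τ.rank + 1) * intToField (genH τ)) =
      (fieldU * fieldV * fieldW) ^ τ.partition.parts.card *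
        MvPolynomial.aeval ![-1 / fieldU, 1 / fieldV] (chainPoly τ g) := by
  obtain ⟨f, hf⟩ := (isContraction_perturb r (MvPolynomial.C serU) (MvPolynomial.C (serU + serV)) 1
    (MvPolynomial.C (serV + 1)) sizeVar).exists_fixpoint
  have h1 := congrArg (fun F => (PowerSeries.coeff τ.expo.degree F).coeff τ.expo)
    (congrArg seriesInv (map_recipSeries (r := r) (map_toField_eq hf hg)))
  simp only [← map_seriesInv, PowerSeries.coeff_map, MvPolynomial.coeff_map] at h1
  rw [specialize, coeff_scaleVars] at h1
  have h2 := congrArg toField (coeff_generating τ hf)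
  rw [map_mul, h1] at h2
  have h3 : fieldQ * toField serQ⁻¹ = 1 := by rw [fieldQ, ← map_mul, serQ_mul_inv, map_one]
  have h4 := prod_varFactor τ
  have h5 : fieldQ ^ τ.rank * (fieldU + fieldV) ^ τ.rank = 1 := by
    rw [← mul_pow, mul_comm fieldQ, fieldU_add_fieldV, one_pow]
  rw [intToField, RingHom.comp_apply, ← h2, chainPoly, pow_succ]
  set a := (MvPolynomial.aeval ![-1 / fieldU, 1 / fieldV] : MvPolynomial (Fin 2) ℤ →ₐ[ℤ] SeriesField)
    (MvPolynomial.coeff τ.expo (PowerSeries.coeff τ.expo.degree (seriesInv (polyRecip r g)))) with ha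
  change fieldW ^ τ.size * (fieldQ ^ τ.rank * fieldQ * (toField serQ⁻¹ * (_ * a))) = _
  linear_combination (fieldW ^ τ.size * fieldQ ^ τ.rank *
    (τ.expo.prod fun j k => varFactor j ^ k) * a) * h3 + (fieldQ ^ τ.rank * a) * h4 +
    (fieldU * fieldV * fieldW) ^ τ.partition.parts.card * a * h5

theorem totalDegree_chainPoly (τ : ChainType r) (hg : polyPerturb r g = g) :
    (chainPoly τ g).totalDegree = τ.partition.parts.card := by
  set ℓ := τ.partition.parts.card with hℓ
  set P := chainPoly τ g with hP
  have hle : ∀ e ∈ P.support, e 0 + e 1 ≤ ℓ := by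
    intro e he
    have := degree_le_of_coeff_ne_zero hg τ (MvPolynomial.mem_support_iff.mp he)
    rwa [Finsupp.degree_eq_sum, Fin.sum_univ_two] at this
  -- If `w^ℓ` were missing, every term of `(uv)^ℓ P(-1/u, 1/v)` would contain a positive power of
  -- `v`, which has constant term `0`. But the constant term must be the number of arrangements of
  -- type `τ`, since those of `Q` and of `(v+1)Q` are `1`.
  have htop : Finsupp.single 1 ℓ ∈ P.support := by
    by_contra hn
    have hlt : ∀ e ∈ P.support, e 1 < ℓ := by
      intro e he
      have h1 := hle e he
      refine lt_of_le_of_ne (by omega) fun h2 => hn ?_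
      convert he
      ext i
      fin_cases i
      · simp
        omega
      · simp [h2]
    have h1 : (fieldU * fieldV) ^ ℓ * MvPolynomial.aeval ![-1 / fieldU, 1 / fieldV] P =
        toField (∑ e ∈ P.support, ((P.coeff e : ℤ) : MvPowerSeries (Fin 2) ℚ) * (-1) ^ e 0 *
          serU ^ (ℓ - e 0) * serV ^ (ℓ - e 1)) := by
      rw [MvPolynomial.aeval_def, MvPolynomial.eval₂_eq', map_sum, Finset.mul_sum]
      refine Finset.sum_congr rfl fun e he => ?_
      have h2 := hle e he
      have h3 : fieldU ^ ℓ = fieldU ^ (ℓ - e 0) * fieldU ^ e 0 := by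
        rw [← pow_add, Nat.sub_add_cancel (by omega)]
      have h4 : fieldV ^ ℓ = fieldV ^ (ℓ - e 1) * fieldV ^ e 1 := by
        rw [← pow_add, Nat.sub_add_cancel (by omega)]
      have h5 : fieldU ^ e 0 * (-1 / fieldU) ^ e 0 = (-1) ^ e 0 := by
        rw [← mul_pow, mul_div_cancel₀ _ fieldU_ne_zero]
      have h6 : fieldV ^ e 1 * (1 / fieldV) ^ e 1 = 1 := by
        rw [← mul_pow, mul_one_div_cancel fieldV_ne_zero, one_pow]
      rw [Fin.prod_univ_two, mul_pow, h3, h4]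
      simp only [map_mul, map_pow, map_neg, map_one, map_intCast, toField_serU, toField_serV,
        Matrix.cons_val_zero, Matrix.cons_val_one, eq_intCast]
      linear_combination (fieldU ^ (ℓ - e 0) * fieldV ^ (ℓ - e 1) * ((P.coeff e : ℤ) : SeriesField) *
        fieldV ^ e 1 * (1 / fieldV) ^ e 1) * h5 + (fieldU ^ (ℓ - e 0) * fieldV ^ (ℓ - e 1) *
        ((P.coeff e : ℤ) : SeriesField) * (-1) ^ e 0) * h6
    have h2 := intToField_genH τ hg
    rw [← hℓ, ← hP, mul_pow, mul_right_comm, h1, intToField, RingHom.comp_apply, fieldQ,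
      ← toField_serW, ← map_pow, ← map_pow, ← map_pow, ← map_mul, ← map_mul, ← map_mul] at h2
    have h3 := congrArg MvPowerSeries.constantCoeff (toField_injective h2)
    have h4 : MvPowerSeries.constantCoeff (MvPowerSeries.map (Int.castRingHom ℚ) (genH τ)) =
        (hCount τ 0 0 : ℚ) := by
      rw [MvPowerSeries.constantCoeff_map]
      exact map_natCast (Int.castRingHom ℚ) _
    simp only [map_mul, map_pow, constantCoeff_serW, constantCoeff_serQ, h4, one_pow, one_mul,
      mul_one, map_sum] at h3
    rw [Finset.sum_eq_zero] at h3
    · exact (hCount_zero_pos τ).ne' (by exact_mod_cast h3)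
    · intro e he
      rw [constantCoeff_serV, zero_pow (by have := hlt e he; omega), mul_zero]
  refine le_antisymm ?_ ?_
  · refine Finset.sup_le fun e he => ?_
    have := hle e he
    change e.degree ≤ ℓ
    rwa [Finsupp.degree_eq_sum, Fin.sum_univ_two]
  · have := MvPolynomial.le_totalDegree htop
    simpa using this

end Comparison

/-! ### Assembly of the theorem -/

theorem mainTheorem6 (r : ℕ) (τ : ChainType r) :
    ∃ P : MvPolynomial (Fin 2) ℤ,
      P.totalDegree = r - τ.degree ∧
      intToField (genH τ) =
        fieldEta ^ ((τ.rank : ℤ) - τ.degree) * fieldU ^ ((r : ℤ) - τ.degree) *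
          fieldV ^ ((r : ℤ) - τ.rank) *
          MvPolynomial.aeval ![-1 / fieldU, 1 / fieldV] P *
          fieldQ ^ (-1 - (τ.degree : ℤ)) ∧
      (τ.degree = r → P = 1) ∧
      (τ.rank < τ.degree → 2 * (MvPolynomial.X 1 + 1) ∣ P) := by
  obtain ⟨g, hg⟩ := (isContraction_polyPerturb r).exists_fixpoint
  have hle := τ.card_parts_le
  have hr := τ.rank_add_size
  have hdeg : τ.degree = r - τ.partition.parts.card := rfl
  refine ⟨chainPoly τ g, ?_, ?_, ?_, ?_⟩
  · rw [totalDegree_chainPoly τ hg]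
    omega
  · have h1 := intToField_genH τ hg
    -- With `ℓ` parts of total size `|μ|` one has `d = r - ℓ` and `r = ν + |μ|`, so all exponents
    -- are expressed through `ℓ`, `ν` and `|μ|`.
    have h2 : (τ.rank : ℤ) - τ.degree = (τ.partition.parts.card : ℕ) - (τ.size : ℕ) := by omega
    have h3 : (r : ℤ) - τ.degree = (τ.partition.parts.card : ℕ) := by omega
    have h4 : (r : ℤ) - τ.rank = (τ.size : ℕ) := by omega
    have h5 : -1 - (τ.degree : ℤ) =
        (τ.partition.parts.card : ℕ) - ((τ.rank + 1 + τ.size : ℕ) : ℤ) := by omega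
    have hV := fieldV_ne_zero
    have hV1 := fieldV_add_one_ne_zero
    have hQ := fieldQ_ne_zero
    rw [h2, h3, h4, h5, zpow_sub₀ (by rw [fieldEta_eq]; exact mul_ne_zero hV hV1), zpow_sub₀ hQ,
      fieldEta_eq]
    simp only [zpow_natCast]
    set a := MvPolynomial.aeval ![-1 / fieldU, 1 / fieldV] (chainPoly τ g)
    set ℓ := τ.partition.parts.card
    rw [fieldW] at h1
    simp only [mul_pow, pow_add] at h1 ⊢
    field_simp
    linear_combination h1
  · intro h
    refine chainPoly_eq_one hg τ (Multiset.card_eq_zero.mp ?_)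
    have := totalDegree_chainPoly τ hg
    omega
  · intro h
    -- The inequality `ν < d` means `ℓ < |μ|`, so the parts cannot all be equal to `1`.
    have h1 : ∃ j ∈ τ.partition.parts, 2 ≤ j := by
      by_contra! h1
      have h2 := Multiset.sum_le_card_nsmul τ.partition.parts 1 fun j hj => by
        have := h1 j hj
        omega
      rw [τ.partition.parts_sum, smul_eq_mul, mul_one] at h2
      omega
    obtain ⟨j, hj, hj2⟩ := h1
    refine dvd_chainPoly τ hj2 ?_
    rw [τ.expo_of_ne (by omega)]
    exact Multiset.count_ne_zero.mpr hj
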